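/- Let $\pi : E \to M$ be a smooth fiber bundle with $\dim M = n$ and $\dim E = n+m$, let $0 \le k < \infty$, and write $J^l = J^l\pi$ for the manifold (for $l = \infty$: the inverse limit of the manifolds $J^i$, $i<\infty$) of $l$-jets of local sections of $\pi$, and $\pi_l : J^l \to M$, $0\le l \le \infty$, for the projection. Let $\nabla : J^k \to J^1\pi_k$ be a connection in $\pi_k$, that is, a smooth section of $J^1\pi_k \to J^k$. Assume that $\nabla$ is flat, i.e. $[X^\nabla, Y^\nabla] = [X,Y]^\nabla$ for all smooth vector fields $X, Y$ on $M$, where $X^\nabla$ is the horizontal lift of $X$ to $J^k$, and holonomic, i.e. it takes its values in $J^{k+1} \subset J^1\pi_k$ (where $j_{k+1}s(x)$ is identified with $j_1(j_k s)(x)$). Then for every $\theta \in J^k$, $x = \pi_k(\theta)$, there is a local section $s_\theta$ of $\pi$ around $x$, with a uniquely determined germ at $x$, such that $j_k s_\theta (x) = \theta$ and $j_k s_\theta$ is $\nabla$-constant near $x$, i.e. $\nabla \circ j_k s_\theta = j_1(j_k s_\theta)$. For $0 \le r \le \infty$ define $$\nabla_{[r]} : J^k \to J^{k+r}, \qquad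 \nabla_{[r]}(\theta) = j_{k+r}s_\theta(x).$$ For every $0 \le r \le \infty$ the map $\nabla_{[r]}$ is a smooth closed embedding. (For $r = \infty$ this means: it is a homeomorphism onto a closed subset of the inverse limit $J^\infty$, its composition with each projection $J^\infty \to J^l$, $l < \infty$, is smooth, and near every point one of these compositions is an immersion.) Moreover $\nabla_{[r]}$ covers the identity of $M$, and in all fibered coordinates $(x^i, u^\alpha)$ of $\pi$, with induced jet coordinates $u^\alpha_I(j_l s(x)) = \partial^{|I|}s^\alpha/\partial x^I(x)$, it is given by $$\nabla_{[r]}^*(u^\alpha_I) = \nabla_I u^\alpha, \qquad |I| \le k+r,$$ where $\nabla_I f = \nabla_{i_1}\cdots\nabla_{i_s} f$ for $I = (i_1,\dots,i_s)$ and $\nabla_i$ is the horizontal lift to $J^k$ of the coordinate field $\partial/\partial x^i$. -/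

import Mathlib

open Set Filter Topology Manifold
open scoped ContDiff

noncomputable section

namespace JetBundle

section Calculus

variable {B : Type*} [NormedAddCommGroup B] [NormedSpace ℝ B]
  {V : Type*} [NormedAddCommGroup V] [NormedSpace ℝ V]
  {W : Type*} [NormedAddCommGroup W] [NormedSpace ℝ W]

theorem iteratedFDeriv_param {X : Type*} [NormedAddCommGroup X] [NormedSpace ℝ X]
    {H : X → B → V} {U : Set (X × B)} (hU : IsOpen U)
    (h : ContDiffOn ℝ ∞ (Function.uncurry H) U) (j : ℕ) :
    ContDiffOn ℝ ∞ (fun z : X × B => iteratedFDeriv ℝ j (H z.1) z.2) U := by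
  induction j with
  | zero =>
    simp only [iteratedFDeriv_zero_eq_comp]
    exact (continuousMultilinearCurryFin0 ℝ B V).symm.contDiff.comp_contDiffOn h
  | succ j ih =>
    simp only [iteratedFDeriv_succ_eq_comp_left]
    have hL : ContDiff ℝ ∞ ⇑(continuousMultilinearCurryLeftEquiv ℝ
        (fun _ : Fin (j + 1) => B) V).symm :=
      LinearIsometryEquiv.contDiff (𝕜 := ℝ) (E := B →L[ℝ] B [×j]→L[ℝ] V)
        (F := B [×(j + 1)]→L[ℝ] V)
        (continuousMultilinearCurryLeftEquiv ℝ (fun _ : Fin (j + 1) => B) V).symm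
    refine hL.comp_contDiffOn ?_
    intro z hz
    have h1 : ContDiffAt ℝ ∞ (fun z : X × B => iteratedFDeriv ℝ j (H z.1) z.2) z :=
      ih.contDiffAt (hU.mem_nhds hz)
    have h2 : ContDiffAt ℝ ∞ (Function.uncurry
        (fun (z : X × B) (y : B) => iteratedFDeriv ℝ j (H z.1) y)) (z, z.2) := by
      have h3 : ContDiffAt ℝ ∞ (fun w : (X × B) × B => (w.1.1, w.2)) (z, z.2) := by fun_prop
      exact ContDiffAt.comp (z, z.2) (f := fun w : (X × B) × B => (w.1.1, w.2))
        (g := fun z : X × B => iteratedFDeriv ℝ j (H z.1) z.2) h1 h3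
    exact (ContDiffAt.fderiv h2 contDiffAt_snd (by simp)).contDiffWithinAt

theorem taylorComp_congr {q q' : FormalMultilinearSeries ℝ V W}
    {p p' : FormalMultilinearSeries ℝ B V} {i : ℕ} (hq : ∀ j ≤ i, q j = q' j)
    (hp : ∀ j ≤ i, p j = p' j) : q.taylorComp p i = q'.taylorComp p' i := by
  simp only [FormalMultilinearSeries.taylorComp]
  refine Finset.sum_congr rfl fun c _ => ?_
  simp only [FormalMultilinearSeries.compAlongOrderedFinpartition]
  rw [hq _ c.length_le]
  congr 1
  funext m
  exact hp _ (c.partSize_le m)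

theorem iteratedFDeriv_swap_zero_one {j : ℕ} {f : B → V} {x : B}
    (hf : ContDiffAt ℝ ((j + 2 : ℕ) : ℕ∞) f x) (v : Fin (j + 2) → B) :
    iteratedFDeriv ℝ (j + 2) f x v =
      fderiv ℝ (fderiv ℝ (iteratedFDeriv ℝ j f)) x (v 0) (v 1) (fun i => v i.succ.succ) := by
  have h1 : DifferentiableAt ℝ (iteratedFDeriv ℝ (j + 1) f) x :=
    (hf.iteratedFDeriv_right (m := 1) (i := j + 1)
      (by norm_cast; omega)).differentiableAt (by simp)
  rw [h1.iteratedFDeriv_succ_apply_left']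
  simp only [iteratedFDeriv_succ_apply_left]
  have h2 : DifferentiableAt ℝ (fderiv ℝ (iteratedFDeriv ℝ j f)) x :=
    ((hf.iteratedFDeriv_right (m := 2) (i := j)
      (le_of_eq (by norm_num; exact add_comm _ _))).fderiv_right (m := 1) (by norm_num)).differentiableAt (by simp)
  have h3 : HasFDerivAt (fun y => fderiv ℝ (iteratedFDeriv ℝ j f) y (Fin.tail v 0)
      (Fin.tail (Fin.tail v))) _ x :=
    ((h2.hasFDerivAt.clm_apply (hasFDerivAt_const (Fin.tail v 0) x)).continuousMultilinear_apply_const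
      (Fin.tail (Fin.tail v)))
  rw [h3.fderiv]
  simp [Fin.tail]
  rfl

theorem iteratedFDeriv_comp_perm_of_contDiffAt (j : ℕ) : ∀ {f : B → V} {x : B},
    ContDiffAt ℝ (j : ℕ∞) f x → ∀ (σ : Equiv.Perm (Fin j)) (v : Fin j → B),
    iteratedFDeriv ℝ j f x (v ∘ σ) = iteratedFDeriv ℝ j f x v := by
  induction j with
  | zero => intro f x _ σ v; congr 1; exact Subsingleton.elim _ _
  | succ j ih =>
    intro f x hf σ
    have hσ : σ ∈ Submonoid.closure
        (Set.range fun i : Fin j => Equiv.swap i.castSucc i.succ) := by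
      rw [Equiv.Perm.mclosure_swap_castSucc_succ]; trivial
    induction hσ using Submonoid.closure_induction with
    | one => intro v; rfl
    | mul a b _ _ ha hb =>
      intro v
      rw [← ha v, ← hb (v ∘ a)]; rfl
    | mem τ hτ =>
      obtain ⟨i, rfl⟩ := hτ
      intro v
      cases j with
      | zero => exact i.elim0
      | succ j =>
        rcases Fin.eq_zero_or_eq_succ i with rfl | ⟨i', rfl⟩
        · rw [iteratedFDeriv_swap_zero_one (by exact_mod_cast hf),
            iteratedFDeriv_swap_zero_one (by exact_mod_cast hf)]
          have hs : IsSymmSndFDerivAt ℝ (iteratedFDeriv ℝ j f) x :=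
            (hf.iteratedFDeriv_right (m := 2) (i := j)
              (le_of_eq (by push_cast; ring))).isSymmSndFDerivAt (by simp)
          have h0 : (v ∘ (Equiv.swap (Fin.castSucc (0 : Fin (j + 1))) (Fin.succ 0))) 0 = v 1 := by
            simp
          have h1 : (v ∘ (Equiv.swap (Fin.castSucc (0 : Fin (j + 1))) (Fin.succ 0))) 1 = v 0 := by
            simp
          rw [h0, h1, hs (v 1) (v 0)]
          congr 1
        · have hd : DifferentiableAt ℝ (iteratedFDeriv ℝ (j + 1) f) x :=
            (hf.iteratedFDeriv_right (m := 1) (i := j + 1)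
              (by norm_cast; omega)).differentiableAt (by simp)
          rw [hd.iteratedFDeriv_succ_apply_left', hd.iteratedFDeriv_succ_apply_left']
          have h0 : (v ∘ (Equiv.swap i'.succ.castSucc i'.succ.succ)) 0 = v 0 := by
            simp only [Function.comp_apply]
            rw [Equiv.swap_apply_of_ne_of_ne]
            · intro h; simp [Fin.ext_iff] at h
            · intro h; simp [Fin.ext_iff] at h
          have h1 : Fin.tail (v ∘ (Equiv.swap i'.succ.castSucc i'.succ.succ)) =
              Fin.tail v ∘ (Equiv.swap i'.castSucc i'.succ) := by
            funext l
            simp only [Fin.tail, Function.comp_apply]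
            congr 1
            rw [← Fin.succ_castSucc]
            exact ((Fin.succ_injective _).swap_apply _ _ _)
          rw [h0, h1]
          congr 1
          apply Filter.EventuallyEq.fderiv_eq
          have he := hf.eventually (by simp)
          filter_upwards [he] with y hy
          exact ih (hy.of_le (by norm_cast; omega)) _ _

theorem contact_comp {i : ℕ} {g : V → W} {f f' : B → V} {x : B}
    (hg : ContDiffAt ℝ ∞ g (f x)) (hf : ContDiffAt ℝ ∞ f x) (hf' : ContDiffAt ℝ ∞ f' x)
    (h : ∀ j ≤ i, iteratedFDeriv ℝ j f x = iteratedFDeriv ℝ j f' x) (hx : f x = f' x) :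
    iteratedFDeriv ℝ i (g ∘ f) x = iteratedFDeriv ℝ i (g ∘ f') x := by
  have hi : ((i : ℕ) : ℕ∞ω) ≤ ∞ := by exact_mod_cast le_top
  rw [iteratedFDeriv_comp hg hf hi, iteratedFDeriv_comp (hx ▸ hg) hf' hi, ← hx]
  exact taylorComp_congr (fun _ _ => rfl) h

theorem contact_precomp {i : ℕ} {g g' : V → W} {f : B → V} {x : B}
    (hg : ContDiffAt ℝ ∞ g (f x)) (hg' : ContDiffAt ℝ ∞ g' (f x)) (hf : ContDiffAt ℝ ∞ f x)
    (h : ∀ j ≤ i, iteratedFDeriv ℝ j g (f x) = iteratedFDeriv ℝ j g' (f x)) :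
    iteratedFDeriv ℝ i (g ∘ f) x = iteratedFDeriv ℝ i (g' ∘ f) x := by
  have hi : ((i : ℕ) : ℕ∞ω) ≤ ∞ := by exact_mod_cast le_top
  rw [iteratedFDeriv_comp hg hf hi, iteratedFDeriv_comp hg' hf hi]
  exact taylorComp_congr h (fun _ _ => rfl)

theorem contact_graph {i : ℕ} {f f' : B → V} {x : B}
    (hf : ContDiffAt ℝ ∞ f x) (hf' : ContDiffAt ℝ ∞ f' x)
    (h : iteratedFDeriv ℝ i f x = iteratedFDeriv ℝ i f' x) :
    iteratedFDeriv ℝ i (fun y => (y, f y)) x = iteratedFDeriv ℝ i (fun y => (y, f' y)) x := by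
  have hi : ((i : ℕ) : ℕ∞ω) ≤ ∞ := by exact_mod_cast le_top
  change iteratedFDeriv ℝ i (fun y => (id y, f y)) x = iteratedFDeriv ℝ i (fun y => (id y, f' y)) x
  rw [iteratedFDeriv_prodMk contDiffAt_id hf hi, iteratedFDeriv_prodMk contDiffAt_id hf' hi, h]

end Calculus

section JetModel

variable (B : Type*) [NormedAddCommGroup B] [NormedSpace ℝ B]
  (V : Type*) [NormedAddCommGroup V] [NormedSpace ℝ V]

/-- Symmetric `j`-linear maps from `B` to `V`. -/
def symmetricMaps (j : ℕ) : Submodule ℝ (B [×j]→L[ℝ] V) where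
  carrier := {p | ∀ (σ : Equiv.Perm (Fin j)) (v : Fin j → B), p (v ∘ σ) = p v}
  add_mem' := fun hp hq σ v => by simp [hp σ v, hq σ v]
  zero_mem' := fun σ v => rfl
  smul_mem' := fun c p hp σ v => by simp [hp σ v]

/-- The space of Taylor coefficients up to order `k` of maps from `B` to `V`: the components are
the symmetric multilinear maps given by the derivatives of order `0, …, k`. -/
def JetModel (k : ℕ) : Type _ := (j : Fin (k + 1)) → symmetricMaps B V j

instance (k : ℕ) : NormedAddCommGroup (JetModel B V k) :=
  inferInstanceAs (NormedAddCommGroup ((j : Fin (k + 1)) → symmetricMaps B V j))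

instance (k : ℕ) : NormedSpace ℝ (JetModel B V k) :=
  inferInstanceAs (NormedSpace ℝ ((j : Fin (k + 1)) → symmetricMaps B V j))

variable {B V}

/-- The component of order `j`, as a continuous linear map. -/
def JetModel.coeff {k : ℕ} (j : Fin (k + 1)) : JetModel B V k →L[ℝ] (B [×j]→L[ℝ] V) :=
  (symmetricMaps B V j).subtypeL ∘L
    (ContinuousLinearMap.proj (R := ℝ) (φ := fun j : Fin (k + 1) => symmetricMaps B V j) j)

/-- Averaging over all permutations, a projection onto the symmetric multilinear maps. -/
def symmetrize (j : ℕ) : (B [×j]→L[ℝ] V) →L[ℝ] symmetricMaps B V j :=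
  ContinuousLinearMap.codRestrict
    (((Nat.factorial j : ℝ))⁻¹ • ∑ σ : Equiv.Perm (Fin j),
      ((ContinuousMultilinearMap.domDomCongrₗᵢ ℝ B V σ).toContinuousLinearEquiv :
        (B [×j]→L[ℝ] V) →L[ℝ] (B [×j]→L[ℝ] V))) (symmetricMaps B V j) (by
    intro p τ v
    simp only [_root_.smul_apply, _root_.sum_apply, ContinuousLinearEquiv.coe_coe,
      LinearIsometryEquiv.coe_toContinuousLinearEquiv]
    congr 1
    rw [← Equiv.sum_comp (Equiv.mulLeft τ⁻¹)]
    refine Finset.sum_congr rfl fun σ _ => ?_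
    change p (fun i => v (τ ((τ⁻¹ * σ) i))) = p (fun i => v (σ i))
    simp)

theorem symmetrize_coe (j : ℕ) (p : symmetricMaps B V j) :
    symmetrize j (p : B [×j]→L[ℝ] V) = p := by
  apply Subtype.ext
  ext v
  change (((Nat.factorial j : ℝ))⁻¹ • ∑ σ : Equiv.Perm (Fin j),
      ((ContinuousMultilinearMap.domDomCongrₗᵢ ℝ B V σ).toContinuousLinearEquiv :
        (B [×j]→L[ℝ] V) →L[ℝ] (B [×j]→L[ℝ] V))) (p : B [×j]→L[ℝ] V) v = _
  simp only [_root_.smul_apply, _root_.sum_apply, ContinuousLinearEquiv.coe_coe,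
      LinearIsometryEquiv.coe_toContinuousLinearEquiv]
  have : ∀ σ : Equiv.Perm (Fin j), (ContinuousMultilinearMap.domDomCongrₗᵢ ℝ B V σ
      (p : B [×j]→L[ℝ] V)) v = (p : B [×j]→L[ℝ] V) v := fun σ => p.2 σ v
  simp only [this, Finset.sum_const, Finset.card_univ, Fintype.card_perm, Fintype.card_fin]
  rw [← Nat.cast_smul_eq_nsmul ℝ, smul_smul, inv_mul_cancel₀ (by positivity), one_smul]

theorem JetModel.contDiff_coeff {k : ℕ} (j : Fin (k + 1)) :
    ContDiff ℝ ∞ (fun p : JetModel B V k => (p j : B [×j]→L[ℝ] V)) :=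
  ContinuousLinearMap.contDiff (𝕜 := ℝ) (E := JetModel B V k) (F := B [×j]→L[ℝ] V)
    (JetModel.coeff j)

theorem JetModel.contDiffOn_iff {X : Type*} [NormedAddCommGroup X] [NormedSpace ℝ X] {k : ℕ}
    {f : X → JetModel B V k} {s : Set X} :
    ContDiffOn ℝ ∞ f s ↔ ∀ j : Fin (k + 1), ContDiffOn ℝ ∞ (fun x => (f x j : B [×j]→L[ℝ] V)) s := by
  refine ⟨fun h j => (JetModel.contDiff_coeff j).comp_contDiffOn h, fun h => ?_⟩
  refine (@contDiffOn_pi ℝ _ X _ _ s ∞ (Fin (k + 1)) _ (fun j => symmetricMaps B V j)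
    (fun j => inferInstance) (fun j => inferInstance) f).2 fun j => ?_
  have := (ContinuousLinearMap.contDiff (𝕜 := ℝ) (n := ∞) (E := B [×j]→L[ℝ] V)
    (F := symmetricMaps B V j) (symmetrize (j : ℕ))).comp_contDiffOn (h j)
  refine this.congr fun x _ => ?_
  exact (symmetrize_coe _ _).symm

/-- The Taylor coefficients of `f` at `a` up to order `k`: the derivatives of `f` at `a` (which are
symmetric already if `f` is smooth at `a`). -/
def taylorCoeff (k : ℕ) (f : B → V) (a : B) : JetModel B V k :=
  fun j => symmetrize j (iteratedFDeriv ℝ j f a)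

theorem taylorCoeff_coe {k : ℕ} {f : B → V} {a : B} (hf : ContDiffAt ℝ ∞ f a) (j : Fin (k + 1)) :
    (taylorCoeff k f a j : B [×j]→L[ℝ] V) = iteratedFDeriv ℝ j f a :=
  congrArg Subtype.val (symmetrize_coe (j : ℕ) ⟨iteratedFDeriv ℝ j f a, fun σ v =>
    iteratedFDeriv_comp_perm_of_contDiffAt j (hf.of_le (by exact_mod_cast le_top)) σ v⟩)

/-- The polynomial map with Taylor coefficients `p` at the point `a`. -/
def taylorPoly {k : ℕ} (a : B) (p : JetModel B V k) (y : B) : V :=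
  ∑ j : Fin (k + 1), ((Nat.factorial j : ℝ))⁻¹ • (p j : B [×j]→L[ℝ] V) (fun _ => y - a)

theorem contDiff_apply_diag {X : Type*} [NormedAddCommGroup X] [NormedSpace ℝ X] (j : ℕ) :
    ∀ {p : X → B [×j]→L[ℝ] V} {g : X → B}, ContDiff ℝ ∞ p → ContDiff ℝ ∞ g →
      ContDiff ℝ ∞ (fun x => p x (fun _ => g x)) := by
  induction j with
  | zero =>
    intro p g hp _
    have := (ContinuousMultilinearMap.apply ℝ (fun _ : Fin 0 => B) V
      (fun i : Fin 0 => i.elim0)).contDiff (n := ∞) |>.comp hp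
    convert this using 2 with x
    simp only [Function.comp_apply, ContinuousMultilinearMap.apply_apply]
    congr 1
    exact Subsingleton.elim _ _
  | succ j ih =>
    intro p g hp hg
    have hL : ContDiff ℝ ∞ ⇑(continuousMultilinearCurryLeftEquiv ℝ
        (fun _ : Fin (j + 1) => B) V) :=
      LinearIsometryEquiv.contDiff (𝕜 := ℝ) (F := B →L[ℝ] B [×j]→L[ℝ] V)
        (E := B [×(j + 1)]→L[ℝ] V)
        (continuousMultilinearCurryLeftEquiv ℝ (fun _ : Fin (j + 1) => B) V)
    have h := ih ((hL.comp hp).clm_apply hg) hg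
    convert h using 2 with x
    simp only [Function.comp_apply, continuousMultilinearCurryLeftEquiv_apply]
    congr 1
    funext i
    refine Fin.cases ?_ (fun i => ?_) i <;> simp

theorem contDiff_taylorPoly (k : ℕ) :
    ContDiff ℝ ∞ (fun z : (B × JetModel B V k) × B => taylorPoly z.1.1 z.1.2 z.2) := by
  unfold taylorPoly
  refine ContDiff.sum fun j _ => contDiff_const.smul ?_
  refine contDiff_apply_diag (X := (B × JetModel B V k) × B) (j : ℕ)
    (p := fun z => (z.1.2 j : B [×j]→L[ℝ] V)) ?_ (contDiff_snd.sub (contDiff_fst.fst))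
  exact (JetModel.contDiff_coeff j).comp contDiff_fst.snd

theorem iteratedFDeriv_taylorPoly {k : ℕ} (a : B) (p : JetModel B V k) (j : Fin (k + 1)) :
    iteratedFDeriv ℝ j (taylorPoly a p) a = (p j : B [×j]→L[ℝ] V) := by
  let q : FormalMultilinearSeries ℝ B V := fun i =>
    if h : i < k + 1 then ((Nat.factorial i : ℝ))⁻¹ • (p ⟨i, h⟩ : B [×i]→L[ℝ] V) else 0
  have hq : ∀ m, k + 1 ≤ m → q m = 0 := fun m hm => by
    simp only [q]; rw [dif_neg (by omega)]
  have hfin : HasFiniteFPowerSeriesOnBall (taylorPoly a p) q a (k + 1) ⊤ := by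
    refine HasFiniteFPowerSeriesOnBall.mk' hq (by simp) ?_
    intro y _
    simp only [taylorPoly, add_sub_cancel_left]
    rw [Finset.sum_range]
    refine Finset.sum_congr rfl fun i _ => ?_
    simp only [q, i.2, dif_pos, Fin.eta]; rfl
  have han : AnalyticOn ℝ (taylorPoly a p) univ := by
    have := hfin.cpolynomialOn
    rw [Metric.eball_top] at this
    exact this.analyticOnNhd.analyticOn
  ext v
  rw [hfin.toHasFPowerSeriesOnBall.iteratedFDeriv_eq_sum han]
  have h1 : ∀ σ : Equiv.Perm (Fin j), q j (fun i => v (σ i)) =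
      ((Nat.factorial j : ℝ))⁻¹ • (p j : B [×j]→L[ℝ] V) v := by
    intro σ
    have := (p j).2 σ v
    simp only [q, j.2, dif_pos, _root_.smul_apply]
    exact congrArg _ this
  simp only [h1, Finset.sum_const, Finset.card_univ, Fintype.card_perm, Fintype.card_fin]
  rw [← Nat.cast_smul_eq_nsmul ℝ, smul_smul, mul_inv_cancel₀ (by positivity), one_smul]

end JetModel

section Fibered

variable (B : Type*) [NormedAddCommGroup B] [NormedSpace ℝ B]
  (V : Type*) [NormedAddCommGroup V] [NormedSpace ℝ V]
  {M : Type*} [TopologicalSpace M] [ChartedSpace B M]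
  {E : Type*} [TopologicalSpace E] [ChartedSpace (B × V) E]

/-- A fibered chart of `π : E → M`: smooth coordinates `(x, u)` on an open set of the total space
such that the `x` are (pulled back from) smooth coordinates on the base. -/
structure FiberedChart (π : E → M) where
  total : OpenPartialHomeomorph E (B × V)
  base : OpenPartialHomeomorph M B
  total_mem : total ∈ IsManifold.maximalAtlas 𝓘(ℝ, B × V) ∞ E
  base_mem : base ∈ IsManifold.maximalAtlas 𝓘(ℝ, B) ∞ M
  proj_mem : ∀ e ∈ total.source, π e ∈ base.source
  fst_eq : ∀ e ∈ total.source, (total e).1 = base (π e)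

/-- `π` is a fibered manifold: fibered charts exist around every point of the total space. -/
class IsFiberedManifold (π : E → M) : Prop where
  exists_chart : ∀ e : E, ∃ c : FiberedChart B V π, e ∈ c.total.source

/-- A smooth fiber bundle: over a neighbourhood of every point of the base there is a smooth
trivialization with a fixed manifold `F` as typical fiber. -/
class IsSmoothFiberBundle.{u} {E : Type u} [TopologicalSpace E] [ChartedSpace (B × V) E]
    (π : E → M) : Prop where
  exists_trivialization : ∃ (F : Type u) (_ : TopologicalSpace F) (_ : ChartedSpace V F)
    (_ : IsManifold 𝓘(ℝ, V) ∞ F), ∀ x : M, ∃ t : Bundle.Trivialization F π, x ∈ t.baseSet ∧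
      ContMDiffOn 𝓘(ℝ, B × V) (𝓘(ℝ, B).prod 𝓘(ℝ, V)) ∞ t t.source ∧
      ContMDiffOn (𝓘(ℝ, B).prod 𝓘(ℝ, V)) 𝓘(ℝ, B × V) ∞ t.toOpenPartialHomeomorph.symm t.target

/-- `s` restricts to a smooth section of `π` on a neighbourhood of `x`. -/
def IsLocalSectionAt (π : E → M) (x : M) (s : M → E) : Prop :=
  (∀ᶠ y in 𝓝 x, ContMDiffAt 𝓘(ℝ, B) 𝓘(ℝ, B × V) ∞ s y) ∧ ∀ᶠ y in 𝓝 x, π (s y) = y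

/-- Smooth local sections of `π` around `x` (only the values near `x` matter). -/
structure LocalSection (π : E → M) (x : M) where
  toFun : M → E
  isLocalSectionAt : IsLocalSectionAt B V π x toFun

instance (π : E → M) (x : M) : CoeFun (LocalSection B V π x) (fun _ => M → E) :=
  ⟨LocalSection.toFun⟩

variable {B V} {π : E → M} {x : M}

/-- The coordinate representation `u ∘ s ∘ x⁻¹ : B → V` of a map `s : M → E`. -/
def FiberedChart.rep (c : FiberedChart B V π) (s : M → E) (y : B) : V :=
  (c.total (s (c.base.symm y))).2

theorem LocalSection.proj_eq (s : LocalSection B V π x) : π (s x) = x :=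
  s.isLocalSectionAt.2.self_of_nhds

theorem LocalSection.contMDiffAt (s : LocalSection B V π x) :
    ContMDiffAt 𝓘(ℝ, B) 𝓘(ℝ, B × V) ∞ s x :=
  s.isLocalSectionAt.1.self_of_nhds

theorem FiberedChart.base_mem_source (c : FiberedChart B V π) (s : LocalSection B V π x)
    (h : s x ∈ c.total.source) : x ∈ c.base.source := by
  have := c.proj_mem _ h
  rwa [s.proj_eq] at this

theorem FiberedChart.contDiffAt_rep (c : FiberedChart B V π) {s : M → E}
    (hs : ContMDiffAt 𝓘(ℝ, B) 𝓘(ℝ, B × V) ∞ s x)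
    (hx : x ∈ c.base.source) (h : s x ∈ c.total.source) :
    ContDiffAt ℝ ∞ (c.rep s) (c.base x) := by
  have h1 : ContMDiffAt 𝓘(ℝ, B) 𝓘(ℝ, B) ∞ c.base.symm (c.base x) :=
    contMDiffAt_symm_of_mem_maximalAtlas c.base_mem (c.base.map_source hx)
  have h2 : c.base.symm (c.base x) = x := c.base.left_inv hx
  have h3 : ContMDiffAt 𝓘(ℝ, B × V) 𝓘(ℝ, B × V) ∞ c.total (s x) :=
    contMDiffAt_of_mem_maximalAtlas c.total_mem h
  have h4 : ContMDiffAt 𝓘(ℝ, B) 𝓘(ℝ, B × V) ∞ (fun y => c.total (s (c.base.symm y)))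
      (c.base x) := by
    refine ContMDiffAt.comp (c.base x) (I' := 𝓘(ℝ, B × V)) (g := c.total)
      (f := fun y => s (c.base.symm y)) (by rwa [h2]) ?_
    exact ContMDiffAt.comp (c.base x) (I' := 𝓘(ℝ, B)) (g := s) (f := c.base.symm)
      (by rwa [h2]) h1
  exact h4.contDiffAt.snd

/-- Two local sections have contact of order `k` at `x`: they have the same value at `x` and, in
fibered coordinates, the same derivatives up to order `k` at `x`. -/
def HasContact (k : ℕ∞) (s t : LocalSection B V π x) : Prop :=
  s x = t x ∧ ∀ c : FiberedChart B V π, s x ∈ c.total.source → ∀ i : ℕ, (i : ℕ∞) ≤ k →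
    iteratedFDeriv ℝ i (c.rep s) (c.base x) = iteratedFDeriv ℝ i (c.rep t) (c.base x)

variable (π x) in
/-- Contact of order `k` at `x`, as an equivalence relation. -/
@[reducible]
def contactSetoid (k : ℕ∞) : Setoid (LocalSection B V π x) where
  r := HasContact k
  iseqv :=
    { refl := fun _ => ⟨rfl, fun _ _ _ _ => rfl⟩
      symm := fun h => ⟨h.1.symm, fun c hc i hi => (h.2 c (h.1 ▸ hc) i hi).symm⟩
      trans := fun h h' => ⟨h.1.trans h'.1, fun c hc i hi =>
        (h.2 c hc i hi).trans (h'.2 c (h.1 ▸ hc) i hi)⟩ }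

variable (B V π) in
/-- The space `J^k π` of `k`-jets of local sections of `π`, for `0 ≤ k ≤ ∞`. -/
structure Jet (k : ℕ∞) where
  base : M
  germ : Quotient (contactSetoid (B := B) (V := V) π base k)

variable (B V π) in
/-- The projection `π_k : J^k π → M`. -/
abbrev jetProj (k : ℕ∞) : Jet B V π k → M := Jet.base

/-- The `k`-jet at `x` of a local section around `x`. -/
def LocalSection.jet (k : ℕ∞) (s : LocalSection B V π x) : Jet B V π k :=
  ⟨x, Quotient.mk (contactSetoid π x k) s⟩

/-- A local section representing the jet `θ`. -/
def Jet.out {k : ℕ∞} (θ : Jet B V π k) : LocalSection B V π θ.base :=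
  @Quotient.out _ (contactSetoid π θ.base k) θ.germ

theorem Jet.jet_out {k : ℕ∞} (θ : Jet B V π k) : θ.out.jet k = θ := by
  cases θ with
  | mk x g => exact congrArg (Jet.mk x) (@Quotient.out_eq _ (contactSetoid π x k) g)

theorem LocalSection.out_jet {k : ℕ∞} (s : LocalSection B V π x) :
    HasContact k (s.jet k).out s :=
  @Quotient.mk_out _ (contactSetoid π x k) s

theorem LocalSection.jet_eq_iff {k : ℕ∞} {s t : LocalSection B V π x} :
    s.jet k = t.jet k ↔ HasContact k s t := by
  constructor
  · intro h
    have := eq_of_heq (Jet.mk.inj h).2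
    exact @Quotient.exact _ (contactSetoid π x k) _ _ this
  · intro h
    exact congrArg (Jet.mk x) (@Quotient.sound _ (contactSetoid π x k) _ _ h)

/-- The projection `π_{k,0} : J^k π → E`. -/
def Jet.value {k : ℕ∞} (θ : Jet B V π k) : E := θ.out θ.base

/-- The projection `π_{l,k} : J^l π → J^k π`, for `k ≤ l`. -/
def Jet.truncate {k l : ℕ∞} (_h : k ≤ l) (θ : Jet B V π l) : Jet B V π k := θ.out.jet k

theorem LocalSection.value_jet {k : ℕ∞} (s : LocalSection B V π x) : (s.jet k).value = s x :=
  s.out_jet.1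

theorem Jet.proj_value {k : ℕ∞} (θ : Jet B V π k) : π θ.value = θ.base := θ.out.proj_eq

end Fibered

section JetCharts

variable {B : Type*} [NormedAddCommGroup B] [NormedSpace ℝ B]
  {V : Type*} [NormedAddCommGroup V] [NormedSpace ℝ V]
  {M : Type*} [TopologicalSpace M] [ChartedSpace B M]
  {E : Type*} [TopologicalSpace E] [ChartedSpace (B × V) E] {π : E → M} {x : M}

/-- The coordinate change of total spaces between two fibered charts. -/
theorem FiberedChart.contDiffOn_total (c c' : FiberedChart B V π) :
    ContDiffOn ℝ ∞ (c.total.symm ≫ₕ c'.total) (c.total.symm ≫ₕ c'.total).source :=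
  (contMDiffOn_of_mem_contDiffGroupoid (I := 𝓘(ℝ, B × V))
    (StructureGroupoid.compatible_of_mem_maximalAtlas c.total_mem c'.total_mem)).contDiffOn

theorem FiberedChart.contDiffOn_base (c c' : FiberedChart B V π) :
    ContDiffOn ℝ ∞ (c.base.symm ≫ₕ c'.base) (c.base.symm ≫ₕ c'.base).source :=
  (contMDiffOn_of_mem_contDiffGroupoid (I := 𝓘(ℝ, B))
    (StructureGroupoid.compatible_of_mem_maximalAtlas c.base_mem c'.base_mem)).contDiffOn

theorem FiberedChart.mem_base_source (c : FiberedChart B V π) {a : B × V}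
    (ha : a ∈ c.total.target) : c.base (π (c.total.symm a)) = a.1 ∧
      π (c.total.symm a) ∈ c.base.source := by
  have h1 := c.total.map_target ha
  refine ⟨?_, c.proj_mem _ h1⟩
  rw [← c.fst_eq _ h1, c.total.right_inv ha]

theorem FiberedChart.proj_symm (c : FiberedChart B V π) {a : B × V}
    (ha : a ∈ c.total.target) : π (c.total.symm a) = c.base.symm a.1 := by
  obtain ⟨h1, h2⟩ := c.mem_base_source ha
  rw [← h1, c.base.left_inv h2]

theorem FiberedChart.fst_mem_target (c : FiberedChart B V π) {a : B × V}
    (ha : a ∈ c.total.target) : a.1 ∈ c.base.target := by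
  obtain ⟨h1, h2⟩ := c.mem_base_source ha
  rw [← h1]; exact c.base.map_source h2

/-- Coordinate representations of a section in two fibered charts. -/
theorem FiberedChart.rep_eventuallyEq (c c' : FiberedChart B V π) (s : LocalSection B V π x)
    (hc : s x ∈ c.total.source) (hc' : s x ∈ c'.total.source) :
    c'.rep s =ᶠ[𝓝 (c'.base x)] (fun a => ((c.total.symm ≫ₕ c'.total) a).2) ∘
      (fun y => (y, c.rep s y)) ∘ (c'.base.symm ≫ₕ c.base) := by
  have hx := c.base_mem_source s hc
  have hx' := c'.base_mem_source s hc'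
  have hcont : Tendsto c'.base.symm (𝓝 (c'.base x)) (𝓝 x) := by
    have := c'.base.continuousAt_symm (c'.base.map_source hx')
    rwa [ContinuousAt, c'.base.left_inv hx'] at this
  have e1 : ∀ᶠ y in 𝓝 x, y ∈ c.base.source := c.base.open_source.mem_nhds hx
  have e2 : ∀ᶠ y in 𝓝 x, s y ∈ c.total.source :=
    s.contMDiffAt.continuousAt (c.total.open_source.mem_nhds hc)
  filter_upwards [hcont (e1.and (e2.and s.isLocalSectionAt.2))] with y hy
  obtain ⟨h1, h2, h3⟩ := hy
  simp only [FiberedChart.rep, Function.comp_apply, OpenPartialHomeomorph.coe_trans]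
  rw [c.base.left_inv h1]
  have : (c.base (c'.base.symm y), (c.total (s (c'.base.symm y))).2) =
      c.total (s (c'.base.symm y)) := by
    refine Prod.ext ?_ rfl
    rw [c.fst_eq _ h2, h3]
  rw [this, c.total.left_inv h2]

theorem FiberedChart.total_eq (c : FiberedChart B V π) (s : LocalSection B V π x)
    (hc : s x ∈ c.total.source) : (c.base x, c.rep s (c.base x)) = c.total (s x) := by
  have hx := c.base_mem_source s hc
  refine Prod.ext ?_ ?_
  · simp only [c.fst_eq _ hc, s.proj_eq]
  · simp only [FiberedChart.rep, c.base.left_inv hx]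

/-- Contact may be checked in one fibered chart. -/
theorem hasContact_of_chart {k : ℕ∞} {s t : LocalSection B V π x} (hst : s x = t x)
    (c : FiberedChart B V π) (hc : s x ∈ c.total.source)
    (h : ∀ i : ℕ, (i : ℕ∞) ≤ k →
      iteratedFDeriv ℝ i (c.rep s) (c.base x) = iteratedFDeriv ℝ i (c.rep t) (c.base x)) :
    HasContact k s t := by
  refine ⟨hst, fun c' hc' i hi => ?_⟩
  have hct : t x ∈ c.total.source := hst ▸ hc
  have hct' : t x ∈ c'.total.source := hst ▸ hc'
  have hx := c.base_mem_source s hc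
  have hx' := c'.base_mem_source s hc'
  rw [((c.rep_eventuallyEq c' s hc hc').iteratedFDeriv ℝ i).eq_of_nhds,
    ((c.rep_eventuallyEq c' t hct hct').iteratedFDeriv ℝ i).eq_of_nhds]
  have hφx : (c'.base.symm ≫ₕ c.base) (c'.base x) = c.base x := by
    simp [c'.base.left_inv hx']
  have hφ : ContDiffAt ℝ ∞ (c'.base.symm ≫ₕ c.base) (c'.base x) :=
    (c'.contDiffOn_base c).contDiffAt ((c'.base.symm ≫ₕ c.base).open_source.mem_nhds (by
      simp [c'.base.left_inv hx', hx, c'.base.map_source hx']))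
  have hs : ContDiffAt ℝ ∞ (c.rep s) (c.base x) := c.contDiffAt_rep s.contMDiffAt hx hc
  have ht : ContDiffAt ℝ ∞ (c.rep t) (c.base x) := c.contDiffAt_rep t.contMDiffAt hx hct
  have hΨ : ContDiffAt ℝ ∞ (fun a => ((c.total.symm ≫ₕ c'.total) a).2)
      (c.base x, c.rep s (c.base x)) := by
    rw [c.total_eq s hc]
    refine (((c.contDiffOn_total c').contDiffAt
      ((c.total.symm ≫ₕ c'.total).open_source.mem_nhds ?_))).snd
    simp [c.total.left_inv hc, hc', c.total.map_source hc]
  have hrep : c.rep s (c.base x) = c.rep t (c.base x) := by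
    simp only [FiberedChart.rep, c.base.left_inv hx, hst]
  have key : ∀ j ≤ i, iteratedFDeriv ℝ j ((fun a => ((c.total.symm ≫ₕ c'.total) a).2) ∘
      (fun y => (y, c.rep s y))) (c.base x) =
      iteratedFDeriv ℝ j ((fun a => ((c.total.symm ≫ₕ c'.total) a).2) ∘
      (fun y => (y, c.rep t y))) (c.base x) := by
    intro j hj
    refine contact_comp (f := fun y => (y, c.rep s y)) (f' := fun y => (y, c.rep t y)) hΨ
      (contDiffAt_id.prodMk hs) (contDiffAt_id.prodMk ht) ?_ (by simp [hrep])
    intro l hl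
    exact contact_graph hs ht (h l (le_trans (by exact_mod_cast hl.trans hj) hi))
  rw [← Function.comp_assoc, ← Function.comp_assoc]
  refine contact_precomp ?_ ?_ hφ ?_
  · rw [hφx]; exact ContDiffAt.comp (c.base x) (f := fun y => (y, c.rep s y)) hΨ
      (contDiffAt_id.prodMk hs)
  · rw [hφx]; exact ContDiffAt.comp (c.base x) (f := fun y => (y, c.rep t y)) (hrep ▸ hΨ)
      (contDiffAt_id.prodMk ht)
  · rw [hφx]; exact key

theorem jet_eq_of_chart {k : ℕ∞} {x' : M} {s : LocalSection B V π x} {t : LocalSection B V π x'}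
    (hx : x = x') (hst : s x = t x')
    (c : FiberedChart B V π) (hc : s x ∈ c.total.source)
    (h : ∀ i : ℕ, (i : ℕ∞) ≤ k →
      iteratedFDeriv ℝ i (c.rep s) (c.base x) = iteratedFDeriv ℝ i (c.rep t) (c.base x')) :
    s.jet k = t.jet k := by
  subst hx
  exact LocalSection.jet_eq_iff.2 (hasContact_of_chart hst c hc h)

/-- The section whose coordinate representation is the polynomial with Taylor coefficients `p` at
the point with coordinates `a`. -/
def FiberedChart.polySection (c : FiberedChart B V π) {k : ℕ} (a : B × JetModel B V k) (y : M) : E :=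
  c.total.symm (c.base y, taylorPoly a.1 a.2 (c.base y))

/-- The coordinates of order zero. -/
def JetModel.zeroth {k : ℕ} (p : JetModel B V k) : V :=
  (p 0 : B [×((0 : Fin (k + 1)) : ℕ)]→L[ℝ] V) 0

theorem taylorPoly_self {k : ℕ} (a : B) (p : JetModel B V k) : taylorPoly a p a = p.zeroth := by
  exact congrArg (fun q => q 0) (iteratedFDeriv_taylorPoly a p 0)

theorem contDiff_zeroth (k : ℕ) : ContDiff ℝ ∞ (fun p : JetModel B V k => p.zeroth) := by
  have h := (contDiff_taylorPoly (B := B) (V := V) k).comp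
    (f := fun p : JetModel B V k => (((0 : B), p), (0 : B)))
    ((contDiff_const.prodMk contDiff_id).prodMk contDiff_const)
  convert h using 2 with p
  exact (taylorPoly_self 0 p).symm

theorem FiberedChart.polySection_isLocalSectionAt (c : FiberedChart B V π) {k : ℕ}
    {a : B × JetModel B V k} (ha : (a.1, a.2.zeroth) ∈ c.total.target) :
    IsLocalSectionAt B V π (c.base.symm a.1) (c.polySection a) := by
  have hb : a.1 ∈ c.base.target := c.fst_mem_target ha
  have hP : ContDiff ℝ ∞ (fun y => taylorPoly a.1 a.2 y) :=
    (contDiff_taylorPoly k).comp (contDiff_const.prodMk contDiff_id)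
  have hev : ∀ᶠ y in 𝓝 (c.base.symm a.1), y ∈ c.base.source ∧
      (c.base y, taylorPoly a.1 a.2 (c.base y)) ∈ c.total.target := by
    refine Filter.Eventually.and (c.base.open_source.mem_nhds (c.base.map_target hb)) ?_
    have hc : ContinuousAt (fun y => (c.base y, taylorPoly a.1 a.2 (c.base y)))
        (c.base.symm a.1) := by
      have h1 := c.base.continuousAt (c.base.map_target hb)
      exact h1.prodMk (hP.continuous.continuousAt.comp h1)
    refine hc (c.total.open_target.mem_nhds ?_)
    simpa only [c.base.right_inv hb, taylorPoly_self] using ha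
  refine ⟨?_, ?_⟩
  · filter_upwards [hev] with y hy
    have h1 : ContMDiffAt 𝓘(ℝ, B) 𝓘(ℝ, B) ∞ c.base y :=
      contMDiffAt_of_mem_maximalAtlas c.base_mem hy.1
    have h2 : ContMDiffAt 𝓘(ℝ, B × V) 𝓘(ℝ, B × V) ∞ c.total.symm
        (c.base y, taylorPoly a.1 a.2 (c.base y)) :=
      contMDiffAt_symm_of_mem_maximalAtlas c.total_mem hy.2
    have h3 : ContMDiffAt 𝓘(ℝ, B) 𝓘(ℝ, B × V) ∞ (fun z => (z, taylorPoly a.1 a.2 z))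
        (c.base y) := (contDiff_id.prodMk hP).contMDiff.contMDiffAt
    exact h2.comp y (h3.comp y h1)
  · filter_upwards [hev] with y hy
    rw [FiberedChart.polySection, c.proj_symm hy.2, c.base.left_inv hy.1]

/-- The polynomial section as a local section. -/
def FiberedChart.polyLocalSection (c : FiberedChart B V π) {k : ℕ}
    {a : B × JetModel B V k} (ha : (a.1, a.2.zeroth) ∈ c.total.target) :
    LocalSection B V π (c.base.symm a.1) :=
  ⟨c.polySection a, c.polySection_isLocalSectionAt ha⟩

theorem FiberedChart.polySection_apply (c : FiberedChart B V π) {k : ℕ}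
    {a : B × JetModel B V k} (ha : (a.1, a.2.zeroth) ∈ c.total.target) :
    c.polySection a (c.base.symm a.1) = c.total.symm (a.1, a.2.zeroth) := by
  rw [FiberedChart.polySection, c.base.right_inv (c.fst_mem_target ha), taylorPoly_self]

theorem FiberedChart.rep_polySection (c : FiberedChart B V π) {k : ℕ}
    {a : B × JetModel B V k} (ha : (a.1, a.2.zeroth) ∈ c.total.target) :
    c.rep (c.polySection a) =ᶠ[𝓝 a.1] taylorPoly a.1 a.2 := by
  have hb : a.1 ∈ c.base.target := c.fst_mem_target ha
  have hP : ContDiff ℝ ∞ (fun y => taylorPoly a.1 a.2 y) :=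
    (contDiff_taylorPoly k).comp (contDiff_const.prodMk contDiff_id)
  have h1 : ∀ᶠ z in 𝓝 a.1, (z, taylorPoly a.1 a.2 z) ∈ c.total.target := by
    refine (continuousAt_id.prodMk hP.continuous.continuousAt) (c.total.open_target.mem_nhds ?_)
    simpa [taylorPoly_self] using ha
  filter_upwards [h1, c.base.open_target.mem_nhds hb] with z hz hz'
  rw [FiberedChart.rep, FiberedChart.polySection, c.base.right_inv hz', c.total.right_inv hz]

/-- The coordinates `(x^i, u^α_I)_{|I| ≤ k}` on `J^k π` in a fibered chart. -/
def FiberedChart.jetCoords (c : FiberedChart B V π) {k : ℕ} (θ : Jet B V π k) :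
    B × JetModel B V k :=
  (c.base θ.base, taylorCoeff k (c.rep θ.out) (c.base θ.base))

open Classical in
/-- The jet with given coordinates (the default `θ₀` outside the range of the chart). -/
def FiberedChart.jetOfCoords (c : FiberedChart B V π) {k : ℕ} (θ₀ : Jet B V π k)
    (a : B × JetModel B V k) : Jet B V π k :=
  if ha : (a.1, a.2.zeroth) ∈ c.total.target then (c.polyLocalSection ha).jet k else θ₀

theorem FiberedChart.jetCoords_jet (c : FiberedChart B V π) (s : LocalSection B V π x)
    (hc : s x ∈ c.total.source) (k : ℕ) :
    c.jetCoords (s.jet k) = (c.base x, taylorCoeff k (c.rep s) (c.base x)) := by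
  refine Prod.ext rfl ?_
  funext j
  have hval : (s.jet k).out x = s x := (s.out_jet (k := k)).1
  have h2 := (s.out_jet (k := k)).2 c (by
    change (s.jet k).out x ∈ _; rwa [hval]) j (by exact_mod_cast Nat.lt_succ_iff.1 j.2)
  exact congrArg (symmetrize (j : ℕ)) h2

theorem FiberedChart.total_value (c : FiberedChart B V π) {k : ℕ} (θ : Jet B V π k)
    (hθ : θ.value ∈ c.total.source) :
    ((c.jetCoords θ).1, (c.jetCoords θ).2.zeroth) = c.total θ.value := by
  rw [Jet.value, ← c.total_eq θ.out hθ]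
  refine Prod.ext rfl ?_
  have hx := c.base_mem_source θ.out hθ
  have h := taylorCoeff_coe (k := k) (c.contDiffAt_rep θ.out.contMDiffAt hx hθ) 0
  exact congrArg (fun q => q 0) h

/-- The coordinates on `J^k π` in a fibered chart, as a partial equivalence; the domain consists of
the jets whose value lies in the domain of the fibered chart. -/
def FiberedChart.jetPartialEquiv (c : FiberedChart B V π) {k : ℕ} (θ₀ : Jet B V π k) :
    PartialEquiv (Jet B V π k) (B × JetModel B V k) where
  toFun := c.jetCoords
  invFun := c.jetOfCoords θ₀
  source := {θ | θ.value ∈ c.total.source}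
  target := {a | (a.1, a.2.zeroth) ∈ c.total.target}
  map_source' := fun θ hθ => by
    change _ ∈ c.total.target
    rw [c.total_value θ hθ]; exact c.total.map_source hθ
  map_target' := fun a ha => by
    have ha' : (a.1, a.2.zeroth) ∈ c.total.target := ha
    simp only [FiberedChart.jetOfCoords, dif_pos ha', mem_ofPred_eq, LocalSection.value_jet]
    change c.polySection a (c.base.symm a.1) ∈ _
    rw [c.polySection_apply ha]
    exact c.total.map_target ha
  left_inv' := fun θ hθ => by
    have hθ' : θ.value ∈ c.total.source := hθ
    have hx := c.base_mem_source θ.out hθ'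
    have ha : ((c.jetCoords θ).1, (c.jetCoords θ).2.zeroth) ∈ c.total.target := by
      rw [c.total_value θ hθ]; exact c.total.map_source hθ
    simp only [FiberedChart.jetOfCoords, dif_pos ha]
    conv_rhs => rw [← θ.jet_out]
    symm
    refine jet_eq_of_chart ?_ ?_ c hθ ?_
    · simp only [FiberedChart.jetCoords]; rw [c.base.left_inv hx]
    · change _ = c.polySection (c.jetCoords θ) _
      rw [c.polySection_apply ha, c.total_value θ hθ, c.total.left_inv hθ]; rfl
    · intro i hi
      have e : c.base (c.base.symm (c.jetCoords θ).1) = c.base θ.base := by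
        rw [c.base.right_inv (c.fst_mem_target ha)]; rfl
      rw [e]
      have h1 := ((c.rep_polySection ha).iteratedFDeriv ℝ i).eq_of_nhds
      have h2 := iteratedFDeriv_taylorPoly (c.jetCoords θ).1 (c.jetCoords θ).2
        ⟨i, Nat.lt_succ_iff.2 (by exact_mod_cast hi)⟩
      have h3 := taylorCoeff_coe (k := k) (c.contDiffAt_rep θ.out.contMDiffAt hx hθ)
        ⟨i, Nat.lt_succ_iff.2 (by exact_mod_cast hi)⟩
      exact (h1.trans (h2.trans h3)).symm
  right_inv' := fun a ha => by
    have ha' : (a.1, a.2.zeroth) ∈ c.total.target := ha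
    simp only [FiberedChart.jetOfCoords, dif_pos ha']
    have hsrc : c.polyLocalSection ha' (c.base.symm a.1) ∈ c.total.source := by
      change c.polySection a (c.base.symm a.1) ∈ _
      rw [c.polySection_apply ha]
      exact c.total.map_target ha
    rw [c.jetCoords_jet _ hsrc k]
    have hb := c.fst_mem_target ha'
    refine Prod.ext (c.base.right_inv hb) ?_
    funext j
    apply Subtype.ext
    rw [taylorCoeff_coe (c.contDiffAt_rep (LocalSection.contMDiffAt _)
      (c.base.map_target hb) hsrc), c.base.right_inv hb]
    exact ((c.rep_polySection ha').iteratedFDeriv ℝ j).eq_of_nhds.trans (iteratedFDeriv_taylorPoly a.1 a.2 j)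

/-- The points at which the family of polynomial sections of `c` can be expressed in `c'`. -/
def FiberedChart.familyDomain (c c' : FiberedChart B V π) (k : ℕ) :
    Set ((B × JetModel B V k) × B) :=
  {z | z.2 ∈ (c'.base.symm ≫ₕ c.base).source ∧
    ((c'.base.symm ≫ₕ c.base) z.2, taylorPoly z.1.1 z.1.2 ((c'.base.symm ≫ₕ c.base) z.2)) ∈
      (c.total.symm ≫ₕ c'.total).source}

theorem FiberedChart.contDiffOn_family (c c' : FiberedChart B V π) (k : ℕ) :
    IsOpen (c.familyDomain c' k) ∧
    ContDiffOn ℝ ∞ (Function.uncurry fun a : B × JetModel B V k =>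
      c'.rep (c.polySection a)) (c.familyDomain c' k) := by
  have hU₁ : IsOpen ((Prod.snd : (B × JetModel B V k) × B → B) ⁻¹'
      (c'.base.symm ≫ₕ c.base).source) :=
    (c'.base.symm ≫ₕ c.base).open_source.preimage continuous_snd
  have hφ : ContDiffOn ℝ ∞ (fun z : (B × JetModel B V k) × B => (c'.base.symm ≫ₕ c.base) z.2)
      (Prod.snd ⁻¹' (c'.base.symm ≫ₕ c.base).source) :=
    (c'.contDiffOn_base c).comp contDiffOn_snd (fun z hz => hz)
  have hg : ContDiffOn ℝ ∞ (fun z : (B × JetModel B V k) × B =>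
      ((c'.base.symm ≫ₕ c.base) z.2, taylorPoly z.1.1 z.1.2 ((c'.base.symm ≫ₕ c.base) z.2)))
      (Prod.snd ⁻¹' (c'.base.symm ≫ₕ c.base).source) :=
    hφ.prodMk ((contDiff_taylorPoly k).comp_contDiffOn
      (f := fun z : (B × JetModel B V k) × B => (z.1, (c'.base.symm ≫ₕ c.base) z.2))
      (contDiffOn_fst.prodMk hφ))
  refine ⟨hg.continuousOn.isOpen_inter_preimage hU₁ (c.total.symm ≫ₕ c'.total).open_source, ?_⟩
  exact ((c.contDiffOn_total c').comp (hg.mono fun z hz => hz.1) (fun z hz => hz.2)).snd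

theorem FiberedChart.mem_transition_source (c c' : FiberedChart B V π) {k : ℕ}
    (θ₀ θ₀' : Jet B V π k) (a : B × JetModel B V k) :
    a ∈ ((c.jetPartialEquiv θ₀).symm.trans (c'.jetPartialEquiv θ₀')).source ↔
      (a.1, a.2.zeroth) ∈ (c.total.symm ≫ₕ c'.total).source := by
  simp only [PartialEquiv.trans_source, OpenPartialHomeomorph.trans_source, mem_inter_iff,
    mem_preimage]
  change (a.1, a.2.zeroth) ∈ c.total.target ∧ (c.jetOfCoords θ₀ a).value ∈ c'.total.source ↔
    (a.1, a.2.zeroth) ∈ c.total.target ∧ c.total.symm (a.1, a.2.zeroth) ∈ c'.total.source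
  refine and_congr_right fun ha => ?_
  simp only [FiberedChart.jetOfCoords, dif_pos ha, LocalSection.value_jet]
  change c.polySection a (c.base.symm a.1) ∈ _ ↔ _
  rw [c.polySection_apply ha]

theorem FiberedChart.isOpen_transition_source (c c' : FiberedChart B V π) {k : ℕ}
    (θ₀ θ₀' : Jet B V π k) :
    IsOpen ((c.jetPartialEquiv θ₀).symm.trans (c'.jetPartialEquiv θ₀')).source := by
  have hz : Continuous (fun a : B × JetModel B V k => (a.1, a.2.zeroth)) :=
    continuous_fst.prodMk ((contDiff_zeroth k).continuous.comp continuous_snd)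
  convert (c.total.symm ≫ₕ c'.total).open_source.preimage hz using 1
  ext a
  exact c.mem_transition_source c' θ₀ θ₀' a

theorem FiberedChart.mem_base_transition (c c' : FiberedChart B V π) {a : B × V}
    (ha : a ∈ (c.total.symm ≫ₕ c'.total).source) :
    a.1 ∈ (c.base.symm ≫ₕ c'.base).source := by
  rw [OpenPartialHomeomorph.trans_source, mem_inter_iff, mem_preimage] at ha ⊢
  refine ⟨c.fst_mem_target ha.1, ?_⟩
  rw [← c.proj_symm (a := a) ha.1]
  exact c'.proj_mem _ ha.2

theorem FiberedChart.mem_familyDomain (c c' : FiberedChart B V π) {k : ℕ}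
    {a : B × JetModel B V k}
    (ha : (a.1, a.2.zeroth) ∈ (c.total.symm ≫ₕ c'.total).source) :
    (a, (c.base.symm ≫ₕ c'.base) a.1) ∈ c.familyDomain c' k := by
  have hb := c.mem_base_transition c' ha
  have h1 : (c'.base.symm ≫ₕ c.base) ((c.base.symm ≫ₕ c'.base) a.1) = a.1 := by
    rw [OpenPartialHomeomorph.trans_source] at hb
    change c.base (c'.base.symm (c'.base (c.base.symm a.1))) = a.1
    rw [c'.base.left_inv hb.2, c.base.right_inv hb.1]
  refine ⟨?_, ?_⟩
  · have := (c.base.symm ≫ₕ c'.base).map_source hb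
    simpa using this
  · simp only [h1, taylorPoly_self]
    exact ha

theorem FiberedChart.contDiffOn_transition (c c' : FiberedChart B V π) {k : ℕ}
    (θ₀ θ₀' : Jet B V π k) :
    ContDiffOn ℝ ∞ ((c.jetPartialEquiv θ₀).symm.trans (c'.jetPartialEquiv θ₀'))
      ((c.jetPartialEquiv θ₀).symm.trans (c'.jetPartialEquiv θ₀')).source := by
  have hmem := c.mem_transition_source c' θ₀ θ₀'
  generalize ((c.jetPartialEquiv θ₀).symm.trans (c'.jetPartialEquiv θ₀')).source = S at hmem
  have hψ : ContDiffOn ℝ ∞ (fun a : B × JetModel B V k => (c.base.symm ≫ₕ c'.base) a.1) S :=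
    (c.contDiffOn_base c').comp contDiffOn_fst
      fun a ha => c.mem_base_transition c' ((hmem a).1 ha)
  have hsrc : ∀ (a : B × JetModel B V k) (ha : a ∈ S),
      c.polyLocalSection ((hmem a).1 ha).1 (c.base.symm a.1) ∈ c'.total.source := by
    intro a ha
    have ha' := (hmem a).1 ha
    change c.polySection a (c.base.symm a.1) ∈ _
    rw [c.polySection_apply ha'.1]; exact ha'.2
  have hder : ∀ j : ℕ, ContDiffOn ℝ ∞ (fun a : B × JetModel B V k =>
      iteratedFDeriv ℝ j (c'.rep (c.polySection a)) ((c.base.symm ≫ₕ c'.base) a.1)) S :=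
    fun j => by
      have h0 := iteratedFDeriv_param (c.contDiffOn_family c' k).1 (c.contDiffOn_family c' k).2 j
      exact h0.comp (f := fun a : B × JetModel B V k => (a, (c.base.symm ≫ₕ c'.base) a.1))
        (contDiffOn_id.prodMk hψ) fun a ha => c.mem_familyDomain c' ((hmem a).1 ha)
  have hT : ContDiffOn ℝ ∞ (fun a : B × JetModel B V k =>
      taylorCoeff k (c'.rep (c.polySection a)) ((c.base.symm ≫ₕ c'.base) a.1)) S :=
    JetModel.contDiffOn_iff.2 fun j => (hder j).congr fun a ha => by
      have h : ContDiffAt ℝ ∞ (c'.rep (c.polySection a)) (c'.base (c.base.symm a.1)) :=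
        c'.contDiffAt_rep (LocalSection.contMDiffAt (c.polyLocalSection ((hmem a).1 ha).1))
          (c'.base_mem_source _ (hsrc a ha)) (hsrc a ha)
      rw [OpenPartialHomeomorph.coe_trans, Function.comp_apply]
      exact taylorCoeff_coe h j
  refine (hψ.prodMk hT).congr fun a ha => ?_
  change c'.jetCoords (c.jetOfCoords θ₀ a) = _
  have ha1 : (a.1, a.2.zeroth) ∈ c.total.target := ((hmem a).1 ha).1
  simp only [FiberedChart.jetOfCoords, dif_pos ha1]
  rw [c'.jetCoords_jet (c.polyLocalSection ha1) (hsrc a ha) k]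
  rfl

end JetCharts

section JetManifold

variable {B : Type*} [NormedAddCommGroup B] [NormedSpace ℝ B]
  {V : Type*} [NormedAddCommGroup V] [NormedSpace ℝ V]
  {M : Type*} [TopologicalSpace M] [ChartedSpace B M]
  {E : Type*} [TopologicalSpace E] [ChartedSpace (B × V) E] {π : E → M} {x : M}

/-- Smooth fiber bundles admit fibered charts. -/
instance (priority := 50) [IsManifold 𝓘(ℝ, B) ∞ M] [IsManifold 𝓘(ℝ, B × V) ∞ E]
    [h : IsSmoothFiberBundle B V π] : IsFiberedManifold B V π where
  exists_chart e := by
    obtain ⟨F, _, _, _, hF⟩ := h.exists_trivialization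
    obtain ⟨t, ht, ht1, ht2⟩ := hF (π e)
    have he : e ∈ t.source := by rw [t.source_eq]; exact ht
    let φ := chartAt B (π e)
    let ψ := chartAt V (t e).2
    have hφ : φ ∈ IsManifold.maximalAtlas 𝓘(ℝ, B) ∞ M := IsManifold.chart_mem_maximalAtlas _
    have hψ : ψ ∈ IsManifold.maximalAtlas 𝓘(ℝ, V) ∞ F := IsManifold.chart_mem_maximalAtlas _
    let τ : OpenPartialHomeomorph E (B × V) := t.toOpenPartialHomeomorph ≫ₕ φ.prod ψ
    have hτ : ∀ z ∈ τ.source, z ∈ t.source ∧ π z ∈ φ.source ∧ (t z).2 ∈ ψ.source := by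
      intro z hz
      rw [OpenPartialHomeomorph.trans_source] at hz
      have h2 : (t z).1 ∈ φ.source := hz.2.1
      rw [t.coe_fst hz.1] at h2
      exact ⟨hz.1, h2, hz.2.2⟩
    refine ⟨⟨τ, φ, ?_, hφ, fun z hz => (hτ z hz).2.1, ?_⟩, ?_⟩
    · refine τ.mem_maximalAtlas_of_contMDiffOn ?_ ?_
      · refine ContMDiffOn.prodMk_space (f := fun z => φ (t z).1) (g := fun z => ψ (t z).2) ?_ ?_
        · refine (contMDiffOn_of_mem_maximalAtlas hφ).comp
            (contMDiff_fst.comp_contMDiffOn (ht1.mono fun z hz => (hτ z hz).1)) ?_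
          intro z hz
          change (t z).1 ∈ φ.source
          rw [t.coe_fst (hτ z hz).1]; exact (hτ z hz).2.1
        · exact (contMDiffOn_of_mem_maximalAtlas hψ).comp
            (contMDiff_snd.comp_contMDiffOn (ht1.mono fun z hz => (hτ z hz).1))
            (fun z hz => (hτ z hz).2.2)
      · have hsub : ∀ z ∈ τ.target, z.1 ∈ φ.target ∧ z.2 ∈ ψ.target ∧
            (φ.symm z.1, ψ.symm z.2) ∈ t.target := by
          intro z hz
          rw [OpenPartialHomeomorph.trans_target] at hz
          exact ⟨hz.1.1, hz.1.2, hz.2⟩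
        have h1 : ContMDiffOn 𝓘(ℝ, B × V) 𝓘(ℝ, B) ∞ (fun z : B × V => φ.symm z.1) τ.target :=
          (contMDiffOn_symm_of_mem_maximalAtlas hφ).comp contDiff_fst.contMDiff.contMDiffOn
            (fun z hz => (hsub z hz).1)
        have h2 : ContMDiffOn 𝓘(ℝ, B × V) 𝓘(ℝ, V) ∞ (fun z : B × V => ψ.symm z.2) τ.target :=
          (contMDiffOn_symm_of_mem_maximalAtlas hψ).comp contDiff_snd.contMDiff.contMDiffOn
            (fun z hz => (hsub z hz).2.1)
        exact ht2.comp (h1.prodMk h2) (fun z hz => (hsub z hz).2.2)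
    · intro z hz
      change φ (t z).1 = φ (π z)
      rw [← t.proj_toFun z (hτ z hz).1]; rfl
    · change e ∈ (t.toOpenPartialHomeomorph ≫ₕ φ.prod ψ).source
      rw [OpenPartialHomeomorph.trans_source]
      refine ⟨he, ?_, mem_chart_source V _⟩
      change (t e).1 ∈ φ.source
      rw [t.coe_fst he]; exact mem_chart_source B _

/-- The `k`-th jet prolongation `j_k s` of a local section (with an arbitrary value at the points
at which `s` is not a smooth section). -/
def LocalSection.jetMap (s : LocalSection B V π x) (k : ℕ∞) : M → Jet B V π k := by
  classical
  exact fun y => if h : IsLocalSectionAt B V π y s then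
    (LocalSection.mk s.toFun h).jet k else s.jet k

theorem LocalSection.eventually_isLocalSectionAt (s : LocalSection B V π x) :
    ∀ᶠ y in 𝓝 x, IsLocalSectionAt B V π y s :=
  (eventually_eventually_nhds.2 s.isLocalSectionAt.1).and
    (eventually_eventually_nhds.2 s.isLocalSectionAt.2)

theorem LocalSection.jetMap_of_isLocalSectionAt (s : LocalSection B V π x) (k : ℕ∞) {y : M}
    (h : IsLocalSectionAt B V π y s) : s.jetMap k y = (LocalSection.mk s.toFun h).jet k :=
  dif_pos h

theorem LocalSection.jetMap_self (s : LocalSection B V π x) (k : ℕ∞) : s.jetMap k x = s.jet k :=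
  dif_pos s.isLocalSectionAt

variable [IsFiberedManifold B V π]

variable (B V π) in
/-- The atlas of `J^k π` formed by the jet coordinates in all fibered charts. -/
def jetCore (k : ℕ) : ChartedSpaceCore (B × JetModel B V k) (Jet B V π (k : ℕ∞)) where
  atlas := {e | ∃ (c : FiberedChart B V π) (θ₀ : Jet B V π (k : ℕ∞)), e = c.jetPartialEquiv θ₀}
  chartAt θ := (IsFiberedManifold.exists_chart (B := B) (V := V) (π := π)
    θ.value).choose.jetPartialEquiv θ
  mem_chart_source θ := (IsFiberedManifold.exists_chart (B := B) (V := V) (π := π)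
    θ.value).choose_spec
  chart_mem_atlas θ := ⟨_, _, rfl⟩
  open_source := by
    rintro _ _ ⟨c, θ₀, rfl⟩ ⟨c', θ₀', rfl⟩
    exact c.isOpen_transition_source c' θ₀ θ₀'
  continuousOn_toFun := by
    rintro _ _ ⟨c, θ₀, rfl⟩ ⟨c', θ₀', rfl⟩
    exact (c.contDiffOn_transition c' θ₀ θ₀').continuousOn

/-- The manifold topology of `J^k π`, `k < ∞`. -/
instance (k : ℕ) : TopologicalSpace (Jet B V π (k : ℕ∞)) := (jetCore B V π k).toTopologicalSpace

/-- The manifold structure of `J^k π`, `k < ∞`. -/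
instance (k : ℕ) : ChartedSpace (B × JetModel B V k) (Jet B V π (k : ℕ∞)) :=
  (jetCore B V π k).toChartedSpace

/-- The chart of `J^k π` given by the jet coordinates in a fibered chart. -/
def FiberedChart.jetChart (c : FiberedChart B V π) {k : ℕ} (θ₀ : Jet B V π (k : ℕ∞)) :
    OpenPartialHomeomorph (Jet B V π (k : ℕ∞)) (B × JetModel B V k) :=
  (jetCore B V π k).openPartialHomeomorph (c.jetPartialEquiv θ₀) ⟨c, θ₀, rfl⟩

theorem FiberedChart.jetChart_mem_atlas (c : FiberedChart B V π) {k : ℕ}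
    (θ₀ : Jet B V π (k : ℕ∞)) :
    c.jetChart θ₀ ∈ atlas (B × JetModel B V k) (Jet B V π (k : ℕ∞)) := by
  change _ ∈ ⋃ (e) (he : e ∈ (jetCore B V π k).atlas), {(jetCore B V π k).openPartialHomeomorph e he}
  simp only [mem_iUnion, mem_singleton_iff]
  exact ⟨c.jetPartialEquiv θ₀, ⟨c, θ₀, rfl⟩, rfl⟩

instance (k : ℕ) : IsManifold 𝓘(ℝ, B × JetModel B V k) ∞ (Jet B V π (k : ℕ∞)) := by
  refine isManifold_of_contDiffOn _ _ _ ?_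
  intro e e' he he'
  change _ ∈ ⋃ (e) (he : e ∈ (jetCore B V π k).atlas),
    {(jetCore B V π k).openPartialHomeomorph e he} at he he'
  simp only [mem_iUnion, mem_singleton_iff] at he he'
  obtain ⟨_, ⟨c, θ₀, rfl⟩, rfl⟩ := he
  obtain ⟨_, ⟨c', θ₀', rfl⟩, rfl⟩ := he'
  have := c.contDiffOn_transition c' θ₀ θ₀'
  refine this.mono ?_
  intro z hz
  exact hz.1

theorem FiberedChart.jetChart_mem_maximalAtlas (c : FiberedChart B V π) {k : ℕ}
    (θ₀ : Jet B V π (k : ℕ∞)) :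
    c.jetChart θ₀ ∈ IsManifold.maximalAtlas 𝓘(ℝ, B × JetModel B V k) ∞ (Jet B V π (k : ℕ∞)) :=
  StructureGroupoid.subset_maximalAtlas _ (c.jetChart_mem_atlas θ₀)

/-- A fibered chart of `π` induces a fibered chart of `π_k : J^k π → M`. -/
def FiberedChart.prolong (c : FiberedChart B V π) {k : ℕ} (θ₀ : Jet B V π (k : ℕ∞)) :
    FiberedChart B (JetModel B V k) (jetProj B V π (k : ℕ∞)) where
  total := c.jetChart θ₀
  base := c.base
  total_mem := c.jetChart_mem_maximalAtlas θ₀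
  base_mem := c.base_mem
  proj_mem := fun θ hθ => c.base_mem_source θ.out hθ
  fst_eq := fun _ _ => rfl

instance (k : ℕ) : IsFiberedManifold B (JetModel B V k) (jetProj B V π (k : ℕ∞)) where
  exists_chart θ := by
    obtain ⟨c, hc⟩ := IsFiberedManifold.exists_chart (B := B) (V := V) (π := π) θ.value
    exact ⟨c.prolong θ, hc⟩

/-- The topology of `J^∞ π` as the inverse limit of the manifolds `J^l π`. -/
instance : TopologicalSpace (Jet B V π ⊤) :=
  ⨅ l : ℕ, TopologicalSpace.induced (Jet.truncate (k := (l : ℕ∞)) le_top) inferInstance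

theorem LocalSection.jetMap_contMDiffAt (s : LocalSection B V π x) (k : ℕ) :
    ContMDiffAt 𝓘(ℝ, B) 𝓘(ℝ, B × JetModel B V k) ∞ (s.jetMap (k : ℕ∞)) x := by
  obtain ⟨c, hc⟩ := IsFiberedManifold.exists_chart (B := B) (V := V) (π := π) (s x)
  have hx := c.base_mem_source s hc
  have e2 : ∀ᶠ y in 𝓝 x, s y ∈ c.total.source :=
    s.contMDiffAt.continuousAt (c.total.open_source.mem_nhds hc)
  have e3 : ∀ᶠ y in 𝓝 x, IsLocalSectionAt B V π y s ∧ s y ∈ c.total.source ∧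
      y ∈ c.base.source :=
    s.eventually_isLocalSectionAt.and (e2.and (c.base.open_source.mem_nhds hx))
  have e4 : ∀ᶠ z in 𝓝 (c.base x), ContDiffAt ℝ ∞ (c.rep s) z := by
    have hcont : Tendsto c.base.symm (𝓝 (c.base x)) (𝓝 x) := by
      have := c.base.continuousAt_symm (c.base.map_source hx)
      rwa [ContinuousAt, c.base.left_inv hx] at this
    filter_upwards [hcont e3, c.base.open_target.mem_nhds (c.base.map_source hx)] with z hz hz'
    obtain ⟨h1, h2, h3⟩ := hz
    have := c.contDiffAt_rep h1.1.self_of_nhds h3 h2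
    rwa [c.base.right_inv hz'] at this
  obtain ⟨N, hN, hNo, hxN⟩ := eventually_nhds_iff.1 e4
  have hg : ContDiffOn ℝ ∞ (fun z => (z, taylorCoeff k (c.rep s) z)) N := by
    refine contDiffOn_id.prodMk (JetModel.contDiffOn_iff.2 fun j => ?_)
    refine ContDiffOn.congr (f := fun z => iteratedFDeriv ℝ j (c.rep s) z) ?_
      (fun z hz => taylorCoeff_coe (hN z hz) j)
    intro z hz
    exact ((hN z hz).iteratedFDeriv_right (m := ∞) (i := j)
      (by exact_mod_cast le_top)).contDiffWithinAt
  have hev : s.jetMap (k : ℕ∞) =ᶠ[𝓝 x] fun y =>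
      (c.jetChart (s.jet (k : ℕ∞))).symm (c.base y, taylorCoeff k (c.rep s) (c.base y)) := by
    filter_upwards [e3] with y hy
    obtain ⟨h1, h2, h3⟩ := hy
    rw [s.jetMap_of_isLocalSectionAt _ h1]
    have h4 := c.jetCoords_jet (LocalSection.mk s.toFun h1) h2 k
    rw [← h4]
    symm
    refine (c.jetPartialEquiv (s.jet (k : ℕ∞))).left_inv ?_
    change Jet.value _ ∈ c.total.source
    rwa [LocalSection.value_jet]
  refine ContMDiffAt.congr_of_eventuallyEq ?_ hev
  have h1 : ContMDiffAt 𝓘(ℝ, B) 𝓘(ℝ, B) ∞ c.base x :=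
    contMDiffAt_of_mem_maximalAtlas c.base_mem hx
  have h2 : ContMDiffAt 𝓘(ℝ, B) 𝓘(ℝ, B × JetModel B V k) ∞
      (fun z => (z, taylorCoeff k (c.rep s) z)) (c.base x) :=
    (hg.contDiffAt (hNo.mem_nhds hxN)).contMDiffAt
  have h3 : ContMDiffAt 𝓘(ℝ, B × JetModel B V k) 𝓘(ℝ, B × JetModel B V k) ∞
      (c.jetChart (s.jet (k : ℕ∞))).symm (c.base x, taylorCoeff k (c.rep s) (c.base x)) := by
    refine contMDiffAt_symm_of_mem_maximalAtlas (c.jetChart_mem_maximalAtlas _) ?_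
    rw [← c.jetCoords_jet s hc k]
    refine (c.jetPartialEquiv (s.jet (k : ℕ∞))).map_source ?_
    change Jet.value _ ∈ c.total.source
    rwa [LocalSection.value_jet]
  exact h3.comp x (h2.comp x h1)

/-- The prolongation `j_k s` as a local section of `π_k`. -/
def LocalSection.prolong (s : LocalSection B V π x) (k : ℕ) :
    LocalSection B (JetModel B V k) (jetProj B V π (k : ℕ∞)) x where
  toFun := s.jetMap (k : ℕ∞)
  isLocalSectionAt := by
    refine ⟨?_, ?_⟩
    · filter_upwards [eventually_eventually_nhds.2 s.eventually_isLocalSectionAt] with y hy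
      have hy0 := hy.self_of_nhds
      refine ((LocalSection.mk s.toFun hy0).jetMap_contMDiffAt k).congr_of_eventuallyEq ?_
      filter_upwards [hy] with z hz
      exact (s.jetMap_of_isLocalSectionAt _ hz).trans
        (LocalSection.jetMap_of_isLocalSectionAt (LocalSection.mk s.toFun hy0) _ hz).symm
    · filter_upwards [s.eventually_isLocalSectionAt] with y hy
      rw [s.jetMap_of_isLocalSectionAt _ hy]
      rfl

end JetManifold

section Connections

variable {B : Type*} [NormedAddCommGroup B] [NormedSpace ℝ B]
  {W : Type*} [NormedAddCommGroup W] [NormedSpace ℝ W]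
  {M : Type*} [TopologicalSpace M] [ChartedSpace B M]
  {P : Type*} [TopologicalSpace P] [ChartedSpace (B × W) P]

variable (B W) in
/-- A connection in `ξ : P → M`: a smooth section of `ξ_{1,0} : J^1 ξ → P`. -/
structure Connection (ξ : P → M) [IsFiberedManifold B W ξ] where
  toFun : P → Jet B W ξ ((1 : ℕ) : ℕ∞)
  value_eq : ∀ p, (toFun p).value = p
  smooth : ContMDiff 𝓘(ℝ, B × W) 𝓘(ℝ, B × JetModel B W 1) ∞ toFun

variable {ξ : P → M} [IsFiberedManifold B W ξ]

instance : CoeFun (Connection B W ξ) (fun _ => P → Jet B W ξ ((1 : ℕ) : ℕ∞)) :=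
  ⟨Connection.toFun⟩

/-- A local section `σ` is `∇`-constant if `∇ ∘ σ = j_1 σ` (near the point under consideration). -/
def Connection.IsConstant (nabla : Connection B W ξ) {x : M} (σ : LocalSection B W ξ x) : Prop :=
  ∀ᶠ y in 𝓝 x, nabla (σ y) = σ.jetMap ((1 : ℕ) : ℕ∞) y

/-- The horizontal lift `X^∇` of a vector field `X` on the base: at `p`, the image of `X` under
the differential of a section `σ` with `∇ p = j_1 σ (x)`; here `x = ξ p` and `σ x = p`. -/
def Connection.lift (nabla : Connection B W ξ) (X : (x : M) → TangentSpace 𝓘(ℝ, B) x) (p : P) :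
    TangentSpace 𝓘(ℝ, B × W) p :=
  show B × W from
    mfderiv 𝓘(ℝ, B) 𝓘(ℝ, B × W) (nabla p).out.toFun (nabla p).base (X (nabla p).base)

/-- Flatness: the curvature `R(X, Y) = [X^∇, Y^∇] - [X, Y]^∇` vanishes for all smooth vector fields
`X`, `Y` on the base. -/
def Connection.IsFlat [IsManifold 𝓘(ℝ, B) ∞ M] (nabla : Connection B W ξ) : Prop :=
  ∀ X Y : (x : M) → TangentSpace 𝓘(ℝ, B) x,
    ContMDiff 𝓘(ℝ, B) 𝓘(ℝ, B).tangent ∞ (fun x => (⟨x, X x⟩ : TangentBundle 𝓘(ℝ, B) M)) →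
    ContMDiff 𝓘(ℝ, B) 𝓘(ℝ, B).tangent ∞ (fun x => (⟨x, Y x⟩ : TangentBundle 𝓘(ℝ, B) M)) →
    ∀ p : P, VectorField.mlieBracket 𝓘(ℝ, B × W) (nabla.lift X) (nabla.lift Y) p -
      nabla.lift (VectorField.mlieBracket 𝓘(ℝ, B) X Y) p = 0

end Connections

section JetConnections

variable {B : Type*} [NormedAddCommGroup B] [NormedSpace ℝ B]
  {V : Type*} [NormedAddCommGroup V] [NormedSpace ℝ V]
  {M : Type*} [TopologicalSpace M] [ChartedSpace B M]
  {E : Type*} [TopologicalSpace E] [ChartedSpace (B × V) E]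
  {π : E → M} [IsFiberedManifold B V π] {k : ℕ}

variable (B V π k) in
/-- Connections in `π_k : J^k π → M`. -/
abbrev JetConnection : Type _ := Connection B (JetModel B V k) (jetProj B V π (k : ℕ∞))

/-- The inclusion `J^{k+1} π → J^1 π_k`, `j_{k+1} s (x) ↦ j_1 (j_k s) (x)`. -/
def jetInclusion (Θ : Jet B V π ((k + 1 : ℕ) : ℕ∞)) :
    Jet B (JetModel B V k) (jetProj B V π (k : ℕ∞)) ((1 : ℕ) : ℕ∞) :=
  (Θ.out.prolong k).jet ((1 : ℕ) : ℕ∞)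

/-- A connection in `π_k` is holonomic if it takes its values in `J^{k+1} π ⊆ J^1 π_k`. -/
def Connection.IsHolonomic (nabla : JetConnection B V π k) : Prop :=
  ∀ θ, nabla θ ∈ range (jetInclusion (B := B) (V := V) (π := π) (k := k))

/-- `s` is a `∇`-constant solution through `θ`: a local section of `π` around `x = π_k θ` with
`j_k s (x) = θ` and `j_k s` a `∇`-constant section of `π_k`. -/
def Connection.IsSolutionThrough (nabla : JetConnection B V π k) (θ : Jet B V π (k : ℕ∞))
    (s : LocalSection B V π θ.base) : Prop :=
  s.jet (k : ℕ∞) = θ ∧ nabla.IsConstant (s.prolong k)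

/-- The map `J^k π → J^l π` sending `θ` to the `l`-jet of the `∇`-constant solution through `θ`;
it is `∇_[r]` for `l = k + r`. -/
def Connection.bracket (nabla : JetConnection B V π k) (l : ℕ∞) (θ : Jet B V π (k : ℕ∞)) :
    Jet B V π l :=
  (@Classical.epsilon _ ⟨θ.out⟩ (nabla.IsSolutionThrough θ)).jet l

/-- Smooth closed embeddings of a finite dimensional manifold `N` in `J^∞ π`. A map to `J^∞ π` is
smooth if all its truncations to `J^l π`, `l < ∞`, are so; as the tangent spaces of `J^∞ π` are
the inverse limits of those of the `J^l π`, it is an immersion at a point if so is one of its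
truncations. -/
structure IsSmoothClosedEmbeddingInfty (H : Type*) [NormedAddCommGroup H] [NormedSpace ℝ H]
    {N : Type*} [TopologicalSpace N] [ChartedSpace H N] (f : N → Jet B V π ⊤) : Prop where
  contMDiff : ∀ l : ℕ, ContMDiff 𝓘(ℝ, H) 𝓘(ℝ, B × JetModel B V l) ∞
    (fun p => (f p).truncate (k := (l : ℕ∞)) le_top)
  isImmersionAt : ∀ p, ∃ l : ℕ, IsImmersionAt 𝓘(ℝ, H) 𝓘(ℝ, B × JetModel B V l) ∞
    (fun p => (f p).truncate (k := (l : ℕ∞)) le_top) p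
  isClosedEmbedding : IsClosedEmbedding f

end JetConnections

section Coordinates

/-- The coordinate space `ℝ^n`. -/
abbrev Rn (n : ℕ) : Type := EuclideanSpace ℝ (Fin n)

variable {n m : ℕ} {M : Type*} [TopologicalSpace M] [ChartedSpace (Rn n) M]
  {E : Type*} [TopologicalSpace E] [ChartedSpace (Rn n × Rn m) E]
  {π : E → M}

/-- The jet coordinate `u^α_I` in a fibered chart, on jets of order at least `|I|`: the partial
derivative `∂^{|I|} s^α / ∂x^I`. -/
def FiberedChart.coord (c : FiberedChart (Rn n) (Rn m) π) (I : List (Fin n)) (α : Fin m)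
    {l : ℕ∞} (Θ : Jet (Rn n) (Rn m) π l) : ℝ :=
  (iteratedFDeriv ℝ I.length (c.rep Θ.out) (c.base Θ.base)
    (fun j => EuclideanSpace.single (I.get j) 1)) α

/-- The coordinate vector field `∂/∂x^i` of a fibered chart on (its domain in) the base. -/
def FiberedChart.coordField (c : FiberedChart (Rn n) (Rn m) π) (i : Fin n) (x : M) :
    TangentSpace 𝓘(ℝ, Rn n) x :=
  show Rn n from
    mfderiv 𝓘(ℝ, Rn n) 𝓘(ℝ, Rn n) c.base.symm (c.base x) (EuclideanSpace.single i (1 : ℝ) : Rn n)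

variable [IsFiberedManifold (Rn n) (Rn m) π] {k : ℕ}

/-- The derivative `∇_i f` of a function `f` on `J^k π` along the horizontal lift
`∇_i = ∂/∂x^i + (∇^α_I)_i ∂/∂u^α_I` of the coordinate field `∂/∂x^i`. -/
def Connection.derivAlong (nabla : JetConnection (Rn n) (Rn m) π k)
    (c : FiberedChart (Rn n) (Rn m) π) (i : Fin n) (f : Jet (Rn n) (Rn m) π (k : ℕ∞) → ℝ)
    (θ : Jet (Rn n) (Rn m) π (k : ℕ∞)) : ℝ :=
  mfderiv 𝓘(ℝ, Rn n × JetModel (Rn n) (Rn m) k) 𝓘(ℝ, ℝ) f θ (nabla.lift (c.coordField i) θ)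

/-- `∇_I f = ∇_{i_1} ⋯ ∇_{i_s} f` for `I = (i_1, …, i_s)`. -/
def Connection.iterDerivAlong (nabla : JetConnection (Rn n) (Rn m) π k)
    (c : FiberedChart (Rn n) (Rn m) π) (I : List (Fin n))
    (f : Jet (Rn n) (Rn m) π (k : ℕ∞) → ℝ) : Jet (Rn n) (Rn m) π (k : ℕ∞) → ℝ :=
  I.foldr (fun i g => nabla.derivAlong c i g) f

end Coordinates

end JetBundle

end

open JetBundle

/-!
# Flat holonomic connections on jet bundles

A connection in `π_k : J^k π → M` is, in a fibered chart, a total differential equation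
`Du = Γ(x, u)` for the coordinates `u` of a section of `π_k`; `Connection.isConstant_iff` identifies
its solutions with the `∇`-constant sections. Evaluating flatness on vector fields with prescribed
values at a point shows that `Γ` has vanishing curvature
(`Connection.IsFlat.curvatureFreeAt`), so that by Frobenius' theorem
(`exists_hasFDerivAt_of_curvatureFree`) there is a unique germ of a solution through every point.
If the connection is holonomic, the components of `Γ` of order `j < k` are the jet coordinates of
order `j + 1` (`Connection.IsHolonomic.coeff_apply`). Hence every component of a solution is the
derivative of the preceding one, and the solution is the `k`-jet prolongation of a section of `π`
(`Connection.IsHolonomic.taylorCoeff_zeroth`). This gives the solutions `s_θ`.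

Differentiating `u^α(s_θ)` repeatedly and eliminating `Du` by the equation expresses the derivatives
of `s_θ` at `x` through the coordinates of `θ`: they are the total derivatives `totalDeriv` of `u^α`
with respect to `Γ`, which are smooth functions on `J^k π`. Therefore `∇_[r]` is smooth, and as the
horizontal lift of `∂/∂x^i` is `∂/∂x^i + Γ_i ∂/∂u` in coordinates, these functions are the `∇_I u^α`
(`Connection.iterDerivAlong_coord`).

Finally `∇_[r]` is a section of the truncation `J^{k+r} π → J^k π`, which is linear in jet
coordinates. A continuous section of a continuous map defined on a Hausdorff space is a closed
embedding, and a smooth section of a linear projection is straightened by a shear along the fibers,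
so that it is an immersion (`isImmersionAtOfComplement_of_coordinates`). For `r = ∞` the truncation
of `∇_[∞]` to `J^k π` is the identity, hence an immersion.
-/

namespace JetBundle

/-! ### Total differential equations and Frobenius' theorem -/

section TotalDifferentialEquations

variable {B : Type*} [NormedAddCommGroup B] [NormedSpace ℝ B]
  {W : Type*} [NormedAddCommGroup W] [NormedSpace ℝ W]

/-- The symmetry in the two base directions that characterizes, at the point `a`, the integrability
of the total differential equation `Du = Γ(x, u)`: the curvature of `Γ` vanishes at `a`. -/
def CurvatureFreeAt (Γ : B × W → B →L[ℝ] W) (a : B × W) : Prop :=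
  ∀ v w : B, fderiv ℝ Γ a (v, Γ a v) w = fderiv ℝ Γ a (w, Γ a w) v

/-- The Picard–Lindelöf theorem on `[0, 1]`, including the fact that the solution stays in the
ball on which the hypotheses are made. -/
theorem exists_solution_mem_closedBall [CompleteSpace W] {f : ℝ → W → W} {u₀ : W}
    {a L K : NNReal}
    (hf : IsPicardLindelof f (tmin := 0) (tmax := 1) ⟨0, by simp⟩ u₀ a 0 L K) :
    ∃ α : ℝ → W, α 0 = u₀ ∧ ∀ t ∈ Icc (0 : ℝ) 1, α t ∈ Metric.closedBall u₀ a ∧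
      HasDerivWithinAt α (f t (α t)) (Icc 0 1) t := by
  have hx : u₀ ∈ Metric.closedBall u₀ ((0 : NNReal) : ℝ) := by simp
  obtain ⟨α, hα⟩ := ODE.FunSpace.exists_isFixedPt_next hf hx
  refine ⟨α.compProj, ?_, fun t ht => ⟨α.compProj_mem_closedBall hf.mul_max_le, ?_⟩⟩
  · have := ODE.FunSpace.next_apply₀ hf hx α
    rw [hα] at this
    rw [ODE.FunSpace.compProj_of_mem (by simp)]
    exact this
  · refine (ODE.hasDerivWithinAt_picard_Icc (t₀ := 0) (x₀ := u₀) (by simp) hf.continuousOn_uncurry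
      α.continuous_compProj.continuousOn (fun _ _ => α.compProj_mem_closedBall hf.mul_max_le)
      ht).congr_of_mem ?_ ht
    intro t' ht'
    nth_rw 1 [← hα]
    rw [ODE.FunSpace.compProj_of_mem ht', ODE.FunSpace.next_apply]

/-- Local uniform bounds for a smooth right hand side, with a single constant. -/
theorem exists_uniform_bounds {Γ : B × W → B →L[ℝ] W} {a₀ : B × W} (hΓ : ContDiffAt ℝ ∞ Γ a₀)
    {P : B × W → Prop} (hP : ∀ᶠ a in 𝓝 a₀, P a) :
    ∃ ρ > 0, ∃ L : NNReal, 1 ≤ L ∧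
      (∀ a ∈ Metric.closedBall a₀ ρ, P a ∧ DifferentiableAt ℝ Γ a ∧ ‖Γ a‖ ≤ L ∧
        ‖fderiv ℝ Γ a‖ ≤ L) ∧
      LipschitzOnWith L (fderiv ℝ Γ) (Metric.closedBall a₀ ρ) := by
  have h1 : ContDiffAt ℝ 1 (fderiv ℝ Γ) a₀ := hΓ.fderiv_right (by norm_cast)
  obtain ⟨K, s, hs, hK⟩ := h1.exists_lipschitzOnWith
  have h2 : ∀ᶠ a in 𝓝 a₀, DifferentiableAt ℝ Γ a := by
    have := (hΓ.of_le (m := 1) (by norm_cast)).eventually (by simp)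
    filter_upwards [this] with a ha using ha.differentiableAt (by simp)
  have h3 : ∀ᶠ a in 𝓝 a₀, ‖Γ a‖ < ‖Γ a₀‖ + 1 :=
    hΓ.continuousAt.norm.eventually (gt_mem_nhds (lt_add_one ‖Γ a₀‖))
  have h4 : ∀ᶠ a in 𝓝 a₀, ‖fderiv ℝ Γ a‖ < ‖fderiv ℝ Γ a₀‖ + K + 1 := by
    filter_upwards [hs, Metric.ball_mem_nhds a₀ one_pos] with a ha ha'
    have e1 := hK.norm_sub_le ha (mem_of_mem_nhds hs)
    have e2 : (K : ℝ) * ‖a - a₀‖ ≤ K * 1 := by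
      gcongr; exact (mem_ball_iff_norm.1 ha').le
    have e3 := norm_le_norm_add_norm_sub' (fderiv ℝ Γ a) (fderiv ℝ Γ a₀)
    linarith
  obtain ⟨ρ, hρ, h⟩ := Metric.nhds_basis_closedBall.eventually_iff.1
    (hP.and (h2.and (h3.and (h4.and hs))))
  refine ⟨ρ, hρ, 1 + K + ‖Γ a₀‖₊ + ‖fderiv ℝ Γ a₀‖₊, ?_, ?_, ?_⟩
  · rw [add_assoc, add_assoc]; exact le_self_add
  · intro a ha
    obtain ⟨h1, h2, h3, h4, -⟩ := h ha
    have := norm_nonneg (Γ a₀)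
    have := norm_nonneg (fderiv ℝ Γ a₀)
    have := K.2
    refine ⟨h1, h2, ?_, ?_⟩ <;> push_cast <;> linarith
  · refine (hK.mono fun a ha => (h ha).2.2.2.2).weaken ?_
    rw [add_comm 1 K, add_assoc, add_assoc]; exact le_self_add

/-- Solutions of `Du = Γ(x, u)` with the same value at a point agree near that point. -/
theorem eventuallyEq_of_hasFDerivAt {Γ : B × W → B →L[ℝ] W} {x₀ : B} {p q : B → W}
    (hΓ : ContDiffAt ℝ ∞ Γ (x₀, p x₀))
    (hp : ∀ᶠ y in 𝓝 x₀, HasFDerivAt p (Γ (y, p y)) y)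
    (hq : ∀ᶠ y in 𝓝 x₀, HasFDerivAt q (Γ (y, q y)) y) (h0 : p x₀ = q x₀) :
    p =ᶠ[𝓝 x₀] q := by
  obtain ⟨K, s, hs, hK⟩ := (hΓ.of_le (m := 1) (by norm_cast)).exists_lipschitzOnWith
  have hcp : Tendsto (fun y => (y, p y)) (𝓝 x₀) (𝓝 (x₀, p x₀)) :=
    (continuousAt_id.prodMk hp.self_of_nhds.continuousAt)
  have hcq : Tendsto (fun y => (y, q y)) (𝓝 x₀) (𝓝 (x₀, p x₀)) := by
    rw [h0]; exact (continuousAt_id.prodMk hq.self_of_nhds.continuousAt)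
  obtain ⟨r, hr, h⟩ := Metric.nhds_basis_ball.eventually_iff.1
    (hp.and (hq.and ((hcp.eventually_mem hs).and (hcq.eventually_mem hs))))
  filter_upwards [Metric.ball_mem_nhds x₀ hr] with y hy
  have hmem : ∀ t ∈ Icc (0 : ℝ) 1, x₀ + t • (y - x₀) ∈ Metric.ball x₀ r := fun t ht =>
    (convex_ball x₀ r).add_smul_sub_mem (Metric.mem_ball_self hr) hy ht
  have hline : ∀ t : ℝ, HasDerivAt (fun t : ℝ => x₀ + t • (y - x₀)) (y - x₀) t := fun t => by
    simpa using ((hasDerivAt_id t).smul_const (y - x₀)).const_add x₀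
  have hder : ∀ t ∈ Icc (0 : ℝ) 1, HasDerivAt
      (fun t : ℝ => p (x₀ + t • (y - x₀)) - q (x₀ + t • (y - x₀)))
      (Γ (x₀ + t • (y - x₀), p (x₀ + t • (y - x₀))) (y - x₀) -
        Γ (x₀ + t • (y - x₀), q (x₀ + t • (y - x₀))) (y - x₀)) t := fun t ht =>
    ((h (hmem t ht)).1.comp_hasDerivAt t (hline t)).sub
      ((h (hmem t ht)).2.1.comp_hasDerivAt t (hline t))
  have key := eq_zero_of_abs_deriv_le_mul_abs_self_of_eq_zero_right
    (f := fun t : ℝ => p (x₀ + t • (y - x₀)) - q (x₀ + t • (y - x₀)))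
    (K := K * ‖y - x₀‖) (a := 0) (b := 1)
    (fun t ht => (hder t ht).continuousAt.continuousWithinAt)
    (fun t ht => (hder t (Ico_subset_Icc_self ht)).hasDerivWithinAt) (by simp [h0])
    (fun t ht => by
      obtain ⟨-, -, h3, h4⟩ := h (hmem t (Ico_subset_Icc_self ht))
      rw [← _root_.sub_apply]
      refine (ContinuousLinearMap.le_opNorm _ _).trans ?_
      have := hK.norm_sub_le h3 h4
      rw [Prod.mk_sub_mk, sub_self, Prod.norm_mk, norm_zero, max_eq_right (norm_nonneg _)] at this
      calc _ ≤ K * ‖p (x₀ + t • (y - x₀)) - q (x₀ + t • (y - x₀))‖ * ‖y - x₀‖ := by gcongr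
        _ = _ := by ring)
  have := key 1 (by simp)
  simpa [sub_eq_zero] using this

/-- A solution of `Du = Γ(x, u)` with smooth `Γ` is smooth. -/
theorem eventually_contDiffAt_of_hasFDerivAt {Γ : B × W → B →L[ℝ] W} {x₀ : B} {p : B → W}
    (hΓ : ∀ᶠ a in 𝓝 (x₀, p x₀), ContDiffAt ℝ ∞ Γ a)
    (hp : ∀ᶠ y in 𝓝 x₀, HasFDerivAt p (Γ (y, p y)) y) :
    ∀ᶠ y in 𝓝 x₀, ContDiffAt ℝ ∞ p y := by
  have hcp : Tendsto (fun y => (y, p y)) (𝓝 x₀) (𝓝 (x₀, p x₀)) :=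
    (continuousAt_id.prodMk hp.self_of_nhds.continuousAt)
  obtain ⟨N, hN, hNo, hxN⟩ := eventually_nhds_iff.1 (hp.and (hcp.eventually hΓ))
  have hn : ∀ n : ℕ, ContDiffOn ℝ n p N := by
    intro n
    induction n with
    | zero =>
      simp only [CharP.cast_eq_zero, contDiffOn_zero]
      exact fun y hy => (hN y hy).1.continuousAt.continuousWithinAt
    | succ n ih =>
      push_cast
      rw [contDiffOn_succ_iff_fderiv_of_isOpen hNo]
      refine ⟨fun y hy => (hN y hy).1.differentiableAt.differentiableWithinAt, by simp, ?_⟩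
      refine ContDiffOn.congr (f := fun y => Γ (y, p y)) ?_ fun y hy => (hN y hy).1.fderiv
      intro y hy
      have h1 : ContDiffAt ℝ n Γ (y, p y) := (hN y hy).2.of_le (by exact_mod_cast le_top)
      exact h1.comp_contDiffWithinAt y (contDiffWithinAt_id.prodMk (ih y hy))
  have hinf : ContDiffOn ℝ ∞ p N := contDiffOn_infty.2 hn
  filter_upwards [hNo.mem_nhds hxN] with y hy using hinf.contDiffAt (hNo.mem_nhds hy)

/-- **Frobenius' theorem** for the total differential equation `Du = Γ(x, u)`: if the curvature of
`Γ` vanishes near `(x₀, u₀)`, there is a solution with `u(x₀) = u₀`.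

The solution at `x₀ + v` is the endpoint `α_v(1)` of the solution of the ordinary differential
equation `α' = Γ(x₀ + t v, α) v`, `α(0) = u₀`, along the segment from `x₀` to `x₀ + v`. Vanishing
curvature makes `t ↦ α_v(t) + t Γ(x₀ + t v, α_v(t)) h` solve the equation for `v + h` up to an error
`O(‖h‖²)`, so that Grönwall's inequality yields
`α_{v + h}(1) = α_v(1) + Γ(x₀ + v, α_v(1)) h + O(‖h‖²)`. No dependence of solutions on parameters
is needed. -/
theorem exists_hasFDerivAt_of_curvatureFree [CompleteSpace W] {Γ : B × W → B →L[ℝ] W} {x₀ : B}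
    {u₀ : W} (hΓ : ContDiffAt ℝ ∞ Γ (x₀, u₀)) (hcurv : ∀ᶠ a in 𝓝 (x₀, u₀), CurvatureFreeAt Γ a) :
    ∃ u : B → W, u x₀ = u₀ ∧ ∀ᶠ y in 𝓝 x₀, HasFDerivAt u (Γ (y, u y)) y := by
  obtain ⟨ρ, hρ, L, hL1, hbd, hLip⟩ := exists_uniform_bounds hΓ hcurv
  have hL1' : (1 : ℝ) ≤ L := by exact_mod_cast hL1
  have hL0 : (0 : ℝ) < L := by linarith
  set Q := Metric.closedBall (x₀, u₀) ρ with hQ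
  have hQc : Convex ℝ Q := convex_closedBall _ _
  have hQmem : ∀ (x : B) (w : W), ‖x - x₀‖ ≤ ρ → ‖w - u₀‖ ≤ ρ → (x, w) ∈ Q := by
    intro x w h1 h2
    rw [hQ, mem_closedBall_iff_norm, Prod.mk_sub_mk, Prod.norm_mk]
    exact max_le h1 h2
  -- `Γ` is Lipschitz on `Q`, and its second order Taylor remainder is controlled
  have hΓLip : ∀ a ∈ Q, ∀ b ∈ Q, ‖Γ b - Γ a‖ ≤ L * ‖b - a‖ := fun a ha b hb =>
    hQc.norm_image_sub_le_of_norm_fderiv_le (fun c hc => (hbd c hc).2.1)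
      (fun c hc => (hbd c hc).2.2.2) ha hb
  have hTaylor : ∀ a ∈ Q, ∀ b ∈ Q, ‖Γ b - Γ a - fderiv ℝ Γ a (b - a)‖ ≤ L * ‖b - a‖ ^ 2 := by
    intro a ha b hb
    have hseg : segment ℝ a b ⊆ Q := hQc.segment_subset ha hb
    have := (convex_segment (𝕜 := ℝ) a b).norm_image_sub_le_of_norm_fderiv_le' (f := Γ)
      (φ := fderiv ℝ Γ a) (C := L * ‖b - a‖) (fun c hc => (hbd c (hseg hc)).2.1)
      (fun c hc => (hLip.norm_sub_le (hseg hc) ha).trans (by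
        gcongr
        exact norm_sub_le_of_mem_segment hc))
      (left_mem_segment ℝ a b) (right_mem_segment ℝ a b)
    rwa [mul_assoc, ← pow_two] at this
  -- the solutions along the segments issuing from `x₀`
  obtain ⟨ε, hε, hε1, hερ, hεL⟩ : ∃ ε : ℝ, 0 < ε ∧ ε ≤ 1 ∧ ε ≤ ρ ∧ L * ε ≤ ρ / 2 := by
    refine ⟨min 1 (min ρ (ρ / 2 / L)), by positivity, min_le_left _ _,
      (min_le_right _ _).trans (min_le_left _ _), ?_⟩
    calc (L : ℝ) * min 1 (min ρ (ρ / 2 / L)) ≤ L * (ρ / 2 / L) := by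
          gcongr; exact (min_le_right _ _).trans (min_le_right _ _)
      _ = ρ / 2 := by field_simp
  have hray : ∀ v : B, ‖v‖ ≤ ε → ∀ t ∈ Icc (0 : ℝ) 1, ‖x₀ + t • v - x₀‖ ≤ ρ := by
    intro v hv t ht
    rw [add_sub_cancel_left, norm_smul, Real.norm_of_nonneg ht.1]
    nlinarith [ht.1, ht.2, norm_nonneg v]
  have hex : ∀ v : B, ‖v‖ ≤ ε → ∃ α : ℝ → W, α 0 = u₀ ∧ ∀ t ∈ Icc (0 : ℝ) 1,
      ‖α t - u₀‖ ≤ ρ / 2 ∧ HasDerivWithinAt α (Γ (x₀ + t • v, α t) v) (Icc 0 1) t := by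
    intro v hv
    have hball : ∀ w ∈ Metric.closedBall u₀ ((ρ / 2).toNNReal : ℝ), ‖w - u₀‖ ≤ ρ := by
      intro w hw
      rw [mem_closedBall_iff_norm, Real.coe_toNNReal _ (by positivity)] at hw
      linarith
    have hpl : IsPicardLindelof (fun t w => Γ (x₀ + t • v, w) v) (tmin := 0) (tmax := 1)
        ⟨0, by simp⟩ u₀ (ρ / 2).toNNReal 0 (L * ε.toNNReal) L := by
      refine ⟨fun t ht => LipschitzOnWith.of_dist_le_mul fun w hw w' hw' => ?_, fun w hw => ?_,
        fun t ht w hw => ?_, ?_⟩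
      · rw [dist_eq_norm, dist_eq_norm, ← _root_.sub_apply]
        refine (ContinuousLinearMap.le_opNorm _ _).trans ?_
        have h1 := hΓLip _ (hQmem _ w' (hray v hv t ht) (hball w' hw')) _
          (hQmem _ w (hray v hv t ht) (hball w hw))
        rw [Prod.mk_sub_mk, sub_self, Prod.norm_mk, norm_zero, max_eq_right (norm_nonneg _)] at h1
        calc _ ≤ (L * ‖w - w'‖) * 1 := by gcongr; exact hv.trans hε1
          _ = _ := mul_one _
      · intro t ht
        have h1 := (hbd _ (hQmem _ w (hray v hv t ht) (hball w hw))).2.1.continuousAt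
        have h2 : ContinuousAt (fun t : ℝ => (x₀ + t • v, w)) t := by fun_prop
        have h3 : ContinuousAt (fun t : ℝ => Γ (x₀ + t • v, w)) t :=
          ContinuousAt.comp (f := fun t : ℝ => (x₀ + t • v, w)) h1 h2
        exact (h3.clm_apply continuousAt_const).continuousWithinAt
      · refine (ContinuousLinearMap.le_opNorm _ _).trans ?_
        push_cast
        rw [Real.coe_toNNReal _ hε.le]
        gcongr
        exact (hbd _ (hQmem _ w (hray v hv t ht) (hball w hw))).2.2.1
      · push_cast
        rw [Real.coe_toNNReal _ hε.le, Real.coe_toNNReal _ (by positivity)]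
        simpa using hεL
    obtain ⟨α, h0, h1⟩ := exists_solution_mem_closedBall hpl
    refine ⟨α, h0, fun t ht => ⟨?_, (h1 t ht).2⟩⟩
    have := (h1 t ht).1
    rwa [mem_closedBall_iff_norm, Real.coe_toNNReal _ (by positivity)] at this
  choose! α hα0 hα using hex
  have hαQ : ∀ v : B, ‖v‖ ≤ ε → ∀ t ∈ Icc (0 : ℝ) 1, (x₀ + t • v, α v t) ∈ Q := fun v hv t ht =>
    hQmem _ _ (hray v hv t ht) (by have := (hα v hv t ht).1; linarith)
  -- comparison of the solutions along two neighbouring segments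
  have key : ∀ v h : B, ‖v‖ ≤ ε → ‖v + h‖ ≤ ε → L * ‖h‖ ≤ ρ / 2 →
      ‖α (v + h) 1 - α v 1 - Γ (x₀ + v, α v 1) h‖ ≤
        gronwallBound 0 L 1 1 * (L ^ 2 + L ^ 3) * ‖h‖ ^ 2 := by
    intro v h hv hvh hh
    set a : ℝ → B × W := fun t => (x₀ + t • v, α v t) with ha
    set φ : ℝ → W := fun t => α v t + t • Γ (a t) h with hφ
    set φ' : ℝ → W := fun t => Γ (a t) v +
      (t • fderiv ℝ Γ (a t) (v, Γ (a t) v) h + (1 : ℝ) • Γ (a t) h) with hφ'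
    have haQ : ∀ t ∈ Icc (0 : ℝ) 1, a t ∈ Q := hαQ v hv
    have hda : ∀ t ∈ Icc (0 : ℝ) 1, HasDerivWithinAt a (v, Γ (a t) v) (Icc 0 1) t := by
      intro t ht
      refine HasDerivWithinAt.prodMk ?_ (hα v hv t ht).2
      simpa using (((hasDerivAt_id t).smul_const v).const_add x₀).hasDerivWithinAt
    have hdφ : ∀ t ∈ Icc (0 : ℝ) 1, HasDerivWithinAt φ (φ' t) (Icc 0 1) t := by
      intro t ht
      have h1 : HasDerivWithinAt (fun t => Γ (a t)) (fderiv ℝ Γ (a t) (v, Γ (a t) v))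
          (Icc 0 1) t :=
        (hbd _ (haQ t ht)).2.1.hasFDerivAt.comp_hasDerivWithinAt t (hda t ht)
      have h2 : HasDerivWithinAt (fun t => Γ (a t) h)
          (fderiv ℝ Γ (a t) (v, Γ (a t) v) h) (Icc 0 1) t := by
        simpa using h1.clm_apply (hasDerivWithinAt_const t _ h)
      exact (hα v hv t ht).2.add ((hasDerivWithinAt_id t _).smul h2)
    have hbh : ∀ t ∈ Icc (0 : ℝ) 1, ‖(h, Γ (a t) h)‖ ≤ L * ‖h‖ := by
      intro t ht
      rw [Prod.norm_mk]
      refine max_le (le_mul_of_one_le_left (norm_nonneg _) hL1') ?_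
      exact ((Γ (a t)).le_opNorm h).trans (by gcongr; exact (hbd _ (haQ t ht)).2.2.1)
    have hφball : ∀ t ∈ Icc (0 : ℝ) 1, ‖φ t - u₀‖ ≤ ρ := by
      intro t ht
      have h1 : ‖t • Γ (a t) h‖ ≤ ρ / 2 := by
        rw [norm_smul, Real.norm_of_nonneg ht.1]
        have h2 : ‖Γ (a t) h‖ ≤ L * ‖h‖ := (le_max_right _ _).trans (hbh t ht)
        nlinarith [ht.1, ht.2, norm_nonneg (Γ (a t) h)]
      have h2 := (hα v hv t ht).1
      calc ‖φ t - u₀‖ = ‖(α v t - u₀) + t • Γ (a t) h‖ := congrArg _ (by simp only [hφ]; abel)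
        _ ≤ ρ / 2 + ρ / 2 := norm_add_le_of_le h2 h1
        _ = ρ := by ring
    have hφQ : ∀ t ∈ Icc (0 : ℝ) 1, (x₀ + t • (v + h), φ t) ∈ Q := fun t ht =>
      hQmem _ _ (hray _ hvh t ht) (hφball t ht)
    have hIco : ∀ {f : ℝ → W} {f' : W} {t : ℝ}, t ∈ Ico (0 : ℝ) 1 →
        HasDerivWithinAt f f' (Icc 0 1) t → HasDerivWithinAt f f' (Ici t) t := fun ht hd =>
      hd.mono_of_mem_nhdsWithin (mem_of_superset (Icc_mem_nhdsGE_of_mem ht) (by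
        exact fun _ hx => hx))
    have herr : ∀ t ∈ Ico (0 : ℝ) 1, dist (φ' t) (Γ (x₀ + t • (v + h), φ t) (v + h)) ≤
        (L ^ 2 + L ^ 3) * ‖h‖ ^ 2 := by
      intro t ht'
      have ht := Ico_subset_Icc_self ht'
      have hdiff : (x₀ + t • (v + h), φ t) - a t = t • (h, Γ (a t) h) := by
        simp only [ha, hφ, Prod.mk_sub_mk, Prod.smul_mk]
        congr 1
        · rw [smul_add]; abel
        · abel
      set R := Γ (x₀ + t • (v + h), φ t) - Γ (a t) -
        fderiv ℝ Γ (a t) ((x₀ + t • (v + h), φ t) - a t) with hR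
      have hnt : ‖t • (h, Γ (a t) h)‖ ≤ L * ‖h‖ := by
        rw [norm_smul, Real.norm_of_nonneg ht.1]
        have := hbh t ht
        nlinarith [ht.1, ht.2, norm_nonneg (h, Γ (a t) h)]
      have hRb : ‖R‖ ≤ L ^ 3 * ‖h‖ ^ 2 := by
        refine (hTaylor _ (haQ t ht) _ (hφQ t ht)).trans ?_
        rw [hdiff]
        calc (L : ℝ) * ‖t • (h, Γ (a t) h)‖ ^ 2 ≤ L * (L * ‖h‖) ^ 2 := by gcongr
          _ = _ := by ring
      have heq : φ' t - Γ (x₀ + t • (v + h), φ t) (v + h) =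
          -(t • fderiv ℝ Γ (a t) (h, Γ (a t) h) h) - R (v + h) := by
        have h1 : Γ (x₀ + t • (v + h), φ t) =
            R + Γ (a t) + t • fderiv ℝ Γ (a t) (h, Γ (a t) h) := by
          rw [hR, hdiff, map_smul]; abel
        have h2 := (hbd _ (haQ t ht)).1 v h
        rw [h1, hφ']
        simp only [_root_.add_apply, _root_.smul_apply, map_add, one_smul, h2]
        abel
      rw [dist_eq_norm, heq]
      have h3 : ‖t • fderiv ℝ Γ (a t) (h, Γ (a t) h) h‖ ≤ L ^ 2 * ‖h‖ ^ 2 := by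
        rw [norm_smul, Real.norm_of_nonneg ht.1]
        have h4 : ‖fderiv ℝ Γ (a t) (h, Γ (a t) h) h‖ ≤ L * (L * ‖h‖) * ‖h‖ := by
          refine (ContinuousLinearMap.le_opNorm _ _).trans ?_
          gcongr
          refine (ContinuousLinearMap.le_opNorm _ _).trans ?_
          exact mul_le_mul (hbd _ (haQ t ht)).2.2.2 (hbh t ht) (norm_nonneg _) hL0.le
        nlinarith [ht.1, ht.2, norm_nonneg (fderiv ℝ Γ (a t) (h, Γ (a t) h) h)]
      have h5 : ‖R (v + h)‖ ≤ L ^ 3 * ‖h‖ ^ 2 := by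
        refine (R.le_opNorm _).trans ?_
        calc ‖R‖ * ‖v + h‖ ≤ (L ^ 3 * ‖h‖ ^ 2) * 1 := by gcongr; exact hvh.trans hε1
          _ = _ := mul_one _
      calc _ ≤ ‖-(t • fderiv ℝ Γ (a t) (h, Γ (a t) h) h)‖ + ‖R (v + h)‖ := norm_sub_le _ _
        _ ≤ L ^ 2 * ‖h‖ ^ 2 + L ^ 3 * ‖h‖ ^ 2 := by rw [norm_neg]; exact add_le_add h3 h5
        _ = _ := by ring
    have hG := dist_le_of_approx_trajectories_ODE_of_mem (a := (0 : ℝ)) (b := 1) (K := L)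
      (v := fun t w => Γ (x₀ + t • (v + h), w) (v + h))
      (s := fun _ => Metric.closedBall u₀ ρ) (f := α (v + h)) (g := φ)
      (f' := fun t => Γ (x₀ + t • (v + h), α (v + h) t) (v + h)) (g' := φ') (δ := 0) (εf := 0)
      (εg := (L ^ 2 + L ^ 3) * ‖h‖ ^ 2)
      (fun t ht => LipschitzOnWith.of_dist_le_mul fun w hw w' hw' => by
        rw [mem_closedBall_iff_norm] at hw hw'
        rw [dist_eq_norm, dist_eq_norm, ← _root_.sub_apply]
        refine (ContinuousLinearMap.le_opNorm _ _).trans ?_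
        have ht' := Ico_subset_Icc_self ht
        have h1 := hΓLip _ (hQmem _ w' (hray _ hvh t ht') hw') _ (hQmem _ w (hray _ hvh t ht') hw)
        rw [Prod.mk_sub_mk, sub_self, Prod.norm_mk, norm_zero, max_eq_right (norm_nonneg _)] at h1
        calc _ ≤ (L * ‖w - w'‖) * 1 := by gcongr; exact hvh.trans hε1
          _ = _ := mul_one _)
      (fun t ht => (hα _ hvh t ht).2.continuousWithinAt)
      (fun t ht => hIco ht (hα _ hvh t (Ico_subset_Icc_self ht)).2)
      (fun t ht => by simp)
      (fun t ht => by
        rw [mem_closedBall_iff_norm]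
        have := (hα _ hvh t (Ico_subset_Icc_self ht)).1; linarith)
      (fun t ht => (hdφ t ht).continuousWithinAt)
      (fun t ht => hIco ht (hdφ t (Ico_subset_Icc_self ht)))
      herr
      (fun t ht => mem_closedBall_iff_norm.2 (hφball t (Ico_subset_Icc_self ht)))
      (by simp [hφ, hα0 _ hvh, hα0 _ hv]) 1 (by simp)
    rw [dist_eq_norm] at hG
    have e1 : α (v + h) 1 - φ 1 = α (v + h) 1 - α v 1 - Γ (x₀ + v, α v 1) h := by
      simp only [hφ, ha, one_smul]; abel
    rw [e1] at hG
    refine hG.trans (le_of_eq ?_)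
    rw [gronwallBound_of_K_ne_0 hL0.ne', gronwallBound_of_K_ne_0 hL0.ne']
    simp only [zero_mul, zero_add, sub_zero, mul_one]
    ring
  refine ⟨fun y => α (y - x₀) 1, ?_, ?_⟩
  · have h0 : ‖(0 : B)‖ ≤ ε := by simpa using hε.le
    have := constant_of_has_deriv_right_zero (f := α 0) (a := 0) (b := 1)
      (fun t ht => (hα 0 h0 t ht).2.continuousWithinAt) (fun t ht => by
        have := (hα 0 h0 t (Ico_subset_Icc_self ht)).2
        rw [map_zero] at this
        exact this.mono_of_mem_nhdsWithin (Icc_mem_nhdsGE_of_mem ht)) 1 (by simp)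
    simp only [sub_self]
    rw [this, hα0 0 h0]
  · filter_upwards [Metric.ball_mem_nhds x₀ hε] with y hy
    rw [mem_ball_iff_norm] at hy
    rw [hasFDerivAt_iff_isLittleO_nhds_zero]
    have hsmall : ∀ᶠ h : B in 𝓝 0, ‖y - x₀ + h‖ < ε ∧ L * ‖h‖ < ρ / 2 := by
      have c1 : ContinuousAt (fun h : B => ‖y - x₀ + h‖) 0 := by fun_prop
      have c2 : ContinuousAt (fun h : B => (L : ℝ) * ‖h‖) 0 := by fun_prop
      refine Filter.Eventually.and ?_ ?_
      · refine (c1 : Tendsto _ _ _).eventually_lt_const ?_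
        simpa using hy
      · refine (c2 : Tendsto _ _ _).eventually_lt_const ?_
        simpa using hρ
    have hO : (fun h : B => α (y + h - x₀) 1 - α (y - x₀) 1 - Γ (y, α (y - x₀) 1) h)
        =O[𝓝 0] fun h => ‖h‖ ^ 2 := by
      refine Asymptotics.IsBigO.of_bound (gronwallBound 0 L 1 1 * (L ^ 2 + L ^ 3)) ?_
      filter_upwards [hsmall] with h hh
      have := key (y - x₀) h hy.le hh.1.le hh.2.le
      rw [add_sub_cancel, show y - x₀ + h = y + h - x₀ by abel] at this
      simpa using this
    exact hO.trans_isLittleO (Asymptotics.isLittleO_norm_pow_id one_lt_two)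

variable {V : Type*} [NormedAddCommGroup V] [NormedSpace ℝ V]

/-- The total derivatives of `g : B × W → V` with respect to the equation `Du = Γ(x, u)`: the
`j`-linear map that expresses the `j`-th derivative of `x ↦ g (x, u(x))` through `(x, u(x))`, for
any solution `u`. -/
noncomputable def totalDeriv (Γ : B × W → B →L[ℝ] W) (g : B × W → V) :
    (j : ℕ) → B × W → B [×j]→L[ℝ] V
  | 0 => fun a => (continuousMultilinearCurryFin0 ℝ B V).symm (g a)
  | j + 1 => fun a => (continuousMultilinearCurryLeftEquiv ℝ (fun _ : Fin (j + 1) => B) V).symm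
      (fderiv ℝ (totalDeriv Γ g j) a ∘L (ContinuousLinearMap.id ℝ B).prod (Γ a))

theorem contDiffOn_totalDeriv {Γ : B × W → B →L[ℝ] W} {g : B × W → V} {S : Set (B × W)}
    (hS : IsOpen S) (hΓ : ContDiffOn ℝ ∞ Γ S) (hg : ContDiffOn ℝ ∞ g S) (j : ℕ) :
    ContDiffOn ℝ ∞ (totalDeriv Γ g j) S := by
  induction j with
  | zero => exact (continuousMultilinearCurryFin0 ℝ B V).symm.contDiff.comp_contDiffOn hg
  | succ j ih =>
    have hL : ContDiff ℝ ∞ ⇑(continuousMultilinearCurryLeftEquiv ℝ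
        (fun _ : Fin (j + 1) => B) V).symm :=
      LinearIsometryEquiv.contDiff (𝕜 := ℝ) (E := B →L[ℝ] B [×j]→L[ℝ] V)
        (F := B [×(j + 1)]→L[ℝ] V)
        (continuousMultilinearCurryLeftEquiv ℝ (fun _ : Fin (j + 1) => B) V).symm
    refine hL.comp_contDiffOn ((ih.fderiv_of_isOpen hS (by norm_cast)).clm_comp ?_)
    have h1 : ContDiffOn ℝ ∞ (fun a => ContinuousLinearMap.inl ℝ B W +
        ContinuousLinearMap.inr ℝ B W ∘L Γ a) S :=
      contDiffOn_const.add (contDiffOn_const.clm_comp hΓ)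
    refine h1.congr fun a _ => ?_
    ext v <;> simp

theorem iteratedFDeriv_eventuallyEq_totalDeriv {Γ : B × W → B →L[ℝ] W} {g : B × W → V}
    {S : Set (B × W)} (hS : IsOpen S) (hΓ : ContDiffOn ℝ ∞ Γ S) (hg : ContDiffOn ℝ ∞ g S)
    {p : B → W} {x₀ : B} (hp : ∀ᶠ y in 𝓝 x₀, HasFDerivAt p (Γ (y, p y)) y)
    (hx₀ : (x₀, p x₀) ∈ S) (j : ℕ) :
    iteratedFDeriv ℝ j (fun y => g (y, p y)) =ᶠ[𝓝 x₀] fun y => totalDeriv Γ g j (y, p y) := by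
  induction j with
  | zero => exact Eventually.of_forall fun y => by ext v; rfl
  | succ j ih =>
    have hcp : ContinuousAt (fun y => (y, p y)) x₀ :=
      continuousAt_id.prodMk hp.self_of_nhds.continuousAt
    filter_upwards [ih.eventuallyEq_nhds, hp, hcp.eventually_mem (hS.mem_nhds hx₀)] with y h1 h2 h3
    have h4 : HasFDerivAt (fun y => totalDeriv Γ g j (y, p y))
        (fderiv ℝ (totalDeriv Γ g j) (y, p y) ∘L
          (ContinuousLinearMap.id ℝ B).prod (Γ (y, p y))) y := by
      have h5 : DifferentiableAt ℝ (totalDeriv Γ g j) (y, p y) :=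
        ((contDiffOn_totalDeriv hS hΓ hg j).contDiffAt (hS.mem_nhds h3)).differentiableAt (by simp)
      exact h5.hasFDerivAt.comp y ((hasFDerivAt_id y).prodMk h2)
    rw [iteratedFDeriv_succ_eq_comp_left, Function.comp_apply, h1.fderiv_eq, h4.fderiv]
    rfl

end TotalDifferentialEquations

/-! ### Charts and vector fields -/

section ChartLemmas

variable {H : Type*} [NormedAddCommGroup H] [NormedSpace ℝ H]
  {N : Type*} [TopologicalSpace N] [ChartedSpace H N]

theorem mdifferentiable_of_mem_maximalAtlas {e : OpenPartialHomeomorph N H}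
    (he : e ∈ IsManifold.maximalAtlas 𝓘(ℝ, H) ∞ N) : e.MDifferentiable 𝓘(ℝ, H) 𝓘(ℝ, H) :=
  ⟨(contMDiffOn_of_mem_maximalAtlas he).mdifferentiableOn (by simp),
    (contMDiffOn_symm_of_mem_maximalAtlas he).mdifferentiableOn (by simp)⟩

theorem isInvertible_mfderiv_of_mem_maximalAtlas {e : OpenPartialHomeomorph N H}
    (he : e ∈ IsManifold.maximalAtlas 𝓘(ℝ, H) ∞ N) {p : N} (hp : p ∈ e.source) :
    (mfderiv 𝓘(ℝ, H) 𝓘(ℝ, H) e p).IsInvertible :=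
  ⟨(mdifferentiable_of_mem_maximalAtlas he).mfderiv hp, rfl⟩

/-- Every tangent vector extends to a smooth vector field. -/
theorem exists_contMDiff_vectorField [FiniteDimensional ℝ H] [T2Space N] [IsManifold 𝓘(ℝ, H) ∞ N]
    (x : N) (v : TangentSpace 𝓘(ℝ, H) x) :
    ∃ X : (y : N) → TangentSpace 𝓘(ℝ, H) y, X x = v ∧
      ContMDiff 𝓘(ℝ, H) 𝓘(ℝ, H).tangent ∞
        (fun y => (⟨y, X y⟩ : TangentBundle 𝓘(ℝ, H) N)) := by
  -- cut off a local extension by a bump function supported in its domain of smoothness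
  obtain ⟨s, hs, hsm⟩ := FiberBundle.exists_contMDiffOn_extend (k := ∞) 𝓘(ℝ, H) H v
  obtain ⟨ρ, -, hρ⟩ := (SmoothBumpFunction.nhds_basis_tsupport (I := 𝓘(ℝ, H)) x).mem_iff.1
    (interior_mem_nhds.2 hs)
  refine ⟨fun y => ρ y • FiberBundle.extend H v y, ?_, fun y => ?_⟩
  · change ρ x • FiberBundle.extend H v x = v
    rw [ρ.eq_one, one_smul, FiberBundle.extend_apply_self]
  · by_cases hy : y ∈ tsupport ρ
    · have h1 := hsm.contMDiffAt (mem_interior_iff_mem_nhds.1 (hρ hy))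
      exact ContMDiffAt.smul_section (ρ.contMDiff.contMDiffAt) h1
    · have h1 : ∀ᶠ z in 𝓝 y, ρ z = 0 := by
        filter_upwards [(isClosed_tsupport ρ).isOpen_compl.mem_nhds hy] with z hz
        exact image_eq_zero_of_notMem_tsupport hz
      refine (Bundle.contMDiff_zeroSection ℝ
        (TangentSpace 𝓘(ℝ, H) : N → Type _)).contMDiffAt.congr_of_eventuallyEq ?_
      filter_upwards [h1] with z hz
      rw [hz, zero_smul]; rfl

end ChartLemmas

/-! ### Connections in fibered charts -/

section ConnectionCoordinates

variable {B : Type*} [NormedAddCommGroup B] [NormedSpace ℝ B]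
  {W : Type*} [NormedAddCommGroup W] [NormedSpace ℝ W]
  {M : Type*} [TopologicalSpace M] [ChartedSpace B M]
  {P : Type*} [TopologicalSpace P] [ChartedSpace (B × W) P]
  {ξ : P → M}

theorem FiberedChart.symm_total_eq (C : FiberedChart B W ξ) {x : M} (σ : LocalSection B W ξ x)
    (h : σ x ∈ C.total.source) : C.total.symm (C.base x, C.rep σ (C.base x)) = σ x := by
  rw [C.total_eq σ h, C.total.left_inv h]

theorem FiberedChart.tendsto_base_symm (C : FiberedChart B W ξ) {x : M} (hx : x ∈ C.base.source) :
    Tendsto C.base.symm (𝓝 (C.base x)) (𝓝 x) := by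
  have := C.base.continuousAt_symm (C.base.map_source hx)
  rwa [ContinuousAt, C.base.left_inv hx] at this

theorem FiberedChart.eventually_base_iff (C : FiberedChart B W ξ) {x : M} (hx : x ∈ C.base.source)
    {q : B → Prop} : (∀ᶠ z in 𝓝 (C.base x), q z) ↔ ∀ᶠ y in 𝓝 x, q (C.base y) :=
  C.base.eventually_nhds q hx

theorem LocalSection.eventually_mem_source (C : FiberedChart B W ξ) {x : M}
    (σ : LocalSection B W ξ x) (h : σ x ∈ C.total.source) :
    ∀ᶠ y in 𝓝 x, IsLocalSectionAt B W ξ y σ ∧ σ y ∈ C.total.source ∧ y ∈ C.base.source :=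
  σ.eventually_isLocalSectionAt.and ((σ.contMDiffAt.continuousAt.eventually_mem
    (C.total.open_source.mem_nhds h)).and (C.base.open_source.mem_nhds (C.base_mem_source σ h)))

variable [IsFiberedManifold B W ξ]

/-- The coefficients of a connection in a fibered chart: the connection assigns to the point with
coordinates `a = (x, u)` the first order jet with derivative `Γ(x, u)`. -/
noncomputable def Connection.coeff (nabla : Connection B W ξ) (C : FiberedChart B W ξ) (a : B × W) :
    B →L[ℝ] W :=
  fderiv ℝ (C.rep (nabla (C.total.symm a)).out) a.1

theorem Connection.base_eq (nabla : Connection B W ξ) (p : P) : (nabla p).base = ξ p := by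
  have := (nabla p).proj_value
  rw [nabla.value_eq] at this
  exact this.symm

theorem Connection.out_base (nabla : Connection B W ξ) (p : P) :
    (nabla p).out (nabla p).base = p := nabla.value_eq p

theorem Connection.fst_total (nabla : Connection B W ξ) (C : FiberedChart B W ξ) {p : P}
    (hp : p ∈ C.total.source) : (C.total p).1 = C.base (nabla p).base := by
  rw [C.fst_eq p hp, nabla.base_eq]

theorem Connection.coeff_total (nabla : Connection B W ξ) (C : FiberedChart B W ξ) {p : P}
    (hp : p ∈ C.total.source) :
    nabla.coeff C (C.total p) = fderiv ℝ (C.rep (nabla p).out) (C.base (nabla p).base) := by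
  rw [Connection.coeff, C.total.left_inv hp, nabla.fst_total C hp]

/-- The coefficients are the first order jet coordinates of the connection, read off in the charts
of `P` and of `J^1 ξ`. -/
theorem Connection.contDiffOn_coeff (nabla : Connection B W ξ) (C : FiberedChart B W ξ) :
    ContDiffOn ℝ ∞ (nabla.coeff C) C.total.target := by
  have hcoords : ContDiffOn ℝ ∞
      (fun a => C.jetCoords (k := 1) (nabla (C.total.symm a))) C.total.target := by
    intro a ha
    have hp := C.total.map_target ha
    have h1 : ContMDiffAt 𝓘(ℝ, B × W) 𝓘(ℝ, B × W) ∞ C.total.symm a :=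
      contMDiffAt_symm_of_mem_maximalAtlas C.total_mem ha
    have h2 : ContMDiffAt 𝓘(ℝ, B × JetModel B W 1) 𝓘(ℝ, B × JetModel B W 1) ∞
        (C.jetChart (nabla (C.total.symm a))) (nabla (C.total.symm a)) := by
      refine contMDiffAt_of_mem_maximalAtlas (C.jetChart_mem_maximalAtlas _) ?_
      change Jet.value _ ∈ C.total.source
      rwa [nabla.value_eq]
    exact (h2.comp a ((nabla.smooth _).comp a h1)).contDiffAt.contDiffWithinAt
  have hL : ContDiff ℝ ∞ (continuousMultilinearCurryFin1 ℝ B W) :=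
    LinearIsometryEquiv.contDiff (𝕜 := ℝ) (E := B [×1]→L[ℝ] W) (F := B →L[ℝ] W) _
  have hc : ContDiff ℝ ∞ (fun p : JetModel B W 1 =>
      (p 1 : B [×((1 : Fin 2) : ℕ)]→L[ℝ] W)) :=
    JetModel.contDiff_coeff (1 : Fin 2)
  refine (hL.comp_contDiffOn (hc.comp_contDiffOn hcoords.snd)).congr fun a ha => ?_
  have hp := C.total.map_target ha
  have hv : (nabla (C.total.symm a)).out (nabla (C.total.symm a)).base ∈ C.total.source := by
    rwa [nabla.out_base]
  have h1 := taylorCoeff_coe (k := 1) (C.contDiffAt_rep (nabla (C.total.symm a)).out.contMDiffAt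
    (C.base_mem_source _ hv) hv) 1
  have h2 : a.1 = C.base (nabla (C.total.symm a)).base := by
    rw [← nabla.fst_total C hp, C.total.right_inv ha]
  ext v
  rw [Connection.coeff, h2]
  change _ = ((taylorCoeff 1 (C.rep (nabla (C.total.symm a)).out)
    (C.base (nabla (C.total.symm a)).base) 1 : symmetricMaps B W ((1 : Fin 2) : ℕ)) :
      B [×((1 : Fin 2) : ℕ)]→L[ℝ] W) (fun _ => v)
  rw [h1]
  exact (iteratedFDeriv_one_apply (𝕜 := ℝ)
    (f := C.rep (nabla (C.total.symm a)).out) (fun _ : Fin 1 => v)).symm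

theorem iteratedFDeriv_one_eq_iff {f g : B → W} {z z' : B} :
    iteratedFDeriv ℝ 1 f z = iteratedFDeriv ℝ 1 g z' ↔ fderiv ℝ f z = fderiv ℝ g z' := by
  constructor
  · intro h
    ext v
    have := congrArg (fun q => q fun _ => v) h
    simpa using this
  · intro h
    ext v
    simp [h]

/-- A first order jet is determined by its value and its derivative in a chart; the values of
`∇ ∘ σ` and `j_1 σ` agree automatically. -/
theorem Connection.apply_eq_jetMap_iff (nabla : Connection B W ξ) (C : FiberedChart B W ξ) {x : M}
    (σ : LocalSection B W ξ x) {y : M} (hy : IsLocalSectionAt B W ξ y σ)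
    (hs : σ y ∈ C.total.source) : nabla (σ y) = σ.jetMap ((1 : ℕ) : ℕ∞) y ↔
      fderiv ℝ (C.rep σ) (C.base y) = nabla.coeff C (C.base y, C.rep σ (C.base y)) := by
  set s : LocalSection B W ξ y := ⟨σ.toFun, hy⟩ with hsdef
  have e1 : (C.base y, C.rep σ (C.base y)) = C.total (σ y) := C.total_eq s hs
  have hbase : (nabla (σ y)).base = y := (nabla.base_eq _).trans s.proj_eq
  have hv := nabla.out_base (σ y)
  rw [e1, nabla.coeff_total C hs, σ.jetMap_of_isLocalSectionAt _ hy]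
  constructor
  · intro h
    rw [h]
    have h2 := (s.out_jet (k := ((1 : ℕ) : ℕ∞))).2 C (by rw [s.out_jet.1]; exact hs) 1 le_rfl
    exact (iteratedFDeriv_one_eq_iff.1 h2).symm
  · intro h
    rw [← (nabla (σ y)).jet_out]
    refine jet_eq_of_chart hbase hv C (by rwa [hv]) fun i hi => ?_
    have hi' : i ≤ 1 := by exact_mod_cast hi
    interval_cases i
    · ext w
      simp only [iteratedFDeriv_zero_apply]
      have h3 := C.total_eq (nabla (σ y)).out (by rwa [hv])
      rw [hv] at h3
      have h4 := C.total_eq s hs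
      exact (Prod.mk.inj (h3.trans h4.symm)).2
    · exact iteratedFDeriv_one_eq_iff.2 h.symm

/-- A local section is `∇`-constant if and only if its coordinate representation solves the total
differential equation given by the coefficients of the connection. -/
theorem Connection.isConstant_iff (nabla : Connection B W ξ) (C : FiberedChart B W ξ) {x : M}
    (σ : LocalSection B W ξ x) (h : σ x ∈ C.total.source) : nabla.IsConstant σ ↔
      ∀ᶠ z in 𝓝 (C.base x), HasFDerivAt (C.rep σ) (nabla.coeff C (z, C.rep σ z)) z := by
  have hx := C.base_mem_source σ h
  rw [C.eventually_base_iff hx, Connection.IsConstant]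
  refine eventually_congr ?_
  filter_upwards [σ.eventually_mem_source C h] with y hy
  rw [nabla.apply_eq_jetMap_iff C σ hy.1 hy.2.1]
  have hd : DifferentiableAt ℝ (C.rep σ) (C.base y) :=
    (C.contDiffAt_rep hy.1.1.self_of_nhds hy.2.2 hy.2.1).differentiableAt (by simp)
  exact ⟨fun h => h ▸ hd.hasFDerivAt, fun h => h.fderiv⟩

/-- The coordinate representation of a vector field on the base. -/
noncomputable def FiberedChart.fieldRep (C : FiberedChart B W ξ)
    (X : (x : M) → TangentSpace 𝓘(ℝ, B) x) (z : B) : B :=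
  mfderiv 𝓘(ℝ, B) 𝓘(ℝ, B) C.base (C.base.symm z) (X (C.base.symm z))

omit [IsFiberedManifold B W ξ] in
theorem FiberedChart.fieldRep_base (C : FiberedChart B W ξ)
    (X : (x : M) → TangentSpace 𝓘(ℝ, B) x) {y : M} (hy : y ∈ C.base.source) :
    C.fieldRep X (C.base y) = mfderiv 𝓘(ℝ, B) 𝓘(ℝ, B) C.base y (X y) := by
  unfold FiberedChart.fieldRep
  rw [C.base.left_inv hy]

/-- The coordinate representation of the horizontal lift of a vector field. -/
noncomputable def Connection.liftRep (nabla : Connection B W ξ) (C : FiberedChart B W ξ)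
    (X : (x : M) → TangentSpace 𝓘(ℝ, B) x) (a : B × W) : B × W :=
  (C.fieldRep X a.1, nabla.coeff C a (C.fieldRep X a.1))

omit [IsFiberedManifold B W ξ] in
theorem FiberedChart.mfderiv_total_section (C : FiberedChart B W ξ) {x : M}
    (s : LocalSection B W ξ x) (h : s x ∈ C.total.source) (v : TangentSpace 𝓘(ℝ, B) x) :
    mfderiv 𝓘(ℝ, B × W) 𝓘(ℝ, B × W) C.total (s x) (mfderiv 𝓘(ℝ, B) 𝓘(ℝ, B × W) s x v) =
      ((mfderiv 𝓘(ℝ, B) 𝓘(ℝ, B) C.base x v : B),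
        fderiv ℝ (C.rep s) (C.base x) (mfderiv 𝓘(ℝ, B) 𝓘(ℝ, B) C.base x v)) := by
  have hx := C.base_mem_source s h
  have h1 : MDifferentiableAt 𝓘(ℝ, B × W) 𝓘(ℝ, B × W) C.total (s x) :=
    (mdifferentiable_of_mem_maximalAtlas C.total_mem).mdifferentiableAt h
  have h2 : MDifferentiableAt 𝓘(ℝ, B) 𝓘(ℝ, B × W) s x := s.contMDiffAt.mdifferentiableAt (by simp)
  have h3 : MDifferentiableAt 𝓘(ℝ, B) 𝓘(ℝ, B) C.base x :=
    (mdifferentiable_of_mem_maximalAtlas C.base_mem).mdifferentiableAt hx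
  have hd : DifferentiableAt ℝ (C.rep s) (C.base x) :=
    (C.contDiffAt_rep s.contMDiffAt hx h).differentiableAt (by simp)
  have hg : HasFDerivAt (fun z => (z, C.rep s z))
      ((ContinuousLinearMap.id ℝ B).prod (fderiv ℝ (C.rep s) (C.base x))) (C.base x) :=
    (hasFDerivAt_id _).prodMk hd.hasFDerivAt
  have hev : C.total ∘ s =ᶠ[𝓝 x] (fun z => (z, C.rep s z)) ∘ C.base := by
    filter_upwards [s.eventually_mem_source C h] with y hy
    exact (C.total_eq (LocalSection.mk s.toFun hy.1) hy.2.1).symm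
  have e1 := mfderiv_comp x h1 h2
  have e2 := mfderiv_comp x (g := fun z => (z, C.rep s z)) hg.hasMFDerivAt.mdifferentiableAt h3
  rw [hev.mfderiv_eq, e2, hg.hasMFDerivAt.mfderiv] at e1
  exact (congrArg (fun φ => φ v) e1).symm

/-- In coordinates, the horizontal lift of `X` is `X + Γ(X) ∂/∂u`. -/
theorem Connection.mfderiv_total_lift (nabla : Connection B W ξ) (C : FiberedChart B W ξ)
    (X : (x : M) → TangentSpace 𝓘(ℝ, B) x) {p : P} (hp : p ∈ C.total.source) :
    mfderiv 𝓘(ℝ, B × W) 𝓘(ℝ, B × W) C.total p (nabla.lift X p) = nabla.liftRep C X (C.total p) := by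
  have hv := nabla.out_base p
  have h : (nabla p).out (nabla p).base ∈ C.total.source := by rwa [hv]
  have h1 := C.mfderiv_total_section (nabla p).out h (X (nabla p).base)
  rw [hv] at h1
  rw [Connection.liftRep, nabla.fst_total C hp, nabla.coeff_total C hp,
    C.fieldRep_base X (C.base_mem_source _ h)]
  exact h1

end ConnectionCoordinates

/-! ### Lie brackets in charts -/

section LieBracket

variable {H : Type*} [NormedAddCommGroup H] [NormedSpace ℝ H] [CompleteSpace H]
  {N : Type*} [TopologicalSpace N] [ChartedSpace H N] [IsManifold 𝓘(ℝ, H) ∞ N]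

/-- Coordinate representations of smooth vector fields are smooth. -/
theorem contDiffAt_coordinate_vectorField {e : OpenPartialHomeomorph N H}
    (he : e ∈ IsManifold.maximalAtlas 𝓘(ℝ, H) ∞ N) {X : (x : N) → TangentSpace 𝓘(ℝ, H) x}
    (hX : ContMDiff 𝓘(ℝ, H) 𝓘(ℝ, H).tangent ∞ (fun x => (⟨x, X x⟩ : TangentBundle 𝓘(ℝ, H) N)))
    {z : H} (hz : z ∈ e.target) :
    ContDiffAt ℝ 1 (fun z : H => (mfderiv 𝓘(ℝ, H) 𝓘(ℝ, H) e (e.symm z) (X (e.symm z)) : H)) z := by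
  have hd := mdifferentiable_of_mem_maximalAtlas he
  have : IsManifold 𝓘(ℝ, H) 2 N := IsManifold.of_le (n := ∞) (by norm_cast)
  have : IsManifold 𝓘(ℝ, H) (1 + 1) N := IsManifold.of_le (n := ∞) (by norm_cast)
  have h1 : ContMDiffAt 𝓘(ℝ, H) 𝓘(ℝ, H).tangent 1
      (fun y => (⟨y, VectorField.mpullback 𝓘(ℝ, H) 𝓘(ℝ, H) e.symm X y⟩ :
        TangentBundle 𝓘(ℝ, H) H)) z :=
    ContMDiffAt.mpullback_vectorField_preimage (n := ∞) ((hX (e.symm z)).of_le (by norm_cast))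
      (contMDiffAt_symm_of_mem_maximalAtlas he hz) ⟨hd.symm.mfderiv hz, rfl⟩
      (by norm_cast)
  refine (contMDiffAt_vectorSpace_iff_contDiffAt.1 h1).congr_of_eventuallyEq ?_
  filter_upwards [e.open_target.mem_nhds hz] with y hy
  have h2 : (mfderiv 𝓘(ℝ, H) 𝓘(ℝ, H) e.symm y).inverse =
      ((hd.symm.mfderiv hy).symm : TangentSpace 𝓘(ℝ, H) (e.symm y) →L[ℝ] TangentSpace 𝓘(ℝ, H) y) :=
    ContinuousLinearMap.inverse_equiv (hd.symm.mfderiv hy)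
  rw [VectorField.mpullback_apply, h2]
  rfl

/-- The Lie bracket of vector fields, computed in a chart. -/
theorem mfderiv_mlieBracket {e : OpenPartialHomeomorph N H}
    (he : e ∈ IsManifold.maximalAtlas 𝓘(ℝ, H) ∞ N) {X Y : (x : N) → TangentSpace 𝓘(ℝ, H) x}
    {X' Y' : H → H} {p : N} (hp : p ∈ e.source)
    (hX : ∀ᶠ q in 𝓝 p, mfderiv 𝓘(ℝ, H) 𝓘(ℝ, H) e q (X q) = X' (e q))
    (hY : ∀ᶠ q in 𝓝 p, mfderiv 𝓘(ℝ, H) 𝓘(ℝ, H) e q (Y q) = Y' (e q))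
    (hX' : ContDiffAt ℝ 1 X' (e p)) (hY' : ContDiffAt ℝ 1 Y' (e p)) :
    mfderiv 𝓘(ℝ, H) 𝓘(ℝ, H) e p (VectorField.mlieBracket 𝓘(ℝ, H) X Y p) =
      fderiv ℝ Y' (e p) (X' (e p)) - fderiv ℝ X' (e p) (Y' (e p)) := by
  have hd := mdifferentiable_of_mem_maximalAtlas he
  have : IsManifold 𝓘(ℝ, H) (minSmoothness ℝ 3) N := IsManifold.of_le (n := ∞) (by
    rw [minSmoothness_of_isRCLikeNormedField]; norm_cast)
  have : IsManifold 𝓘(ℝ, H) (minSmoothness ℝ 2) N := inferInstance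
  have key : ∀ {Z : (x : N) → TangentSpace 𝓘(ℝ, H) x} {Z' : H → H},
      (∀ᶠ q in 𝓝 p, mfderiv 𝓘(ℝ, H) 𝓘(ℝ, H) e q (Z q) = Z' (e q)) →
      Z =ᶠ[𝓝 p] VectorField.mpullback 𝓘(ℝ, H) 𝓘(ℝ, H) e Z' := by
    intro Z Z' h
    filter_upwards [h, e.open_source.mem_nhds hp] with q hq hqs
    have h2 : (mfderiv 𝓘(ℝ, H) 𝓘(ℝ, H) e q).inverse = ((hd.mfderiv hqs).symm :
        TangentSpace 𝓘(ℝ, H) (e q) →L[ℝ] TangentSpace 𝓘(ℝ, H) q) :=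
      ContinuousLinearMap.inverse_equiv (hd.mfderiv hqs)
    have h3 : (mfderiv 𝓘(ℝ, H) 𝓘(ℝ, H) e q).inverse (mfderiv 𝓘(ℝ, H) 𝓘(ℝ, H) e q (Z q)) = Z q := by
      rw [h2]
      exact (hd.mfderiv hqs).symm_apply_apply (Z q)
    exact h3.symm.trans (congrArg _ hq)
  have smooth : ∀ {Z' : H → H}, ContDiffAt ℝ 1 Z' (e p) →
      MDifferentiableAt 𝓘(ℝ, H) 𝓘(ℝ, H).tangent
        (fun z => (⟨z, Z' z⟩ : TangentBundle 𝓘(ℝ, H) H)) (e p) := by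
    intro Z' h
    exact (contMDiffAt_vectorSpace_iff_contDiffAt.2 h).mdifferentiableAt (by simp)
  rw [(key hX).mlieBracket_vectorField_eq (key hY)]
  have h3 := VectorField.mpullback_mlieBracket (n := ∞) (smooth hX') (smooth hY')
    (contMDiffAt_of_mem_maximalAtlas he hp)
    (by rw [minSmoothness_of_isRCLikeNormedField]; norm_cast)
  rw [← h3, VectorField.mpullback_apply,
    (isInvertible_mfderiv_of_mem_maximalAtlas he hp).self_apply_inverse]
  have h4 := congrFun (VectorField.mlieBracketWithin_eq_lieBracketWithin (𝕜 := ℝ) (V := X')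
    (W := Y') (s := univ)) (e p)
  rw [VectorField.lieBracketWithin_univ] at h4
  exact h4

end LieBracket

/-! ### Flatness in coordinates -/

section Flatness

variable {B : Type*} [NormedAddCommGroup B] [NormedSpace ℝ B] [FiniteDimensional ℝ B]
  {W : Type*} [NormedAddCommGroup W] [NormedSpace ℝ W] [CompleteSpace W]
  {M : Type*} [TopologicalSpace M] [T2Space M] [ChartedSpace B M] [IsManifold 𝓘(ℝ, B) ∞ M]
  {P : Type*} [TopologicalSpace P] [ChartedSpace (B × W) P] [IsManifold 𝓘(ℝ, B × W) ∞ P]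
  {ξ : P → M} [IsFiberedManifold B W ξ]

/-- The coefficients of a flat connection have vanishing curvature. The vertical part of
`[X^∇, Y^∇] - [X, Y]^∇` in coordinates is the curvature evaluated at `X` and `Y`, the derivatives
of `X` and `Y` cancelling. -/
theorem Connection.IsFlat.curvatureFreeAt {nabla : Connection B W ξ} (hflat : nabla.IsFlat)
    (C : FiberedChart B W ξ) {a : B × W} (ha : a ∈ C.total.target) :
    CurvatureFreeAt (nabla.coeff C) a := by
  have : CompleteSpace B := FiniteDimensional.complete ℝ B
  intro v w
  set p := C.total.symm a with hpdef
  have hp : p ∈ C.total.source := C.total.map_target ha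
  have hap : C.total p = a := C.total.right_inv ha
  have hx : ξ p ∈ C.base.source := C.proj_mem p hp
  have hxa : C.base (ξ p) = a.1 := by rw [← C.fst_eq p hp, hap]
  have hz : a.1 ∈ C.base.target := C.fst_mem_target ha
  have hbm := mdifferentiable_of_mem_maximalAtlas C.base_mem
  -- vector fields whose coordinate representations have the values `v` and `w` at `a`
  obtain ⟨X, hXx, hX⟩ := exists_contMDiff_vectorField (ξ p) ((hbm.mfderiv hx).symm v)
  obtain ⟨Y, hYx, hY⟩ := exists_contMDiff_vectorField (ξ p) ((hbm.mfderiv hx).symm w)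
  have hXa : C.fieldRep X a.1 = v := by
    rw [← hxa, C.fieldRep_base X hx, hXx]
    exact (hbm.mfderiv hx).apply_symm_apply v
  have hYa : C.fieldRep Y a.1 = w := by
    rw [← hxa, C.fieldRep_base Y hx, hYx]
    exact (hbm.mfderiv hx).apply_symm_apply w
  have hXd : ContDiffAt ℝ 1 (C.fieldRep X) a.1 :=
    contDiffAt_coordinate_vectorField C.base_mem hX hz
  have hYd : ContDiffAt ℝ 1 (C.fieldRep Y) a.1 :=
    contDiffAt_coordinate_vectorField C.base_mem hY hz
  have hΓ : ContDiffAt ℝ 1 (nabla.coeff C) a :=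
    ((nabla.contDiffOn_coeff C).contDiffAt (C.total.open_target.mem_nhds ha)).of_le
      (by norm_cast)
  have hsm : ∀ Z : (x : M) → TangentSpace 𝓘(ℝ, B) x, ContDiffAt ℝ 1 (C.fieldRep Z) a.1 →
      ContDiffAt ℝ 1 (nabla.liftRep C Z) a := by
    intro Z hZ
    have h1 : ContDiffAt ℝ 1 (fun a : B × W => C.fieldRep Z a.1) a := hZ.comp a contDiffAt_fst
    exact h1.prodMk (hΓ.clm_apply h1)
  have hder : ∀ Z : (x : M) → TangentSpace 𝓘(ℝ, B) x, ContDiffAt ℝ 1 (C.fieldRep Z) a.1 →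
      HasFDerivAt (nabla.liftRep C Z)
        (((fderiv ℝ (C.fieldRep Z) a.1).comp (ContinuousLinearMap.fst ℝ B W)).prod
          ((nabla.coeff C a).comp ((fderiv ℝ (C.fieldRep Z) a.1).comp
            (ContinuousLinearMap.fst ℝ B W)) +
            (fderiv ℝ (nabla.coeff C) a).flip (C.fieldRep Z a.1))) a := by
    intro Z hZ
    have h1 : HasFDerivAt (fun a : B × W => C.fieldRep Z a.1)
        ((fderiv ℝ (C.fieldRep Z) a.1).comp (ContinuousLinearMap.fst ℝ B W)) a :=
      (hZ.differentiableAt (by simp)).hasFDerivAt.comp a hasFDerivAt_fst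
    exact h1.prodMk ((hΓ.differentiableAt (by simp)).hasFDerivAt.clm_apply h1)
  -- the flatness identity at `p`, transported to coordinates
  have e0 := congrArg (mfderiv 𝓘(ℝ, B × W) 𝓘(ℝ, B × W) C.total p)
    (sub_eq_zero.1 (hflat X Y hX hY p))
  have hlift : ∀ Z : (x : M) → TangentSpace 𝓘(ℝ, B) x, ∀ᶠ q in 𝓝 p,
      mfderiv 𝓘(ℝ, B × W) 𝓘(ℝ, B × W) C.total q (nabla.lift Z q) =
        nabla.liftRep C Z (C.total q) := by
    intro Z
    filter_upwards [C.total.open_source.mem_nhds hp] with q hq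
    exact nabla.mfderiv_total_lift C Z hq
  have hfield : ∀ Z : (x : M) → TangentSpace 𝓘(ℝ, B) x, ∀ᶠ q in 𝓝 (ξ p),
      mfderiv 𝓘(ℝ, B) 𝓘(ℝ, B) C.base q (Z q) = C.fieldRep Z (C.base q) := by
    intro Z
    filter_upwards [C.base.open_source.mem_nhds hx] with q hq
    exact (C.fieldRep_base Z hq).symm
  have e1 := mfderiv_mlieBracket C.total_mem hp (hlift X) (hlift Y)
    (hap ▸ hsm X hXd)
    (hap ▸ hsm Y hYd)
  have e2 := mfderiv_mlieBracket C.base_mem hx (hfield X) (hfield Y)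
    (hxa ▸ hXd) (hxa ▸ hYd)
  have e3 := nabla.mfderiv_total_lift C (VectorField.mlieBracket 𝓘(ℝ, B) X Y) hp
  have e4 := (e1.symm.trans e0).trans e3
  rw [hap, (hder X hXd).fderiv, (hder Y hYd).fderiv] at e4
  have e5 := congrArg Prod.snd e4
  have e6 : C.fieldRep (VectorField.mlieBracket 𝓘(ℝ, B) X Y) a.1 =
      fderiv ℝ (C.fieldRep Y) a.1 v - fderiv ℝ (C.fieldRep X) a.1 w := by
    rw [← hxa, C.fieldRep_base _ hx]
    refine e2.trans ?_
    rw [hxa, hXa, hYa]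
  simp only [Connection.liftRep, hXa, hYa, e6, Prod.snd_sub, ContinuousLinearMap.prod_apply,
    _root_.add_apply, ContinuousLinearMap.comp_apply, ContinuousLinearMap.coe_fst',
    ContinuousLinearMap.flip_apply, map_sub] at e5
  have e7 : fderiv ℝ (nabla.coeff C) a (v, nabla.coeff C a v) w -
      fderiv ℝ (nabla.coeff C) a (w, nabla.coeff C a w) v = 0 := by
    rw [← sub_eq_zero] at e5
    rw [← e5]
    abel
  exact sub_eq_zero.1 e7

end Flatness

/-! ### Families of Taylor coefficients -/

section TaylorCoefficients

variable {B : Type*} [NormedAddCommGroup B] [NormedSpace ℝ B]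
  {V : Type*} [NormedAddCommGroup V] [NormedSpace ℝ V]

instance [CompleteSpace V] (j : ℕ) : CompleteSpace (symmetricMaps B V j) := by
  refine IsClosed.completeSpace_coe (s := (symmetricMaps B V j : Set (B [×j]→L[ℝ] V))) (hs := ?_)
  have h : (symmetricMaps B V j : Set (B [×j]→L[ℝ] V)) =
      ⋂ (σ : Equiv.Perm (Fin j)) (v : Fin j → B), {p | p (v ∘ σ) = p v} := by
    ext p
    simp only [mem_iInter]
    rfl
  rw [h]
  exact isClosed_iInter fun σ => isClosed_iInter fun v => isClosed_eq
    (ContinuousMultilinearMap.apply ℝ (fun _ : Fin j => B) V (v ∘ σ)).continuous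
    (ContinuousMultilinearMap.apply ℝ (fun _ : Fin j => B) V v).continuous

instance [CompleteSpace V] (k : ℕ) : CompleteSpace (JetModel B V k) :=
  inferInstanceAs (CompleteSpace ((j : Fin (k + 1)) → symmetricMaps B V j))

theorem taylorCoeff_eventuallyEq {k : ℕ} {f g : B → V} {z : B} (h : f =ᶠ[𝓝 z] g) :
    taylorCoeff k f =ᶠ[𝓝 z] taylorCoeff k g := by
  filter_upwards [h.eventuallyEq_nhds] with y hy
  funext j
  exact congrArg (symmetrize (j : ℕ)) (hy.iteratedFDeriv ℝ j).eq_of_nhds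

theorem taylorCoeff_zeroth {k : ℕ} {f : B → V} {z : B} (h : ContDiffAt ℝ ∞ f z) :
    (taylorCoeff k f z).zeroth = f z :=
  congrArg (fun q => q 0) (taylorCoeff_coe (k := k) h 0)

theorem hasFDerivAt_coeff {k : ℕ} {u : B → JetModel B V k} {u' : B →L[ℝ] JetModel B V k} {z : B}
    (h : HasFDerivAt u u' z) (j : Fin (k + 1)) :
    HasFDerivAt (fun y => (u y j : B [×j]→L[ℝ] V)) ((JetModel.coeff j).comp u') z :=
  (JetModel.coeff (B := B) (V := V) j).hasFDerivAt.comp z h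

/-- The derivative of the Taylor coefficients of a map shifts their order by one. -/
theorem fderiv_taylorCoeff_apply {k : ℕ} {f : B → V} {z : B} {u' : B →L[ℝ] JetModel B V k}
    (hf : ∀ᶠ y in 𝓝 z, ContDiffAt ℝ ∞ f y) (hu : HasFDerivAt (taylorCoeff k f) u' z)
    {j : ℕ} (hj : j + 1 < k + 1) (v : Fin (j + 1) → B) :
    (u' (v 0) ⟨j, by omega⟩ : B [×j]→L[ℝ] V) (Fin.tail v) =
      (taylorCoeff k f z ⟨j + 1, hj⟩ : B [×(j + 1)]→L[ℝ] V) v := by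
  have h1 := hasFDerivAt_coeff hu ⟨j, by omega⟩
  have h2 : (fun y => (taylorCoeff k f y ⟨j, by omega⟩ : B [×j]→L[ℝ] V)) =ᶠ[𝓝 z]
      iteratedFDeriv ℝ j f := by
    filter_upwards [hf] with y hy
    exact taylorCoeff_coe hy ⟨j, by omega⟩
  have h3 := (h1.congr_of_eventuallyEq h2.symm).fderiv
  have h4 := taylorCoeff_coe hf.self_of_nhds (⟨j + 1, hj⟩ : Fin (k + 1))
  change _ = ((taylorCoeff k f z ⟨j + 1, hj⟩ : symmetricMaps B V (j + 1)) :
    B [×(j + 1)]→L[ℝ] V) v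
  refine Eq.trans ?_ (congrArg (fun q : B [×(j + 1)]→L[ℝ] V => q v) h4).symm
  refine Eq.trans ?_ (iteratedFDeriv_succ_apply_left v).symm
  rw [h3]
  rfl

end TaylorCoefficients

/-! ### Local sections and their prolongations -/

section Sections

variable {B : Type*} [NormedAddCommGroup B] [NormedSpace ℝ B]
  {V : Type*} [NormedAddCommGroup V] [NormedSpace ℝ V]
  {M : Type*} [TopologicalSpace M] [ChartedSpace B M]
  {E : Type*} [TopologicalSpace E] [ChartedSpace (B × V) E] {π : E → M} {x : M}

/-- Smooth maps in coordinates are representations of local sections. -/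
theorem FiberedChart.exists_localSection (c : FiberedChart B V π) {f : B → V}
    (hx : x ∈ c.base.source) (hf : ∀ᶠ z in 𝓝 (c.base x), ContDiffAt ℝ ∞ f z)
    (ha : (c.base x, f (c.base x)) ∈ c.total.target) :
    ∃ s : LocalSection B V π x, s x ∈ c.total.source ∧ c.rep s =ᶠ[𝓝 (c.base x)] f := by
  have hev : ∀ᶠ z in 𝓝 (c.base x), ContDiffAt ℝ ∞ f z ∧ (z, f z) ∈ c.total.target := by
    refine hf.and ?_
    exact (continuousAt_id.prodMk hf.self_of_nhds.continuousAt).eventually_mem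
      (c.total.open_target.mem_nhds ha)
  refine ⟨⟨fun y => c.total.symm (c.base y, f (c.base y)), ?_, ?_⟩, c.total.map_target ha, ?_⟩
  · filter_upwards [(c.eventually_base_iff hx).1 hev, c.base.open_source.mem_nhds hx] with y hy hys
    have h1 : ContMDiffAt 𝓘(ℝ, B) 𝓘(ℝ, B) ∞ c.base y :=
      contMDiffAt_of_mem_maximalAtlas c.base_mem hys
    have h2 : ContMDiffAt 𝓘(ℝ, B × V) 𝓘(ℝ, B × V) ∞ c.total.symm (c.base y, f (c.base y)) :=
      contMDiffAt_symm_of_mem_maximalAtlas c.total_mem hy.2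
    have h3 : ContMDiffAt 𝓘(ℝ, B) 𝓘(ℝ, B × V) ∞ (fun z => (z, f z)) (c.base y) :=
      (contDiffAt_id.prodMk hy.1).contMDiffAt
    exact h2.comp y (h3.comp y h1)
  · filter_upwards [(c.eventually_base_iff hx).1 hev, c.base.open_source.mem_nhds hx] with y hy hys
    rw [c.proj_symm hy.2, c.base.left_inv hys]
  · filter_upwards [hev, c.base.open_target.mem_nhds (c.base.map_source hx)] with z hz hzt
    simp only [FiberedChart.rep]
    rw [c.base.right_inv hzt, c.total.right_inv hz.2]

theorem FiberedChart.eventually_contDiffAt_rep (c : FiberedChart B V π) (s : LocalSection B V π x)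
    (h : s x ∈ c.total.source) : ∀ᶠ z in 𝓝 (c.base x), ContDiffAt ℝ ∞ (c.rep s) z := by
  rw [c.eventually_base_iff (c.base_mem_source s h)]
  filter_upwards [s.eventually_mem_source c h] with y hy
  exact c.contDiffAt_rep hy.1.1.self_of_nhds hy.2.2 hy.2.1

theorem FiberedChart.rep_congr (c : FiberedChart B V π) (hx : x ∈ c.base.source) {s t : M → E}
    (h : s =ᶠ[𝓝 x] t) : c.rep s =ᶠ[𝓝 (c.base x)] c.rep t := by
  filter_upwards [(c.tendsto_base_symm hx).eventually h] with z hz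
  simp only [FiberedChart.rep, hz]

theorem FiberedChart.eventuallyEq_of_rep (c : FiberedChart B V π) (s t : LocalSection B V π x)
    (hs : s x ∈ c.total.source) (ht : t x ∈ c.total.source)
    (h : c.rep s =ᶠ[𝓝 (c.base x)] c.rep t) : s.toFun =ᶠ[𝓝 x] t.toFun := by
  have h' := (c.eventually_base_iff (c.base_mem_source s hs)).1 h
  filter_upwards [h', s.eventually_mem_source c hs, t.eventually_mem_source c ht] with y hy h1 h2
  have e1 := c.symm_total_eq (LocalSection.mk s.toFun h1.1) h1.2.1
  have e2 := c.symm_total_eq (LocalSection.mk t.toFun h2.1) h2.2.1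
  have e3 : c.rep s (c.base y) = c.rep t (c.base y) := hy
  change c.total.symm (c.base y, c.rep s (c.base y)) = s.toFun y at e1
  change c.total.symm (c.base y, c.rep t (c.base y)) = t.toFun y at e2
  rw [← e1, ← e2, e3]

theorem LocalSection.jet_congr {s t : LocalSection B V π x} (h : s.toFun =ᶠ[𝓝 x] t.toFun) (l : ℕ∞) :
    s.jet l = t.jet l := by
  refine LocalSection.jet_eq_iff.2 ⟨h.eq_of_nhds, fun c hc i _ => ?_⟩
  exact ((c.rep_congr (c.base_mem_source s hc) h).iteratedFDeriv ℝ i).eq_of_nhds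

variable [IsFiberedManifold B V π]

theorem LocalSection.prolong_apply (s : LocalSection B V π x) (k : ℕ) :
    s.prolong k x = s.jet (k : ℕ∞) := s.jetMap_self _

/-- In coordinates, prolonging a section means taking Taylor coefficients. -/
theorem FiberedChart.rep_prolong (c : FiberedChart B V π) (s : LocalSection B V π x)
    (h : s x ∈ c.total.source) {k : ℕ} (θ₀ : Jet B V π (k : ℕ∞)) :
    (c.prolong θ₀).rep (s.prolong k) =ᶠ[𝓝 (c.base x)] taylorCoeff k (c.rep s) := by
  have hx := c.base_mem_source s h
  refine (c.eventually_base_iff hx).2 ?_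
  filter_upwards [s.eventually_mem_source c h] with y hy
  have h1 : (c.prolong θ₀).rep (s.prolong k) (c.base y) = (c.jetCoords (s.jetMap (k : ℕ∞) y)).2 := by
    change (c.jetCoords (s.jetMap (k : ℕ∞) (c.base.symm (c.base y)))).2 = _
    rw [c.base.left_inv hy.2.2]
  rw [h1, s.jetMap_of_isLocalSectionAt _ hy.1,
    c.jetCoords_jet (LocalSection.mk s.toFun hy.1) hy.2.1]

theorem FiberedChart.mem_prolong_source (c : FiberedChart B V π) (s : LocalSection B V π x)
    (h : s x ∈ c.total.source) {k : ℕ} (θ₀ : Jet B V π (k : ℕ∞)) :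
    s.prolong k x ∈ (c.prolong θ₀).total.source := by
  rw [s.prolong_apply]
  change Jet.value _ ∈ c.total.source
  rwa [s.value_jet]

end Sections

/-! ### Solutions of flat holonomic connections -/

section Solutions

variable {B : Type*} [NormedAddCommGroup B] [NormedSpace ℝ B]
  {V : Type*} [NormedAddCommGroup V] [NormedSpace ℝ V]
  {M : Type*} [TopologicalSpace M] [ChartedSpace B M]
  {E : Type*} [TopologicalSpace E] [ChartedSpace (B × V) E] {π : E → M} {x : M}
  [IsFiberedManifold B V π] {k : ℕ} {nabla : JetConnection B V π k}

/-- The coefficients of a holonomic connection of order `j < k` are the jet coordinates of order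
`j + 1`. -/
theorem Connection.IsHolonomic.coeff_apply (hhol : nabla.IsHolonomic) (c : FiberedChart B V π)
    (θ₀ : Jet B V π (k : ℕ∞)) {a : B × JetModel B V k} (ha : a ∈ (c.prolong θ₀).total.target)
    {j : ℕ} (hj : j + 1 < k + 1) (v : Fin (j + 1) → B) :
    (nabla.coeff (c.prolong θ₀) a (v 0) ⟨j, by omega⟩ : B [×j]→L[ℝ] V) (Fin.tail v) =
      (a.2 ⟨j + 1, hj⟩ : B [×(j + 1)]→L[ℝ] V) v := by
  set C := c.prolong θ₀ with hC
  set θ := C.total.symm a with hθdef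
  have hθ : θ ∈ C.total.source := C.total.map_target ha
  -- near `θ`, compare with the prolongation of a section representing the `(k + 1)`-jet `∇ θ`
  obtain ⟨Θ, hΘ⟩ := hhol θ
  set σ := Θ.out.prolong k with hσ
  have hσθ : σ Θ.base = θ := by
    rw [← nabla.value_eq θ, ← hΘ]
    exact σ.value_jet.symm
  have hs : Θ.out Θ.base ∈ c.total.source := by
    have h1 : Jet.value θ ∈ c.total.source := hθ
    rw [← hσθ, hσ, LocalSection.prolong_apply, LocalSection.value_jet] at h1
    exact h1
  have hσs : σ Θ.base ∈ C.total.source := by rwa [hσθ]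
  have ha' : (C.base Θ.base, C.rep σ (C.base Θ.base)) = a := by
    rw [C.total_eq σ hσs, hσθ, hθdef, C.total.right_inv ha]
  have h1 : fderiv ℝ (C.rep σ) (C.base Θ.base) = nabla.coeff C a := by
    rw [← ha', ← nabla.apply_eq_jetMap_iff C σ σ.isLocalSectionAt hσs, hσθ, ← hΘ, σ.jetMap_self]
    rfl
  have hd : DifferentiableAt ℝ (C.rep σ) (C.base Θ.base) :=
    (C.contDiffAt_rep σ.contMDiffAt (C.base_mem_source σ hσs) hσs).differentiableAt (by simp)
  have h2 : C.rep σ =ᶠ[𝓝 (c.base Θ.base)] taylorCoeff k (c.rep Θ.out) := c.rep_prolong Θ.out hs θ₀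
  have h3 : HasFDerivAt (taylorCoeff k (c.rep Θ.out)) (nabla.coeff C a) (c.base Θ.base) := by
    rw [← h1]
    exact hd.hasFDerivAt.congr_of_eventuallyEq h2.symm
  have h4 : taylorCoeff k (c.rep Θ.out) (c.base Θ.base) = a.2 := by
    rw [← ha', ← h2.eq_of_nhds]; rfl
  rw [← h4]
  exact fderiv_taylorCoeff_apply (c.eventually_contDiffAt_rep Θ.out hs) h3 hj v

theorem Connection.contDiffAt_coeff_prolong (nabla : JetConnection B V π k)
    (c : FiberedChart B V π) (θ₀ : Jet B V π (k : ℕ∞)) {a : B × JetModel B V k}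
    (ha : a ∈ (c.prolong θ₀).total.target) : ContDiffAt ℝ ∞ (nabla.coeff (c.prolong θ₀)) a :=
  (nabla.contDiffOn_coeff _).contDiffAt ((c.prolong θ₀).total.open_target.mem_nhds ha)

/-- Solutions of the total differential equation of a holonomic connection are families of Taylor
coefficients. -/
theorem Connection.IsHolonomic.taylorCoeff_zeroth (hhol : nabla.IsHolonomic)
    (c : FiberedChart B V π) (θ₀ : Jet B V π (k : ℕ∞)) {z₀ : B} {u : B → JetModel B V k}
    (h₀ : (z₀, u z₀) ∈ (c.prolong θ₀).total.target)
    (hu : ∀ᶠ z in 𝓝 z₀, HasFDerivAt u (nabla.coeff (c.prolong θ₀) (z, u z)) z)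
    (hus : ∀ᶠ z in 𝓝 z₀, ContDiffAt ℝ ∞ (fun z => (u z).zeroth) z) :
    taylorCoeff k (fun z => (u z).zeroth) =ᶠ[𝓝 z₀] u := by
  have hmem : ∀ᶠ z in 𝓝 z₀, (z, u z) ∈ (c.prolong θ₀).total.target :=
    (continuousAt_id.prodMk hu.self_of_nhds.continuousAt).eventually_mem
      ((c.prolong θ₀).total.open_target.mem_nhds h₀)
  -- by holonomicity, the component of order `j + 1` of `u` is the derivative of that of order `j`
  have key : ∀ (j : ℕ) (hj : j < k + 1), iteratedFDeriv ℝ j (fun z => (u z).zeroth) =ᶠ[𝓝 z₀]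
      fun z => (u z ⟨j, hj⟩ : B [×j]→L[ℝ] V) := by
    intro j
    induction j with
    | zero =>
      intro hj
      refine Eventually.of_forall fun z => ?_
      ext v
      rw [iteratedFDeriv_zero_apply]
      change (u z 0 : B [×((0 : Fin (k + 1)) : ℕ)]→L[ℝ] V) 0 = (u z 0 : B [×((0 : Fin (k + 1)) : ℕ)]→L[ℝ] V) v
      congr 1
      exact Subsingleton.elim (α := Fin 0 → B) _ _
    | succ j ih =>
      intro hj
      filter_upwards [(ih (by omega)).eventuallyEq_nhds, hu, hmem] with z hz huz hmz
      ext v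
      rw [iteratedFDeriv_succ_apply_left, hz.fderiv_eq,
        (hasFDerivAt_coeff huz ⟨j, by omega⟩).fderiv]
      exact hhol.coeff_apply c θ₀ hmz hj v
  have key' : ∀ᶠ z in 𝓝 z₀, ∀ j : Fin (k + 1), iteratedFDeriv ℝ j (fun z => (u z).zeroth) z =
      (u z j : B [×j]→L[ℝ] V) := eventually_all.2 fun j => key j j.2
  filter_upwards [key', hus] with z hz hzs
  funext j
  exact Subtype.ext ((taylorCoeff_coe hzs j).trans (hz j))

/-- The coordinate representation of a solution through `θ` has the coordinates of `θ` as
Taylor coefficients and solves the total differential equation of the connection. -/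
theorem Connection.IsSolutionThrough.rep {θ : Jet B V π (k : ℕ∞)} {s : LocalSection B V π θ.base}
    (hs : nabla.IsSolutionThrough θ s) (c : FiberedChart B V π) (θ₀ : Jet B V π (k : ℕ∞))
    (hθ : θ.value ∈ c.total.source) : s θ.base ∈ c.total.source ∧
    (c.base θ.base, taylorCoeff k (c.rep s) (c.base θ.base)) = c.jetCoords θ ∧
    ∀ᶠ z in 𝓝 (c.base θ.base), HasFDerivAt (taylorCoeff k (c.rep s))
      (nabla.coeff (c.prolong θ₀) (z, taylorCoeff k (c.rep s) z)) z := by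
  have h0 : s θ.base ∈ c.total.source := by
    have := s.value_jet (k := (k : ℕ∞))
    rwa [← this, hs.1]
  refine ⟨h0, ?_, ?_⟩
  · rw [← c.jetCoords_jet s h0 k, hs.1]
  · have h1 := (nabla.isConstant_iff (c.prolong θ₀) (s.prolong k)
      (c.mem_prolong_source s h0 θ₀)).1 hs.2
    filter_upwards [h1, (c.rep_prolong s h0 θ₀).eventuallyEq_nhds] with z hz hz'
    rw [← hz'.eq_of_nhds]
    exact hz.congr_of_eventuallyEq hz'.symm

/-- Uniqueness of the germ of a solution. -/
theorem Connection.IsSolutionThrough.eventuallyEq {θ : Jet B V π (k : ℕ∞)}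
    {s t : LocalSection B V π θ.base} (hs : nabla.IsSolutionThrough θ s)
    (ht : nabla.IsSolutionThrough θ t) : t.toFun =ᶠ[𝓝 θ.base] s.toFun := by
  obtain ⟨c, hc⟩ := IsFiberedManifold.exists_chart (B := B) (V := V) (π := π) θ.value
  obtain ⟨hs1, hs2, hs3⟩ := hs.rep c θ hc
  obtain ⟨ht1, ht2, ht3⟩ := ht.rep c θ hc
  have htarget : c.jetCoords θ ∈ (c.prolong θ).total.target := (c.prolong θ).total.map_source hc
  have h1 : taylorCoeff k (c.rep t) =ᶠ[𝓝 (c.base θ.base)] taylorCoeff k (c.rep s) := by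
    refine eventuallyEq_of_hasFDerivAt (Γ := nabla.coeff (c.prolong θ)) ?_ ht3 hs3
      (congrArg Prod.snd (ht2.trans hs2.symm))
    rw [ht2]
    exact nabla.contDiffAt_coeff_prolong c θ htarget
  refine c.eventuallyEq_of_rep t s ht1 hs1 ?_
  filter_upwards [h1, c.eventually_contDiffAt_rep s hs1, c.eventually_contDiffAt_rep t ht1]
    with z hz h2 h3
  rw [← JetBundle.taylorCoeff_zeroth (k := k) h2, ← JetBundle.taylorCoeff_zeroth (k := k) h3, hz]

theorem Connection.bracket_eq_jet {θ : Jet B V π (k : ℕ∞)} {s : LocalSection B V π θ.base}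
    (hs : nabla.IsSolutionThrough θ s) (l : ℕ∞) : nabla.bracket l θ = s.jet l := by
  refine LocalSection.jet_congr (Connection.IsSolutionThrough.eventuallyEq hs ?_) l
  exact Classical.epsilon_spec (p := nabla.IsSolutionThrough θ) ⟨s, hs⟩

/-- Existence of solutions, from the Frobenius theorem in coordinates. -/
theorem Connection.exists_isSolutionThrough [FiniteDimensional ℝ B] [CompleteSpace V] [T2Space M]
    [IsManifold 𝓘(ℝ, B) ∞ M] (hflat : nabla.IsFlat) (hhol : nabla.IsHolonomic)
    (θ : Jet B V π (k : ℕ∞)) : ∃ s, nabla.IsSolutionThrough θ s := by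
  obtain ⟨c, hc⟩ := IsFiberedManifold.exists_chart (B := B) (V := V) (π := π) θ.value
  have hx := c.base_mem_source θ.out hc
  have htarget : c.jetCoords θ ∈ (c.prolong θ).total.target := (c.prolong θ).total.map_source hc
  obtain ⟨u, hu0, hu⟩ := exists_hasFDerivAt_of_curvatureFree
    (Γ := nabla.coeff (c.prolong θ)) (x₀ := (c.jetCoords θ).1) (u₀ := (c.jetCoords θ).2)
    (nabla.contDiffAt_coeff_prolong c θ htarget) (by
      filter_upwards [(c.prolong θ).total.open_target.mem_nhds htarget] with a ha
      exact hflat.curvatureFreeAt _ ha)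
  change u (c.base θ.base) = _ at hu0
  change ∀ᶠ z in 𝓝 (c.base θ.base), _ at hu
  have hθu : (c.base θ.base, u (c.base θ.base)) = c.jetCoords θ := by rw [hu0]; rfl
  have htu : (c.base θ.base, u (c.base θ.base)) ∈ (c.prolong θ).total.target := by rwa [hθu]
  have hus : ∀ᶠ z in 𝓝 (c.base θ.base), ContDiffAt ℝ ∞ u z := by
    refine eventually_contDiffAt_of_hasFDerivAt (Γ := nabla.coeff (c.prolong θ)) ?_ hu
    filter_upwards [(c.prolong θ).total.open_target.mem_nhds htu] with a ha
    exact nabla.contDiffAt_coeff_prolong c θ ha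
  have hfs : ∀ᶠ z in 𝓝 (c.base θ.base), ContDiffAt ℝ ∞ (fun z => (u z).zeroth) z := by
    filter_upwards [hus] with z hz
    exact (contDiff_zeroth k).contDiffAt.comp z hz
  obtain ⟨s, hs, hrep⟩ := c.exists_localSection (f := fun z => (u z).zeroth) hx hfs htu
  have htay : taylorCoeff k (c.rep s) =ᶠ[𝓝 (c.base θ.base)] u :=
    (taylorCoeff_eventuallyEq hrep).trans (hhol.taylorCoeff_zeroth c θ htu hu hfs)
  refine ⟨s, ?_, ?_⟩
  · refine (c.prolong θ).total.injOn ?_ hc ?_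
    · change Jet.value _ ∈ c.total.source
      rwa [s.value_jet]
    · change c.jetCoords (s.jet k) = c.jetCoords θ
      rw [c.jetCoords_jet s hs, htay.eq_of_nhds, hθu]
  · rw [nabla.isConstant_iff (c.prolong θ) (s.prolong k) (c.mem_prolong_source s hs θ)]
    filter_upwards [hu, ((c.rep_prolong s hs θ).trans htay).eventuallyEq_nhds] with z hz hz'
    rw [hz'.eq_of_nhds]
    exact hz.congr_of_eventuallyEq hz'

end Solutions

/-! ### Maps given in charts -/

section CoordinateMaps

variable {H : Type*} [NormedAddCommGroup H] [NormedSpace ℝ H]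
  {N : Type*} [TopologicalSpace N] [ChartedSpace H N]
  {H' : Type*} [NormedAddCommGroup H'] [NormedSpace ℝ H']
  {N' : Type*} [TopologicalSpace N'] [ChartedSpace H' N']

theorem contMDiffOn_of_coordinates {e : OpenPartialHomeomorph N H}
    (he : e ∈ IsManifold.maximalAtlas 𝓘(ℝ, H) ∞ N) {e' : OpenPartialHomeomorph N' H'}
    (he' : e' ∈ IsManifold.maximalAtlas 𝓘(ℝ, H') ∞ N') {f : N → N'} {g : H → H'}
    (hf : MapsTo f e.source e'.source) (hg : ContDiffOn ℝ ∞ g e.target)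
    (hfg : ∀ q ∈ e.source, e' (f q) = g (e q)) :
    ContMDiffOn 𝓘(ℝ, H) 𝓘(ℝ, H') ∞ f e.source := by
  have h1 : ContMDiffOn 𝓘(ℝ, H) 𝓘(ℝ, H') ∞ (fun q => g (e q)) e.source :=
    hg.contMDiffOn.comp (contMDiffOn_of_mem_maximalAtlas he) e.mapsTo
  refine ((contMDiffOn_symm_of_mem_maximalAtlas he').comp h1 fun q hq => ?_).congr fun q hq => ?_
  · rw [mem_preimage, ← hfg q hq]
    exact e'.map_source (hf hq)
  · rw [Function.comp_apply, ← hfg q hq, e'.left_inv (hf hq)]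

/-- The shear `z ↦ z - ψ (τ z)` along the fibers of a linear projection `τ`, where `ψ` takes
values in the kernel of `τ`. -/
noncomputable def shear (τ : H' →L[ℝ] H) {S : Set H} (hS : IsOpen S) {ψ : H → H'}
    (hψ : ContinuousOn ψ S) (hτψ : ∀ a ∈ S, τ (ψ a) = 0) : OpenPartialHomeomorph H' H' where
  toFun z := z - ψ (τ z)
  invFun z := z + ψ (τ z)
  source := τ ⁻¹' S
  target := τ ⁻¹' S
  map_source' z hz := by
    simpa only [mem_preimage, map_sub, hτψ (τ z) hz, sub_zero] using hz
  map_target' z hz := by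
    simpa only [mem_preimage, map_add, hτψ (τ z) hz, add_zero] using hz
  left_inv' z hz := by simp only [map_sub, hτψ (τ z) hz, sub_zero, sub_add_cancel]
  right_inv' z hz := by simp only [map_add, hτψ (τ z) hz, add_zero, add_sub_cancel_right]
  open_source := hS.preimage τ.continuous
  open_target := hS.preimage τ.continuous
  continuousOn_toFun := continuousOn_id.sub (hψ.comp τ.continuous.continuousOn fun _ hz => hz)
  continuousOn_invFun := continuousOn_id.add (hψ.comp τ.continuous.continuousOn fun _ hz => hz)

/-- A map which in charts is a section of a linear projection `τ` is an immersion: a shear along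
the fibers of `τ` straightens it to a linear section. -/
theorem isImmersionAtOfComplement_of_coordinates [IsManifold 𝓘(ℝ, H') ∞ N']
    {e : OpenPartialHomeomorph N H}
    (he : e ∈ IsManifold.maximalAtlas 𝓘(ℝ, H) ∞ N) {e' : OpenPartialHomeomorph N' H'}
    (he' : e' ∈ IsManifold.maximalAtlas 𝓘(ℝ, H') ∞ N') {f : N → N'} {g : H → H'}
    (hf : MapsTo f e.source e'.source) (hg : ContDiffOn ℝ ∞ g e.target)
    (hfg : ∀ q ∈ e.source, e' (f q) = g (e q)) (τ : H' →L[ℝ] H) (ι : H →L[ℝ] H')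
    (hι : Function.RightInverse ι τ) (hτg : ∀ a ∈ e.target, τ (g a) = a) {x : N}
    (hx : x ∈ e.source) :
    IsImmersionAtOfComplement τ.ker 𝓘(ℝ, H) 𝓘(ℝ, H') ∞ f x := by
  have hψ : ContDiffOn ℝ ∞ (fun a => g a - ι a) e.target := hg.sub ι.contDiff.contDiffOn
  have hτψ : ∀ a ∈ e.target, τ (g a - ι a) = 0 := fun a ha => by
    rw [map_sub, hτg a ha, hι a, sub_self]
  let φ := shear τ e.open_target hψ.continuousOn hτψ
  have hψτ : ContDiffOn ℝ ∞ (fun z => g (τ z) - ι (τ z)) (τ ⁻¹' e.target) :=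
    hψ.comp τ.contDiff.contDiffOn fun _ hz => hz
  have hφ : ContDiffOn ℝ ∞ φ φ.source := contDiffOn_id.sub hψτ
  have hφ' : ContDiffOn ℝ ∞ φ.symm φ.target := contDiffOn_id.add hψτ
  have hmem : e' ≫ₕ φ ∈ IsManifold.maximalAtlas 𝓘(ℝ, H') ∞ N' := by
    refine OpenPartialHomeomorph.mem_maximalAtlas_of_contMDiffOn _ ?_ ?_
    · rw [OpenPartialHomeomorph.trans_source]
      exact hφ.contMDiffOn.comp ((contMDiffOn_of_mem_maximalAtlas he').mono inter_subset_left)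
        fun z hz => hz.2
    · rw [OpenPartialHomeomorph.trans_target]
      exact (contMDiffOn_symm_of_mem_maximalAtlas he').comp
        (hφ'.contMDiffOn.mono inter_subset_left) fun z hz => hz.2
  have hmaps : ∀ q ∈ e.source, f q ∈ (e' ≫ₕ φ).source := fun q hq => by
    rw [OpenPartialHomeomorph.trans_source]
    refine ⟨hf hq, ?_⟩
    change τ (e' (f q)) ∈ e.target
    rw [hfg q hq, hτg _ (e.map_source hq)]
    exact e.map_source hq
  refine IsImmersionAtOfComplement.mk_of_charts
    (ContinuousLinearEquiv.equivOfRightInverse τ ι hι).symm e (e' ≫ₕ φ) hx (hmaps x hx) he hmem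
    hmaps ?_
  intro a ha
  have ha' : a ∈ e.target := by simpa using ha
  have h1 : e' (f (e.symm a)) = g a := by
    rw [hfg _ (e.map_target ha'), e.right_inv ha']
  have h2 : φ (e' (f (e.symm a))) = ι a := by
    rw [h1]
    change g a - (g (τ (g a)) - ι (τ (g a))) = ι a
    rw [hτg a ha', sub_sub_cancel]
  have h3 : (ContinuousLinearEquiv.equivOfRightInverse τ ι hι).symm (a, 0) = ι a := by
    simp
  simp only [Function.comp_apply, h3]
  simpa using h2

end CoordinateMaps

/-! ### Truncation of jets and the topology of the jet spaces -/

section Truncation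

variable {B : Type*} [NormedAddCommGroup B] [NormedSpace ℝ B]
  {V : Type*} [NormedAddCommGroup V] [NormedSpace ℝ V]

/-- The Taylor coefficient of order `j ≤ k`, with values in the symmetric multilinear maps. -/
noncomputable def JetModel.component {k j : ℕ} (hj : j < k + 1) :
    JetModel B V k →L[ℝ] symmetricMaps B V j :=
  ContinuousLinearMap.proj (R := ℝ) (φ := fun j : Fin (k + 1) => symmetricMaps B V j) ⟨j, hj⟩

/-- Forgetting the Taylor coefficients of order greater than `k`. -/
noncomputable def JetModel.restrict {k l : ℕ} (h : k ≤ l) : JetModel B V l →L[ℝ] JetModel B V k :=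
  ContinuousLinearMap.pi (R := ℝ) (φ := fun j : Fin (k + 1) => symmetricMaps B V j)
    fun j => JetModel.component (j := j) (by omega)

/-- Extending Taylor coefficients by zero in orders greater than `k`. -/
noncomputable def JetModel.extend (k l : ℕ) : JetModel B V k →L[ℝ] JetModel B V l :=
  ContinuousLinearMap.pi (R := ℝ) (φ := fun j : Fin (l + 1) => symmetricMaps B V j)
    fun j => if h : (j : ℕ) < k + 1 then JetModel.component h else 0

theorem JetModel.restrict_extend {k l : ℕ} (h : k ≤ l) (p : JetModel B V k) :
    JetModel.restrict h (JetModel.extend k l p) = p := by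
  funext j
  have h1 : JetModel.restrict h (JetModel.extend k l p) j =
      (if h : (j : ℕ) < k + 1 then JetModel.component h else 0 :
        JetModel B V k →L[ℝ] symmetricMaps B V (j : ℕ)) p := rfl
  rw [h1, dif_pos j.2]
  rfl

variable {M : Type*} [TopologicalSpace M] [ChartedSpace B M]
  {E : Type*} [TopologicalSpace E] [ChartedSpace (B × V) E] {π : E → M} {x : M}

theorem HasContact.mono {k l : ℕ∞} (h : k ≤ l) {s t : LocalSection B V π x}
    (hst : HasContact l s t) : HasContact k s t :=
  ⟨hst.1, fun c hc i hi => hst.2 c hc i (hi.trans h)⟩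

theorem LocalSection.truncate_jet {k l : ℕ∞} (h : k ≤ l) (s : LocalSection B V π x) :
    (s.jet l).truncate h = s.jet k :=
  LocalSection.jet_eq_iff.2 (HasContact.mono h s.out_jet)

theorem Jet.value_truncate {k l : ℕ∞} (h : k ≤ l) (Θ : Jet B V π l) :
    (Θ.truncate h).value = Θ.value := Θ.out.value_jet

theorem FiberedChart.jetCoords_truncate (c : FiberedChart B V π) {k l : ℕ} (h : k ≤ l)
    (Θ : Jet B V π (l : ℕ∞)) (hΘ : Θ.value ∈ c.total.source) :
    c.jetCoords (Θ.truncate (k := (k : ℕ∞)) (Nat.cast_le.2 h)) =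
      ((c.jetCoords Θ).1, JetModel.restrict h (c.jetCoords Θ).2) :=
  c.jetCoords_jet Θ.out hΘ k

variable [IsFiberedManifold B V π]

theorem Jet.continuous_truncate {k l : ℕ} (h : k ≤ l) :
    Continuous (Jet.truncate (B := B) (V := V) (π := π) (k := (k : ℕ∞)) (l := (l : ℕ∞))
      (Nat.cast_le.2 h)) := by
  refine continuous_iff_continuousAt.2 fun Θ => ?_
  obtain ⟨c, hc⟩ := IsFiberedManifold.exists_chart (B := B) (V := V) (π := π) Θ.value
  have h1 := contMDiffOn_of_coordinates (f := Jet.truncate (k := (k : ℕ∞)) (Nat.cast_le.2 h))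
    (c.jetChart_mem_maximalAtlas Θ)
    (c.jetChart_mem_maximalAtlas (Θ.truncate (k := (k : ℕ∞)) (Nat.cast_le.2 h)))
    (g := fun a => (a.1, JetModel.restrict h a.2))
    (fun Θ' hΘ' => by
      change Jet.value _ ∈ c.total.source
      rw [Jet.value_truncate]; exact hΘ')
    (contDiff_fst.prodMk ((JetModel.restrict (B := B) (V := V) h).contDiff.comp
      contDiff_snd)).contDiffOn
    (fun Θ' hΘ' => c.jetCoords_truncate h Θ' hΘ')
  exact h1.continuousOn.continuousAt ((c.jetChart Θ).open_source.mem_nhds hc)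

theorem Jet.continuous_value {l : ℕ} :
    Continuous (Jet.value (B := B) (V := V) (π := π) (k := (l : ℕ∞))) := by
  refine continuous_iff_continuousAt.2 fun Θ => ?_
  obtain ⟨c, hc⟩ := IsFiberedManifold.exists_chart (B := B) (V := V) (π := π) Θ.value
  have h1 : ContinuousAt (c.jetChart Θ) Θ := (c.jetChart Θ).continuousAt hc
  have h2 : ContinuousAt (fun a : B × JetModel B V l => (a.1, a.2.zeroth)) (c.jetChart Θ Θ) :=
    (continuous_fst.prodMk ((contDiff_zeroth l).continuous.comp continuous_snd)).continuousAt
  have h3 : ContinuousAt c.total.symm (c.total Θ.value) :=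
    c.total.continuousAt_symm (c.total.map_source hc)
  have h4 : ContinuousAt (fun Θ' : Jet B V π (l : ℕ∞) => c.total.symm
      ((c.jetChart Θ Θ').1, (c.jetChart Θ Θ').2.zeroth)) Θ := by
    refine ContinuousAt.comp (g := c.total.symm)
      (f := fun Θ' : Jet B V π (l : ℕ∞) => ((c.jetChart Θ Θ').1, (c.jetChart Θ Θ').2.zeroth)) ?_
      (ContinuousAt.comp (f := c.jetChart Θ) h2 h1)
    have := c.total_value Θ hc
    change ContinuousAt c.total.symm ((c.jetCoords Θ).1, (c.jetCoords Θ).2.zeroth)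
    rwa [this]
  refine h4.congr ?_
  filter_upwards [(c.jetChart Θ).open_source.mem_nhds hc] with Θ' hΘ'
  change c.total.symm ((c.jetCoords Θ').1, (c.jetCoords Θ').2.zeroth) = Θ'.value
  rw [c.total_value Θ' hΘ', c.total.left_inv hΘ']

/-- The jet manifolds are Hausdorff: jets with the same value lie in a common chart. -/
instance [T2Space E] (l : ℕ) : T2Space (Jet B V π (l : ℕ∞)) := by
  refine (t2Space_iff _).2 fun Θ Θ' hne => ?_
  by_cases hv : Θ.value = Θ'.value
  · obtain ⟨c, hc⟩ := IsFiberedManifold.exists_chart (B := B) (V := V) (π := π) Θ.value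
    have hc' : Θ' ∈ (c.jetChart Θ).source := by
      change Jet.value _ ∈ c.total.source
      rwa [← hv]
    have h1 : c.jetChart Θ Θ ≠ c.jetChart Θ Θ' := fun h => hne ((c.jetChart Θ).injOn hc hc' h)
    obtain ⟨u, v, hu, hv, hxu, hyv, huv⟩ := t2_separation h1
    refine ⟨_, _, (c.jetChart Θ).isOpen_inter_preimage hu, (c.jetChart Θ).isOpen_inter_preimage hv,
      ⟨hc, hxu⟩, ⟨hc', hyv⟩, ?_⟩
    exact (huv.preimage _).mono inter_subset_right inter_subset_right
  · obtain ⟨u, v, hu, hv, hxu, hyv, huv⟩ := t2_separation hv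
    exact ⟨_, _, hu.preimage Jet.continuous_value, hv.preimage Jet.continuous_value, hxu, hyv,
      huv.preimage _⟩

theorem Jet.continuous_truncate_top (l : ℕ) :
    Continuous (Jet.truncate (B := B) (V := V) (π := π) (k := (l : ℕ∞)) (l := ⊤) le_top) :=
  continuous_iInf_dom (i := l) continuous_induced_dom

omit [IsFiberedManifold B V π] in
theorem LocalSection.jet_top_eq {x' : M} {s : LocalSection B V π x} {t : LocalSection B V π x'}
    (h : ∀ l : ℕ, s.jet (l : ℕ∞) = t.jet (l : ℕ∞)) : s.jet ⊤ = t.jet ⊤ := by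
  have hx : x = x' := congrArg Jet.base (h 0)
  subst hx
  refine LocalSection.jet_eq_iff.2 ⟨(LocalSection.jet_eq_iff.1 (h 0)).1, fun c hc i _ => ?_⟩
  exact (LocalSection.jet_eq_iff.1 (h i)).2 c hc i le_rfl

/-- The truncations of finite order separate the points of `J^∞ π`. -/
instance [T2Space E] : T2Space (Jet B V π ⊤) := by
  refine T2Space.of_injective_continuous
    (f := fun (Θ : Jet B V π ⊤) (l : ℕ) => Θ.truncate (k := (l : ℕ∞)) le_top) ?_
    (continuous_pi Jet.continuous_truncate_top)
  intro Θ Θ' h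
  rw [← Θ.jet_out, ← Θ'.jet_out]
  exact LocalSection.jet_top_eq fun l => congrFun h l

end Truncation

/-! ### The coordinate expression of `∇_[r]` -/

section BracketCoordinates

variable {B : Type*} [NormedAddCommGroup B] [NormedSpace ℝ B]
  {V : Type*} [NormedAddCommGroup V] [NormedSpace ℝ V]
  {M : Type*} [TopologicalSpace M] [ChartedSpace B M]
  {E : Type*} [TopologicalSpace E] [ChartedSpace (B × V) E] {π : E → M}
  [IsFiberedManifold B V π] {k : ℕ} {nabla : JetConnection B V π k}

/-- In coordinates, the derivatives of the solution through `θ` are the total derivatives of the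
coordinates of order zero, evaluated at the coordinates of `θ`. -/
theorem Connection.IsSolutionThrough.iteratedFDeriv_rep {θ : Jet B V π (k : ℕ∞)}
    {s : LocalSection B V π θ.base} (hs : nabla.IsSolutionThrough θ s) (c : FiberedChart B V π)
    (θ₀ : Jet B V π (k : ℕ∞)) (hθ : θ.value ∈ c.total.source) (j : ℕ) :
    iteratedFDeriv ℝ j (c.rep s) (c.base θ.base) =
      totalDeriv (nabla.coeff (c.prolong θ₀)) (fun a : B × JetModel B V k => a.2.zeroth) j
        (c.jetCoords θ) := by
  obtain ⟨h1, h2, h3⟩ := hs.rep c θ₀ hθ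
  have h4 : (fun z => (taylorCoeff k (c.rep s) z).zeroth) =ᶠ[𝓝 (c.base θ.base)] c.rep s := by
    filter_upwards [c.eventually_contDiffAt_rep s h1] with z hz
    exact taylorCoeff_zeroth hz
  have h5 := iteratedFDeriv_eventuallyEq_totalDeriv
    (g := fun a : B × JetModel B V k => a.2.zeroth) (c.prolong θ₀).total.open_target
    (nabla.contDiffOn_coeff (c.prolong θ₀))
    ((contDiff_zeroth k).comp contDiff_snd).contDiffOn h3
    (by rw [h2]; exact (c.prolong θ₀).total.map_source hθ) j
  rw [← (h4.iteratedFDeriv ℝ j).eq_of_nhds, h5.eq_of_nhds, h2]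

variable (nabla) in
/-- The coordinate expression of `∇_[l - k]`. -/
noncomputable def Connection.bracketRep (c : FiberedChart B V π) (θ₀ : Jet B V π (k : ℕ∞)) (l : ℕ)
    (a : B × JetModel B V k) : B × JetModel B V l :=
  (a.1, fun j => symmetrize j (totalDeriv (nabla.coeff (c.prolong θ₀))
    (fun a : B × JetModel B V k => a.2.zeroth) j a))

theorem Connection.contDiffOn_bracketRep (c : FiberedChart B V π) (θ₀ : Jet B V π (k : ℕ∞))
    (l : ℕ) : ContDiffOn ℝ ∞ (nabla.bracketRep c θ₀ l) (c.prolong θ₀).total.target := by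
  refine contDiffOn_fst.prodMk (JetModel.contDiffOn_iff.2 fun j => ?_)
  exact ((symmetricMaps B V j).subtypeL.contDiff.comp (ContinuousLinearMap.contDiff (𝕜 := ℝ)
    (E := B [×j]→L[ℝ] V) (F := symmetricMaps B V j) (symmetrize (j : ℕ)))).comp_contDiffOn
    (contDiffOn_totalDeriv (c.prolong θ₀).total.open_target
    (nabla.contDiffOn_coeff (c.prolong θ₀))
    ((contDiff_zeroth k).comp contDiff_snd).contDiffOn j)

end BracketCoordinates

/-! ### `∇_[r]` is a closed embedding -/

section BracketSmooth

variable {B : Type*} [NormedAddCommGroup B] [NormedSpace ℝ B] [FiniteDimensional ℝ B]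
  {V : Type*} [NormedAddCommGroup V] [NormedSpace ℝ V] [CompleteSpace V]
  {M : Type*} [TopologicalSpace M] [T2Space M] [ChartedSpace B M] [IsManifold 𝓘(ℝ, B) ∞ M]
  {E : Type*} [TopologicalSpace E] [ChartedSpace (B × V) E] {π : E → M}
  [IsFiberedManifold B V π] {k : ℕ} {nabla : JetConnection B V π k}

variable (hflat : nabla.IsFlat) (hhol : nabla.IsHolonomic)
include hflat hhol

theorem Connection.value_bracket (l : ℕ∞) (θ : Jet B V π (k : ℕ∞)) :
    (nabla.bracket l θ).value = θ.value := by
  obtain ⟨s, hs⟩ := nabla.exists_isSolutionThrough hflat hhol θ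
  rw [nabla.bracket_eq_jet hs, s.value_jet, ← s.value_jet (k := (k : ℕ∞)), hs.1]

theorem Connection.truncate_bracket {l l' : ℕ∞} (h : l ≤ l') (θ : Jet B V π (k : ℕ∞)) :
    (nabla.bracket l' θ).truncate h = nabla.bracket l θ := by
  obtain ⟨s, hs⟩ := nabla.exists_isSolutionThrough hflat hhol θ
  rw [nabla.bracket_eq_jet hs, nabla.bracket_eq_jet hs, s.truncate_jet]

theorem Connection.bracket_self (θ : Jet B V π (k : ℕ∞)) : nabla.bracket (k : ℕ∞) θ = θ := by
  obtain ⟨s, hs⟩ := nabla.exists_isSolutionThrough hflat hhol θ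
  rw [nabla.bracket_eq_jet hs, hs.1]

theorem Connection.jetCoords_bracket (c : FiberedChart B V π) (θ₀ : Jet B V π (k : ℕ∞)) (l : ℕ)
    {θ : Jet B V π (k : ℕ∞)} (hθ : θ.value ∈ c.total.source) :
    c.jetCoords (nabla.bracket (l : ℕ∞) θ) = nabla.bracketRep c θ₀ l (c.jetCoords θ) := by
  obtain ⟨s, hs⟩ := nabla.exists_isSolutionThrough hflat hhol θ
  rw [nabla.bracket_eq_jet hs, c.jetCoords_jet s (hs.rep c θ₀ hθ).1]
  refine Prod.ext rfl ?_
  funext j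
  exact congrArg (symmetrize (j : ℕ)) (hs.iteratedFDeriv_rep c θ₀ hθ j)

theorem Connection.contMDiff_bracket (l : ℕ) :
    ContMDiff 𝓘(ℝ, B × JetModel B V k) 𝓘(ℝ, B × JetModel B V l) ∞ (nabla.bracket (l : ℕ∞)) := by
  intro θ
  obtain ⟨c, hc⟩ := IsFiberedManifold.exists_chart (B := B) (V := V) (π := π) θ.value
  refine (contMDiffOn_of_coordinates (c.jetChart_mem_maximalAtlas θ)
    (c.jetChart_mem_maximalAtlas (nabla.bracket (l : ℕ∞) θ)) (fun θ' hθ' => ?_)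
    (nabla.contDiffOn_bracketRep c θ l)
    (fun θ' hθ' => nabla.jetCoords_bracket hflat hhol c θ l hθ')).contMDiffAt
    ((c.jetChart θ).open_source.mem_nhds hc)
  change Jet.value _ ∈ c.total.source
  rw [nabla.value_bracket hflat hhol]
  exact hθ'

theorem Connection.isImmersion_bracket {l : ℕ} (h : k ≤ l) :
    IsImmersion 𝓘(ℝ, B × JetModel B V k) 𝓘(ℝ, B × JetModel B V l) ∞
      (nabla.bracket (l : ℕ∞)) := by
  -- in jet coordinates, `∇_[l - k]` is a section of the linear truncation `τ`
  let τ : B × JetModel B V l →L[ℝ] B × JetModel B V k :=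
    (ContinuousLinearMap.id ℝ B).prodMap (JetModel.restrict h)
  let ι : B × JetModel B V k →L[ℝ] B × JetModel B V l :=
    (ContinuousLinearMap.id ℝ B).prodMap (JetModel.extend k l)
  have hι : Function.RightInverse ι τ := fun a => Prod.ext rfl (JetModel.restrict_extend h a.2)
  refine ⟨τ.ker, inferInstance, inferInstance, fun θ => ?_⟩
  obtain ⟨c, hc⟩ := IsFiberedManifold.exists_chart (B := B) (V := V) (π := π) θ.value
  refine isImmersionAtOfComplement_of_coordinates (c.jetChart_mem_maximalAtlas θ)
    (c.jetChart_mem_maximalAtlas (nabla.bracket (l : ℕ∞) θ)) (fun θ' hθ' => ?_)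
    (nabla.contDiffOn_bracketRep c θ l)
    (fun θ' hθ' => nabla.jetCoords_bracket hflat hhol c θ l hθ') τ ι hι (fun a ha => ?_) hc
  · change Jet.value _ ∈ c.total.source
    rw [nabla.value_bracket hflat hhol]
    exact hθ'
  · set θ' := (c.jetChart θ).symm a with hθ'def
    have hθ' : θ'.value ∈ c.total.source := (c.jetChart θ).map_target ha
    have ha' : c.jetCoords θ' = a := (c.jetChart θ).right_inv ha
    rw [← ha', ← nabla.jetCoords_bracket hflat hhol c θ l hθ']
    refine (c.jetCoords_truncate h _ ?_).symm.trans ?_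
    · rwa [nabla.value_bracket hflat hhol]
    · rw [nabla.truncate_bracket hflat hhol, nabla.bracket_self hflat hhol]

/-- `∇_[l - k]` is a continuous section of the continuous truncation `J^l π → J^k π`. -/
theorem Connection.isClosedEmbedding_bracket [T2Space E] {l : ℕ} (h : k ≤ l) :
    IsClosedEmbedding (nabla.bracket (l : ℕ∞)) := by
  have h1 : Function.LeftInverse (Jet.truncate (k := (k : ℕ∞)) (Nat.cast_le.2 h))
      (nabla.bracket (l : ℕ∞)) := fun θ => by
    rw [nabla.truncate_bracket hflat hhol, nabla.bracket_self hflat hhol]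
  exact h1.isClosedEmbedding (Jet.continuous_truncate h)
    (nabla.contMDiff_bracket hflat hhol l).continuous

theorem Connection.isSmoothClosedEmbeddingInfty_bracket [T2Space E] :
    IsSmoothClosedEmbeddingInfty (B × JetModel B V k) (nabla.bracket ⊤) := by
  have h1 : ∀ l : ℕ, (fun θ => (nabla.bracket ⊤ θ).truncate (k := (l : ℕ∞)) le_top) =
      nabla.bracket (l : ℕ∞) := fun l => funext (nabla.truncate_bracket hflat hhol le_top)
  refine ⟨fun l => ?_, fun θ => ⟨k, ?_⟩, ?_⟩
  · rw [h1]
    exact nabla.contMDiff_bracket hflat hhol l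
  -- the truncation of order `k` is the identity
  · rw [h1]
    exact (nabla.isImmersion_bracket hflat hhol le_rfl).isImmersionAt θ
  · have h2 : Function.LeftInverse (Jet.truncate (k := (k : ℕ∞)) le_top) (nabla.bracket ⊤) :=
      fun θ => by rw [nabla.truncate_bracket hflat hhol, nabla.bracket_self hflat hhol]
    refine h2.isClosedEmbedding (Jet.continuous_truncate_top k) ?_
    refine continuous_iInf_rng.2 fun l => continuous_induced_rng.2 ?_
    change Continuous fun θ => (nabla.bracket ⊤ θ).truncate (k := (l : ℕ∞)) le_top
    rw [h1]
    exact (nabla.contMDiff_bracket hflat hhol l).continuous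

end BracketSmooth

/-! ### The coordinate formula -/

section CoordinateFormula

variable {n m : ℕ} {M : Type*} [TopologicalSpace M] [ChartedSpace (Rn n) M]
  {E : Type*} [TopologicalSpace E] [ChartedSpace (Rn n × Rn m) E]
  {π : E → M} [IsFiberedManifold (Rn n) (Rn m) π] {k : ℕ}

/-- The tuple of coordinate vectors with the given indices. -/
noncomputable def basisTuple (I : List (Fin n)) (j : Fin I.length) : Rn n :=
  EuclideanSpace.single (I.get j) 1

theorem FiberedChart.fieldRep_coordField (c : FiberedChart (Rn n) (Rn m) π) (i : Fin n)
    (θ₀ : Jet (Rn n) (Rn m) π (k : ℕ∞)) {z : Rn n} (hz : z ∈ c.base.target) :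
    (c.prolong θ₀).fieldRep (c.coordField i) z = EuclideanSpace.single i 1 := by
  have hd := mdifferentiable_of_mem_maximalAtlas c.base_mem
  have hy := c.base.map_target hz
  have h := (c.prolong θ₀).fieldRep_base (c.coordField i) hy
  change (c.prolong θ₀).fieldRep (c.coordField i) (c.base (c.base.symm z)) = _ at h
  rw [c.base.right_inv hz] at h
  rw [h]
  exact (hd.mfderiv hy).apply_symm_apply (EuclideanSpace.single i (1 : ℝ) : Rn n)

/-- Iterated derivatives along the horizontal lifts of the coordinate fields are total
derivatives. -/
theorem Connection.iterDerivAlong_coord (nabla : JetConnection (Rn n) (Rn m) π k)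
    (c : FiberedChart (Rn n) (Rn m) π) (θ₀ : Jet (Rn n) (Rn m) π (k : ℕ∞)) (α : Fin m)
    (I : List (Fin n)) : ∀ {θ : Jet (Rn n) (Rn m) π (k : ℕ∞)}, θ.value ∈ c.total.source →
    nabla.iterDerivAlong c I (c.coord [] α) θ =
      totalDeriv (nabla.coeff (c.prolong θ₀))
        (fun a : Rn n × JetModel (Rn n) (Rn m) k => a.2.zeroth) I.length (c.jetCoords θ)
        (basisTuple I) α := by
  induction I with
  | nil =>
    intro θ hθ
    have h1 := congrArg Prod.snd (c.total_value θ hθ)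
    have h2 := congrArg Prod.snd (c.total_eq θ.out hθ)
    change c.rep θ.out (c.base θ.base) α = (c.jetCoords θ).2.zeroth α
    exact congrArg (fun u : Rn m => u α) (h2.trans h1.symm)
  | cons i I ih =>
    intro θ hθ
    set C := c.prolong θ₀ with hC
    set T := totalDeriv (nabla.coeff C)
      (fun a : Rn n × JetModel (Rn n) (Rn m) k => a.2.zeroth) I.length with hT
    have hθ' : θ ∈ C.total.source := hθ
    have ha : C.total θ ∈ C.total.target := C.total.map_source hθ'
    have hTd : HasFDerivAt T (fderiv ℝ T (C.total θ)) (C.total θ) :=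
      (((contDiffOn_totalDeriv C.total.open_target (nabla.contDiffOn_coeff C)
        ((contDiff_zeroth k).comp contDiff_snd).contDiffOn I.length).contDiffAt
        (C.total.open_target.mem_nhds ha)).differentiableAt (by simp)).hasFDerivAt
    let L : (Rn n [×I.length]→L[ℝ] Rn m) →L[ℝ] ℝ :=
      (EuclideanSpace.proj α : Rn m →L[ℝ] ℝ).comp
        (ContinuousMultilinearMap.apply ℝ (fun _ : Fin I.length => Rn n) (Rn m) (basisTuple I))
    have hF : HasFDerivAt (fun a => L (T a)) (L.comp (fderiv ℝ T (C.total θ))) (C.total θ) :=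
      L.hasFDerivAt.comp _ hTd
    -- the induction hypothesis holds near `θ`, so that it may be differentiated
    have hev : nabla.iterDerivAlong c I (c.coord [] α) =ᶠ[𝓝 θ] (fun a => L (T a)) ∘ C.total := by
      filter_upwards [C.total.open_source.mem_nhds hθ'] with θ' h
      exact ih h
    have hCd : MDifferentiableAt 𝓘(ℝ, Rn n × JetModel (Rn n) (Rn m) k)
        𝓘(ℝ, Rn n × JetModel (Rn n) (Rn m) k) C.total θ :=
      (mdifferentiable_of_mem_maximalAtlas C.total_mem).mdifferentiableAt hθ'
    have h1 := mfderiv_comp θ (g := fun a => L (T a)) hF.hasMFDerivAt.mdifferentiableAt hCd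
    rw [← hev.mfderiv_eq, hF.hasMFDerivAt.mfderiv] at h1
    have h2 : nabla.iterDerivAlong c (i :: I) (c.coord [] α) θ =
        L (fderiv ℝ T (C.total θ) (mfderiv 𝓘(ℝ, Rn n × JetModel (Rn n) (Rn m) k)
          𝓘(ℝ, Rn n × JetModel (Rn n) (Rn m) k) C.total θ (nabla.lift (c.coordField i) θ))) :=
      congrArg (fun φ => φ (nabla.lift (c.coordField i) θ)) h1
    have h3 : nabla.liftRep C (c.coordField i) (C.total θ) =
        (EuclideanSpace.single i 1, nabla.coeff C (C.total θ) (EuclideanSpace.single i 1)) := by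
      rw [Connection.liftRep, c.fieldRep_coordField i θ₀ (C.fst_mem_target ha)]
    rw [h2, nabla.mfderiv_total_lift C _ hθ', h3]
    rfl

variable [T2Space M] [IsManifold 𝓘(ℝ, Rn n) ∞ M]

theorem Connection.coord_bracket {nabla : JetConnection (Rn n) (Rn m) π k}
    (hflat : nabla.IsFlat) (hhol : nabla.IsHolonomic) (c : FiberedChart (Rn n) (Rn m) π)
    {θ : Jet (Rn n) (Rn m) π (k : ℕ∞)} (hθ : θ.value ∈ c.total.source) {l : ℕ∞}
    (I : List (Fin n)) (α : Fin m) (hI : (I.length : ℕ∞) ≤ l) :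
    c.coord I α (nabla.bracket l θ) = nabla.iterDerivAlong c I (c.coord [] α) θ := by
  obtain ⟨s, hs⟩ := nabla.exists_isSolutionThrough hflat hhol θ
  have h1 : (s.jet l).out θ.base ∈ c.total.source := by
    rw [show (s.jet l).out θ.base = s θ.base from s.value_jet]
    exact (hs.rep c θ hθ).1
  have h2 := (s.out_jet (k := l)).2 c h1 I.length hI
  rw [nabla.iterDerivAlong_coord c θ α I hθ, ← hs.iteratedFDeriv_rep c θ hθ,
    nabla.bracket_eq_jet hs]
  exact congrArg (fun q => q (basisTuple I) α) h2

end CoordinateFormula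

end JetBundle

theorem mainTheorem7 {n m : ℕ}
    {M : Type*} [TopologicalSpace M] [T2Space M] [SecondCountableTopology M]
    [ChartedSpace (Rn n) M] [IsManifold 𝓘(ℝ, Rn n) ∞ M]
    {E : Type*} [TopologicalSpace E] [T2Space E] [SecondCountableTopology E]
    [ChartedSpace (Rn n × Rn m) E] [IsManifold 𝓘(ℝ, Rn n × Rn m) ∞ E]
    (π : E → M) [IsSmoothFiberBundle (Rn n) (Rn m) π] (k : ℕ)
    (nabla : JetConnection (Rn n) (Rn m) π k)
    (hflat : nabla.IsFlat) (hhol : nabla.IsHolonomic) :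
    -- through every `θ` there is a `∇`-constant solution, and its germ is unique
    (∀ θ, ∃ s, nabla.IsSolutionThrough θ s ∧
      ∀ t, nabla.IsSolutionThrough θ t → t.toFun =ᶠ[𝓝 θ.base] s.toFun) ∧
    -- `∇_[r]` sends `θ` to the `(k + r)`-jet of this solution
    (∀ (l : ℕ∞) θ s, nabla.IsSolutionThrough θ s → nabla.bracket l θ = s.jet l) ∧
    -- `∇_[r]` is a smooth closed embedding for `r < ∞` ...
    (∀ r : ℕ,
      IsSmoothEmbedding 𝓘(ℝ, Rn n × JetModel (Rn n) (Rn m) k)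
        𝓘(ℝ, Rn n × JetModel (Rn n) (Rn m) (k + r)) ∞ (nabla.bracket ((k + r : ℕ) : ℕ∞)) ∧
      IsClosed (range (nabla.bracket ((k + r : ℕ) : ℕ∞)))) ∧
    -- ... and for `r = ∞`
    IsSmoothClosedEmbeddingInfty (Rn n × JetModel (Rn n) (Rn m) k) (nabla.bracket ⊤) ∧
    -- in fibered charts, `∇_[r]^* u^α_I = ∇_I u^α` for `|I| ≤ k + r`, `0 ≤ r ≤ ∞`
    (∀ (r : ℕ∞) (c : FiberedChart (Rn n) (Rn m) π) (θ : Jet (Rn n) (Rn m) π (k : ℕ∞)),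
      θ.value ∈ c.total.source →
      (nabla.bracket (k + r) θ).base = θ.base ∧
      (nabla.bracket (k + r) θ).value ∈ c.total.source ∧
      ∀ (I : List (Fin n)) (α : Fin m), (I.length : ℕ∞) ≤ k + r →
        c.coord I α (nabla.bracket (k + r) θ) = nabla.iterDerivAlong c I (c.coord [] α) θ) := by
  refine ⟨fun θ => ?_, fun l θ s hs => nabla.bracket_eq_jet hs l, fun r => ?_,
    nabla.isSmoothClosedEmbeddingInfty_bracket hflat hhol, fun r c θ hθ => ⟨rfl, ?_, ?_⟩⟩
  · obtain ⟨s, hs⟩ := nabla.exists_isSolutionThrough hflat hhol θ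
    exact ⟨s, hs, fun t ht => hs.eventuallyEq ht⟩
  · have h := nabla.isClosedEmbedding_bracket hflat hhol (Nat.le_add_right k r)
    exact ⟨⟨nabla.isImmersion_bracket hflat hhol (Nat.le_add_right k r), h.isEmbedding⟩,
      h.isClosed_range⟩
  · rwa [nabla.value_bracket hflat hhol]
  · exact fun I α hI => nabla.coord_bracket hflat hhol c hθ I α hI
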